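/- Let $(\mathcal A,\varphi)$ be a tracial C*-probability space, that is, a unital C*-algebra with a faithful tracial state (for instance a von Neumann algebra with a faithful normal tracial state), and let $S=(S_t)_{t\ge 0}$ be a free Brownian motion in it: $S_0=0$, the $S_t$ are self-adjoint, the increments are freely independent, and $S_t-S_s$ has the centered semicircular law $\mathcal S(0,t-s)$ with variance $t-s$ for $s\le t$. Let $L^2_s(\mathbb R_+^2)$ be the set of real functions $f\in L^2(\mathbb R_+^2)$ with $f(x,y)=f(y,x)$ almost everywhere. For $f\in L^2_s(\mathbb R_+^2)$ let $I_2^S(f)$ be the double Wigner integral of $f$, that is, the value at $f$ of the isometric extension to $L^2(\mathbb R_+^2)\to L^2(\varphi)$ of the linear map sending $\mathbf 1_{(s,t]\times(u,v]}$ to $(S_t-S_s)(S_v-S_u)$ whenever $(s,t]\cap(u,v]=\emptyset$. The second (symmetric) Wigner chaos of $S$ is the set of all $I_2^S(f)$, $f\in L^2_s(\mathbb R_+^2)$, viewed as elements of $\mathcal A$. Laws are understood through moments: $F_n$ converges in law to $F_\infty$ if all moments of $F_n$ converge to those of $F_\infty$, and two variables are equal in law if all their moments coincide. Let $\{F_n\}_{n\ge1}$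 be a sequence in the second Wigner chaos of $S$ that converges in law to a random variable $F_\infty$ (in some noncommutative probability space, possibly different from $(\mathcal A,\varphi)$). Then there exist $\lambda_0\in\mathbb R$ and $f\in L^2_s(\mathbb R_+^2)$, with $I_2^S(f)\in\mathcal A$, such that $$F_\infty \overset{\rm law}{=} A + I_2^S(f),$$ where $A$ has the centered semicircular law $\mathcal S(0,\lambda_0^2)$ with variance $\lambda_0^2$ and is freely independent of $S$. Here $A$ is an element of some tracial C*-probability space $(\mathcal B,\psi)$ containing $(\mathcal A,\varphi)$, i.e. there is a unital *-homomorphism $j:\mathcal A\to\mathcal B$ with $\psi\circ j=\varphi$, through which $S$ and $I_2^S(f)$ are regarded as elements of $\mathcal B$. -/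

import Mathlib

open MeasureTheory Filter Topology
open scoped NNReal ENNReal

universe u v

namespace FreeProb

/-- `φ` is a faithful tracial state on the C*-algebra `A`, so that `(A, φ)` is a tracial
C*-probability space.  (Every von Neumann algebra with a faithful normal tracial state is one.) -/
structure IsFaithfulTracialState {A : Type u} [CStarAlgebra A] (φ : A →ₗ[ℂ] ℂ) : Prop where
  map_one : φ 1 = 1
  nonneg : ∀ x : A, ∃ r : ℝ, 0 ≤ r ∧ φ (star x * x) = (r : ℂ)
  trace : ∀ x y : A, φ (x * y) = φ (y * x)
  faithful : ∀ x : A, φ (star x * x) = 0 → x = 0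

/-- The `L²(φ)`-norm `φ(x* x)^{1/2}`. -/
noncomputable def l2Norm {A : Type u} [CStarAlgebra A] (φ : A →ₗ[ℂ] ℂ) (x : A) : ℝ :=
  Real.sqrt (φ (star x * x)).re

/-- Equality in law of a variable `X` of the noncommutative probability space `(C, τ)` and a
variable `Y` of `(B, ψ)`: all moments coincide. -/
def EqualInLaw {C : Type v} [Ring C] [Algebra ℂ C] (τ : C →ₗ[ℂ] ℂ) (X : C)
    {B : Type u} [Ring B] [Algebra ℂ B] (ψ : B →ₗ[ℂ] ℂ) (Y : B) : Prop :=
  ∀ k : ℕ, τ (X ^ k) = ψ (Y ^ k)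

/-- Convergence in law of the variables `F n` of `(A, φ)` to the variable `X` of `(C, τ)`:
all moments converge. -/
def ConvergesInLaw {A : Type u} [Ring A] [Algebra ℂ A] (φ : A →ₗ[ℂ] ℂ) (F : ℕ → A)
    {C : Type v} [Ring C] [Algebra ℂ C] (τ : C →ₗ[ℂ] ℂ) (X : C) : Prop :=
  ∀ k : ℕ, Tendsto (fun n => φ (F n ^ k)) atTop (𝓝 (τ (X ^ k)))

/-- Free independence of a family of unital subalgebras: `φ (a₁ ⋯ aₙ) = 0` whenever `n ≥ 1`, all
`aⱼ` are centered, and neighbouring `aⱼ` come from subalgebras with different indices. -/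
def FreelyIndependent {A : Type u} [Ring A] [Algebra ℂ A] (φ : A →ₗ[ℂ] ℂ)
    {ι : Type*} (B : ι → Subalgebra ℂ A) : Prop :=
  ∀ l : List (ι × A), l ≠ [] → l.IsChain (fun p q => p.1 ≠ q.1) →
    (∀ p ∈ l, p.2 ∈ B p.1 ∧ φ p.2 = 0) → φ (l.map Prod.snd).prod = 0

/-- `a` is a self-adjoint variable with the centered semicircular law `𝒮(0, w)`: its odd moments
vanish and its moment of order `2m` is `Cₘ wᵐ`, where `Cₘ` is the `m`-th Catalan number.  (For
`w > 0` these are the moments of the density `√(4w - x²) / (2πw)` on `[-2√w, 2√w]`; for `w = 0`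
they are those of the point mass at zero.) -/
def IsSemicircular {A : Type u} [CStarAlgebra A] (φ : A →ₗ[ℂ] ℂ) (a : A) (w : ℝ) : Prop :=
  IsSelfAdjoint a ∧
    ∀ m : ℕ, φ (a ^ (2 * m)) = (catalan m : ℂ) * (w : ℂ) ^ m ∧ φ (a ^ (2 * m + 1)) = 0

/-- A free Brownian motion `(S t)_{t ≥ 0}` in `(A, φ)`: it consists of self-adjoint elements, starts
at zero, and has freely independent increments, with `S t - S s ∼ 𝒮(0, t - s)` for `s ≤ t`. -/
structure IsFreeBrownianMotion {A : Type u} [CStarAlgebra A] (φ : A →ₗ[ℂ] ℂ)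
    (S : ℝ≥0 → A) : Prop where
  zero : S 0 = 0
  selfAdjoint : ∀ t, IsSelfAdjoint (S t)
  semicircular : ∀ s t : ℝ≥0, s ≤ t → IsSemicircular φ (S t - S s) ((t : ℝ) - (s : ℝ))
  free_increments : ∀ t : ℕ → ℝ≥0, Monotone t →
    FreelyIndependent φ fun k : ℕ => Algebra.adjoin ℂ {S (t (k + 1)) - S (t k)}

/-- Lebesgue measure on the quadrant `ℝ₊²`, as a measure on `ℝ × ℝ`. -/
noncomputable def quadrant : Measure (ℝ × ℝ) :=
  (volume : Measure (ℝ × ℝ)).restrict (Set.Ici 0 ×ˢ Set.Ici 0)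

/-- `f` represents an element of `L²_s(ℝ₊²)`: it is real valued, square integrable on `ℝ₊²`, and
symmetric almost everywhere. -/
def IsSymmL2 (f : ℝ × ℝ → ℝ) : Prop :=
  MemLp f 2 quadrant ∧ ∀ᵐ p ∂quadrant, f p.swap = f p

/-- A rectangle `(s, t] × (u, v]` in `ℝ₊²` that does not meet the diagonal. -/
structure OffDiagRect where
  s : ℝ≥0
  t : ℝ≥0
  u : ℝ≥0
  v : ℝ≥0
  le_st : s ≤ t
  le_uv : u ≤ v
  disjoint : Disjoint (Set.Ioc s t) (Set.Ioc u v)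

/-- The rectangle as a set of points of the plane. -/
def OffDiagRect.toSet (R : OffDiagRect) : Set (ℝ × ℝ) :=
  Set.Ioc (R.s : ℝ) R.t ×ˢ Set.Ioc (R.u : ℝ) R.v

/-- The off-diagonal step function `∑ c_R 1_R`. -/
noncomputable def stepFun (g : OffDiagRect →₀ ℝ) (p : ℝ × ℝ) : ℝ :=
  g.sum fun R c => c * R.toSet.indicator (fun _ => (1 : ℝ)) p

/-- The double Wigner integral `∑ c_R (S t - S s) (S v - S u)` of the off-diagonal step function
`∑ c_R 1_R`, where `R = (s, t] × (u, v]`. -/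
noncomputable def stepIntegral {A : Type u} [CStarAlgebra A] (S : ℝ≥0 → A)
    (g : OffDiagRect →₀ ℝ) : A :=
  g.sum fun R c => (c : ℂ) • ((S R.t - S R.s) * (S R.v - S R.u))

/-- `F` is the double Wigner integral `I₂ˢ(f) = ∫∫ f(x, y) dS_x dS_y`: the pair `(f, F)` is a limit,
in `L²(ℝ₊²) × L²(φ)`, of pairs (off-diagonal step function, its double Wigner integral).  As the
integral of off-diagonal step functions is an isometry from `L²(ℝ₊²)` to `L²(φ)` and `φ` is
faithful, `F` is determined by `f`. -/
def IsDoubleWignerIntegral {A : Type u} [CStarAlgebra A] (φ : A →ₗ[ℂ] ℂ) (S : ℝ≥0 → A)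
    (f : ℝ × ℝ → ℝ) (F : A) : Prop :=
  MemLp f 2 quadrant ∧ ∀ ε : ℝ, 0 < ε → ∃ g : OffDiagRect →₀ ℝ,
    eLpNorm (fun p => f p - stepFun g p) 2 quadrant < ENNReal.ofReal ε ∧
    l2Norm φ (F - stepIntegral S g) < ε

/-- The (symmetric) second Wigner chaos of `S`: all `I₂ˢ(f)` with `f ∈ L²_s(ℝ₊²)`. -/
def secondWignerChaos {A : Type u} [CStarAlgebra A] (φ : A →ₗ[ℂ] ℂ) (S : ℝ≥0 → A) : Set A :=
  {F | ∃ f : ℝ × ℝ → ℝ, IsSymmL2 f ∧ IsDoubleWignerIntegral φ S f F}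

end FreeProb

/-!
An element of the second chaos is, up to a small error in operator norm, the integral of a symmetric
off-diagonal step function, and over a grid adapted to the step function such an integral is a
Wick-ordered quadratic form `∑ c i j (X i X j - δ i j w i)` in free semicircular variables `X i`,
the increments, with a real symmetric matrix `c`. The law of such a form is found without the
combinatorics of noncrossing partitions: on the algebraic Fock space the field operators commute
with right creation operators except on the vacuum, and the resulting Schwinger-Dyson equations
solve the moment-cumulant recursion with the traces of powers of `c * diagonal w` as cumulants
(`hasFreeCumulants_vacuumState_wickForm`). Free semicircular variables in any tracial C*-probability
space reproduce the Fock model through their Wick products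
(`IsFreeSemicircularFamily.apply_wickMap`), which also shows that algebras generated by disjoint
blocks of the family are free. So the cumulant of order `r ≥ 2` of a symmetric step integral is the
power sum `∑ λ i ^ r` of the eigenvalues. This bounds all moments, hence the norm of a quadratic
form by a multiple of its `L²` norm; that is why `L²` approximation by step integrals is
approximation in norm (`IsFreeBrownianMotion.exists_stepIntegral_near`).

The moment-cumulant recursion is triangular and affine in the cumulants, so convergence of the
moments forces convergence of the cumulants (`HasFreeCumulants.tendsto`). The eigenvalues, sorted by
decreasing absolute value, have a limit `z` along an ultrafilter. The power sums of order at least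
three converge to those of `z`, while the sums of squares may lose mass: their limit is
`s ^ 2 + ∑ z k ^ 2` (`exists_limit_power_sums`). Hence the limit law has the cumulants of a
semicircular variable of variance `s ^ 2` plus a free sum `∑ z k (X k ^ 2 - 1)`
(`IsFreeBrownianMotion.exists_chaosCumulant`).

To realise this law, let `f` be the function with the value `z k` on the square `(k, k + 1]²`. Its
double integral `I` is the norm limit of `∑ z k ((S (k + 1) - S k) ^ 2 - 1)`, as removing a fine
neighbourhood of the diagonal shows (`IsFreeBrownianMotion.exists_integral_diag`). The semicircular
variable is found in the tracial ultrapower of the algebra, made faithful by the GNS construction,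
as the class of the sequence of increments `S (n + 1) - S n`: each of them is free from the past,
and any finite set of times is eventually in the past
(`IsFreeBrownianMotion.exists_free_semicircular`). The sum of the two variables is the limit of
Wick-ordered forms whose cumulants are explicit, which identifies its law
(`IsFreeBrownianMotion.hasFreeCumulants_chaos`).
-/

namespace FreeProb

open Finset.HasAntidiagonal (antidiagonal)

/-! ### Free cumulants of a sequence of moments -/

/-- `m` is the moment sequence whose free cumulant of order `r + 1` is `κ r`.  With
`M(z) = ∑ mₙ zⁿ`, the moment-cumulant relation is `M = 1 + ∑ κ r z ^ (r + 1) M ^ (r + 1)`; the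
auxiliary array is `t b r = [z ^ b] ∑ κ (r + s) z ^ s M ^ (s + 1)`, the sum being over `s ≥ 0`.
It turns the relation into a recursion which is affine in each new cumulant. -/
def HasFreeCumulants (m κ : ℕ → ℂ) : Prop :=
  ∃ t : ℕ → ℕ → ℂ, m 0 = 1 ∧ (∀ b, t b 0 = m (b + 1)) ∧ (∀ r, t 0 r = κ r) ∧
    ∀ b r, t (b + 1) r = m (b + 1) * κ r +
      ∑ p ∈ antidiagonal b, m p.2 * t p.1 (r + 1)

/-! ### The algebraic full Fock space -/

/-- The algebraic full Fock space over letters indexed by `ℕ`: its basis consists of all words. -/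
def Fock : Type := List ℕ →₀ ℂ

noncomputable instance : AddCommGroup Fock := inferInstanceAs (AddCommGroup (List ℕ →₀ ℂ))

noncomputable instance : Module ℂ Fock := inferInstanceAs (Module ℂ (List ℕ →₀ ℂ))

/-- The basis vector of the Fock space given by a word. -/
noncomputable def word (u : List ℕ) : Fock := (Finsupp.single u 1 : List ℕ →₀ ℂ)

/-- The linear map on the Fock space with prescribed values on words. -/
noncomputable def fockLift {V : Type*} [AddCommGroup V] [Module ℂ V] (f : List ℕ → V) :
    Fock →ₗ[ℂ] V :=
  (Finsupp.linearCombination ℂ f : (List ℕ →₀ ℂ) →ₗ[ℂ] V)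

@[simp]
theorem fockLift_word {V : Type*} [AddCommGroup V] [Module ℂ V] (f : List ℕ → V) (u : List ℕ) :
    fockLift f (word u) = f u :=
  (Finsupp.linearCombination_single ℂ 1 u).trans (one_smul ℂ _)

theorem fock_hom_ext {V : Type*} [AddCommGroup V] [Module ℂ V] {T U : Fock →ₗ[ℂ] V}
    (h : ∀ u, T (word u) = U (word u)) : T = U :=
  Finsupp.lhom_ext' (M := ℂ) fun u => LinearMap.ext_ring (h u)

/-- The semicircular field operator of the letter `i` with variance `w i`: left creation of the
letter `i`, plus `w i` times left annihilation. -/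
noncomputable def field (w : ℕ → ℂ) (i : ℕ) : Module.End ℂ Fock :=
  fockLift fun u => word (i :: u) +
    match u with
    | [] => 0
    | j :: u' => if j = i then w i • word u' else 0

/-- Creation of the letter `i` on the right. -/
noncomputable def rightCreation (i : ℕ) : Module.End ℂ Fock :=
  fockLift fun u => word (u ++ [i])

/-- The vacuum vector, i.e. the empty word. -/
noncomputable def vacuum : Fock := word []

/-- The coefficient of the vacuum vector. -/
noncomputable def vacuumCoeff : Fock →ₗ[ℂ] ℂ := fockLift fun u => if u = [] then 1 else 0

/-- The projection onto the vacuum vector. -/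
noncomputable def vacuumProj : Module.End ℂ Fock :=
  (LinearMap.toSpanSingleton ℂ Fock vacuum).comp vacuumCoeff

/-- The vacuum expectation of an operator on the Fock space. -/
noncomputable def vacuumState : Module.End ℂ Fock →ₗ[ℂ] ℂ :=
  vacuumCoeff.comp (LinearMap.applyₗ vacuum)

theorem vacuumState_apply (T : Module.End ℂ Fock) : vacuumState T = vacuumCoeff (T vacuum) := rfl

theorem field_word_nil (w : ℕ → ℂ) (i : ℕ) :
    field w i (word []) = word [i] := by
  simp [field]

theorem field_word_cons (w : ℕ → ℂ) (i j : ℕ) (u : List ℕ) :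
    field w i (word (j :: u)) = word (i :: j :: u) +
      if j = i then w i • word u else 0 := by
  simp [field]

theorem rightCreation_word (i : ℕ) (u : List ℕ) :
    rightCreation i (word u) = word (u ++ [i]) := by
  simp [rightCreation]

/-- Left field operators commute with right creation operators except on the vacuum vector. -/
theorem field_mul_rightCreation (w : ℕ → ℂ) (i j : ℕ) :
    field w j * rightCreation i =
      rightCreation i * field w j + (if i = j then w i else 0) • vacuumProj := by
  refine fock_hom_ext fun u => ?_
  cases u with
  | nil =>
    simp only [Module.End.mul_apply, LinearMap.add_apply, LinearMap.smul_apply,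
      rightCreation_word, field_word_nil, List.nil_append, field_word_cons]
    by_cases h : i = j <;> simp [vacuumProj, vacuumCoeff, vacuum, h]
  | cons k u =>
    simp only [Module.End.mul_apply, LinearMap.add_apply, LinearMap.smul_apply,
      rightCreation_word, List.cons_append, field_word_cons, map_add]
    by_cases h : k = j <;> simp [vacuumProj, vacuumCoeff, rightCreation_word, h]

theorem vacuumState_mul_proj_mul (T U : Module.End ℂ Fock) :
    vacuumState (T * vacuumProj * U) = vacuumState T * vacuumState U := by
  simp [vacuumState_apply, vacuumProj, mul_comm]

theorem vacuumState_mul_proj (T : Module.End ℂ Fock) :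
    vacuumState (T * vacuumProj) = vacuumState T := by
  simp [vacuumState_apply, vacuumProj, vacuumCoeff, vacuum]

theorem vacuumState_proj_mul (T : Module.End ℂ Fock) :
    vacuumState (vacuumProj * T) = vacuumState T := by
  simp [vacuumState_apply, vacuumProj, vacuumCoeff, vacuum]

theorem vacuumState_one : vacuumState 1 = 1 := by
  simp [vacuumState_apply, vacuumCoeff, vacuum]

theorem vacuumState_rightCreation_mul (i : ℕ) (T : Module.End ℂ Fock) :
    vacuumState (rightCreation i * T) = 0 := by
  have h : vacuumCoeff.comp (rightCreation i) = 0 := by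
    refine fock_hom_ext fun u => ?_
    simp [rightCreation_word, vacuumCoeff]
  exact LinearMap.congr_fun h (T vacuum)

theorem vacuumState_mul_field (w : ℕ → ℂ) (i : ℕ) (T : Module.End ℂ Fock) :
    vacuumState (T * field w i) = vacuumState (T * rightCreation i) := by
  simp [vacuumState_apply, vacuum, field_word_nil, rightCreation_word]

/-- The vacuum expectation of `T * field w i` only involves the commutator of `T` with the right
creation operator.  This is the Schwinger-Dyson equation of a free semicircular family. -/
theorem vacuumState_mul_field_of_comm (w : ℕ → ℂ) (i : ℕ) {T D : Module.End ℂ Fock}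
    (h : T * rightCreation i = rightCreation i * T + D) :
    vacuumState (T * field w i) = vacuumState D := by
  rw [vacuumState_mul_field, h, map_add, vacuumState_rightCreation_mul, zero_add]

theorem pow_mul_of_comm {R : Type*} [Ring R] {F C D : R} (h : F * C = C * F + D) (k : ℕ) :
    F ^ (k + 1) * C = C * F ^ (k + 1) +
      ∑ p ∈ antidiagonal k, F ^ p.1 * D * F ^ p.2 := by
  induction k with
  | zero => simp [h]
  | succ k ih =>
    rw [Finset.Nat.sum_antidiagonal_succ, pow_succ' F (k + 1), mul_assoc, ih, mul_add,
      ← mul_assoc, h, add_mul, Finset.mul_sum, mul_assoc C]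
    simp only [pow_zero, one_mul, pow_succ' F, mul_assoc, add_assoc]

/-- The variable `d Xₙ + ∑ c i j (X i X j - δ i j w i)`, the sum running over `i, j < n`, in an
algebra.  The quadratic part is the Wick-ordered quadratic form with coefficient matrix `c`. -/
noncomputable def wickForm {A : Type*} [Ring A] [Algebra ℂ A] (X : ℕ → A) (w : ℕ → ℂ) {n : ℕ}
    (c : Matrix (Fin n) (Fin n) ℂ) (d : ℂ) : A :=
  d • X n + ∑ i : Fin n, ∑ j : Fin n,
    c i j • (X i * X j - (if i = j then w i else 0) • (1 : A))

section Recursion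

variable (w : ℕ → ℂ) {n : ℕ} (c : Matrix (Fin n) (Fin n) ℂ) (d : ℂ)

/-- The letter `n` does not occur in the quadratic part, so only the linear part contributes. -/
theorem wickForm_mul_rightCreation_last :
    wickForm (field w) w c d * rightCreation n =
      rightCreation n * wickForm (field w) w c d + (d * w n) • vacuumProj := by
  have h : ∀ i : Fin n, field w i * rightCreation n = rightCreation n * field w i := by
    intro i
    rw [field_mul_rightCreation, if_neg (by omega), zero_smul, add_zero]
  have h2 : ∀ i j : Fin n, field w i * field w j * rightCreation n =
      rightCreation n * (field w i * field w j) := by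
    intro i j
    rw [mul_assoc, h, ← mul_assoc, h, mul_assoc]
  simp only [wickForm, add_mul, mul_add, smul_mul_assoc, field_mul_rightCreation, if_true,
    Finset.sum_mul, Finset.mul_sum, sub_mul, mul_sub, mul_smul_comm, h2, one_mul, mul_one,
    smul_add, mul_smul]
  abel

/-- Commuting the form with a right creation operator leaves a term for each of the two factors of
the quadratic part, with the vacuum projection in place of that factor. -/
theorem wickForm_mul_rightCreation (k : Fin n) :
    wickForm (field w) w c d * rightCreation k =
      rightCreation k * wickForm (field w) w c d +
        (w k • (∑ q : Fin n, c k q • (vacuumProj * field w q)) +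
          w k • (∑ p : Fin n, c p k • (field w p * vacuumProj))) := by
  have hn : field w n * rightCreation k = rightCreation k * field w n := by
    rw [field_mul_rightCreation, if_neg (by omega), zero_smul, add_zero]
  have h2 : ∀ i j : Fin n, field w i * field w j * rightCreation k =
      rightCreation k * (field w i * field w j) +
        (if k = i then w k else 0) • (vacuumProj * field w j) +
        (if k = j then w k else 0) • (field w i * vacuumProj) := by
    intro i j
    rw [mul_assoc, field_mul_rightCreation, mul_add, ← mul_assoc, field_mul_rightCreation,
      add_mul, mul_smul_comm, smul_mul_assoc, mul_assoc]
    simp only [Fin.ext_iff]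
  simp only [wickForm, add_mul, mul_add, smul_mul_assoc, hn, Finset.sum_mul, Finset.mul_sum,
    sub_mul, mul_sub, mul_smul_comm, h2, one_mul, mul_one, smul_add, smul_sub, add_sub_right_comm,
    Finset.sum_add_distrib]
  have e1 : ∑ x : Fin n, ∑ y : Fin n, c x y • (if k = x then w k else 0) • (vacuumProj * field w y)
      = w k • ∑ q : Fin n, c k q • (vacuumProj * field w q) := by
    rw [Finset.sum_eq_single k]
    · simp [Finset.smul_sum, smul_smul, mul_comm]
    · intro i _ hi
      simp [Ne.symm hi]
    · simp
  have e2 : ∑ x : Fin n, ∑ y : Fin n, c x y • (if k = y then w k else 0) • (field w x * vacuumProj)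
      = w k • ∑ p : Fin n, c p k • (field w p * vacuumProj) := by
    rw [Finset.smul_sum]
    refine Finset.sum_congr rfl fun i _ => ?_
    rw [Finset.sum_eq_single k]
    · simp [smul_smul, mul_comm]
    · intro j _ hj
      simp [Ne.symm hj]
    · simp
  rw [e1, e2]
  simp only [add_assoc]

/-- The parity operator: it multiplies a word by `-1` to the number of its letters other
than `z`. -/
noncomputable def parity (z : ℕ) : Module.End ℂ Fock :=
  fockLift fun u => ((-1 : ℂ) ^ (u.countP (· ≠ z))) • word u

theorem parity_word (z : ℕ) (u : List ℕ) :
    parity z (word u) = ((-1 : ℂ) ^ (u.countP (· ≠ z))) • word u := by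
  simp [parity]

theorem parity_mul_field (z i : ℕ) :
    parity z * field w i = (if i = z then (1 : ℂ) else -1) • (field w i * parity z) := by
  refine fock_hom_ext fun u => ?_
  cases u with
  | nil =>
    simp only [Module.End.mul_apply, LinearMap.smul_apply, field_word_nil, parity_word,
      map_smul]
    by_cases h : i = z <;> simp [h]
  | cons j u =>
    simp only [Module.End.mul_apply, LinearMap.smul_apply, field_word_cons, parity_word,
      map_smul, map_add]
    by_cases hj : j = i
    · subst hj
      by_cases h : j = z <;> simp [h, parity_word, pow_succ, smul_smul, mul_comm]
    · by_cases h : i = z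
      · subst h; simp [hj, pow_succ]
      · simp [h, hj, pow_succ]

theorem vacuumState_parity_mul (z : ℕ) (T : Module.End ℂ Fock) :
    vacuumState (parity z * T) = vacuumState T := by
  have h : vacuumCoeff.comp (parity z) = vacuumCoeff := by
    refine fock_hom_ext fun u => ?_
    cases u <;> simp [parity_word, vacuumCoeff]
  exact LinearMap.congr_fun h (T vacuum)

theorem vacuumState_mul_parity (z : ℕ) (T : Module.End ℂ Fock) :
    vacuumState (T * parity z) = vacuumState T := by
  simp [vacuumState_apply, vacuum, parity_word]

theorem parity_commute_wickForm : Commute (parity n) (wickForm (field w) w c d) := by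
  have h : ∀ i : Fin n, parity n * field w i = -(field w i * parity n) := by
    intro i
    rw [parity_mul_field, if_neg (by omega), neg_smul, one_smul]
  have h2 : ∀ i j : Fin n, parity n * (field w i * field w j) =
      field w i * field w j * parity n := by
    intro i j
    rw [← mul_assoc, h, neg_mul, mul_assoc, h, mul_neg, neg_neg, mul_assoc]
  simp only [Commute, SemiconjBy, wickForm, mul_add, add_mul, smul_mul_assoc, mul_smul_comm,
    parity_mul_field, if_true, one_smul, Finset.mul_sum, Finset.sum_mul, mul_sub, sub_mul, h2,
    mul_one, one_mul]

/-- The form is even in the letters below `n`, so expectations with a single such letter vanish. -/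
theorem vacuumState_pow_mul_field (k : ℕ) (p : Fin n) :
    vacuumState (wickForm (field w) w c d ^ k * field w p) = 0 := by
  have h : vacuumState (wickForm (field w) w c d ^ k * field w p) =
      -vacuumState (wickForm (field w) w c d ^ k * field w p) := by
    conv_lhs => rw [← vacuumState_parity_mul n, ← mul_assoc,
      ((parity_commute_wickForm w c d).pow_right k).eq, mul_assoc, parity_mul_field,
      if_neg (by omega), neg_smul, one_smul, mul_neg, map_neg, ← mul_assoc,
      vacuumState_mul_parity]
  exact self_eq_neg.mp h

theorem vacuumState_field_mul_pow (k : ℕ) (p : Fin n) :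
    vacuumState (field w p * wickForm (field w) w c d ^ k) = 0 := by
  have h : vacuumState (field w p * wickForm (field w) w c d ^ k) =
      -vacuumState (field w p * wickForm (field w) w c d ^ k) := by
    conv_lhs => rw [← vacuumState_parity_mul n, ← mul_assoc, parity_mul_field,
      if_neg (by omega), neg_smul, one_smul, neg_mul, map_neg, mul_assoc,
      ((parity_commute_wickForm w c d).pow_right k).eq, ← mul_assoc,
      vacuumState_mul_parity]
  exact self_eq_neg.mp h

/-- The vacuum expectations `⟨X q Fᵇ X i⟩`, as a matrix. -/
noncomputable def momentMatrix (b : ℕ) : Matrix (Fin n) (Fin n) ℂ :=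
  Matrix.of fun q i => vacuumState (field w q * wickForm (field w) w c d ^ b * field w i)

theorem momentMatrix_zero : momentMatrix w c d 0 = Matrix.diagonal fun i : Fin n => w i := by
  ext q i
  have h := field_mul_rightCreation w i q
  simp only [momentMatrix, Matrix.of_apply, pow_zero, mul_one]
  rw [vacuumState_mul_field_of_comm w i h]
  by_cases hqi : q = i
  · subst hqi
    simpa [vacuumState_one] using congrArg (w q * ·) (vacuumState_mul_proj 1)
  · simp [Matrix.diagonal_apply_ne _ hqi, Fin.val_inj, Ne.symm hqi]

theorem momentMatrix_succ (b : ℕ) :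
    momentMatrix w c d (b + 1) =
      vacuumState (wickForm (field w) w c d ^ (b + 1)) • Matrix.diagonal (fun i : Fin n => w i) +
        ∑ p ∈ antidiagonal b, vacuumState (wickForm (field w) w c d ^ p.2) •
          (momentMatrix w c d p.1 * (c * Matrix.diagonal fun i : Fin n => w i)) := by
  ext q i
  set F := wickForm (field w) w c d with hF
  have h1 := pow_mul_of_comm (wickForm_mul_rightCreation w c d i) b
  rw [← hF] at h1
  set D := (w i • (∑ q : Fin n, c i q • (vacuumProj * field w q)) +
          w i • (∑ p : Fin n, c p i • (field w p * vacuumProj))) with hD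
  have h2 : field w q * F ^ (b + 1) * rightCreation i =
      rightCreation i * (field w q * F ^ (b + 1)) +
        ((if i = q then w i else 0) • (vacuumProj * F ^ (b + 1)) +
          ∑ p ∈ antidiagonal b, field w q * (F ^ p.1 * D * F ^ p.2)) := by
    rw [mul_assoc, h1, mul_add, ← mul_assoc, field_mul_rightCreation, add_mul, smul_mul_assoc,
      Finset.mul_sum, mul_assoc]
    simp only [Fin.ext_iff, add_assoc]
  have h3 : ∀ p : ℕ × ℕ, vacuumState (field w q * (F ^ p.1 * D * F ^ p.2)) =
      vacuumState (F ^ p.2) * ∑ j, momentMatrix w c d p.1 q j * (c j i * w i) := by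
    intro p
    have e1 : ∀ j : Fin n,
        vacuumState (field w q * (F ^ p.1 * (vacuumProj * field w j) * F ^ p.2)) = 0 := by
      intro j
      have := vacuumState_mul_proj_mul (field w q * F ^ p.1) (field w j * F ^ p.2)
      rw [vacuumState_field_mul_pow, zero_mul] at this
      simpa only [mul_assoc] using this
    have e2 : ∀ j : Fin n,
        vacuumState (field w q * (F ^ p.1 * (field w j * vacuumProj) * F ^ p.2)) =
          momentMatrix w c d p.1 q j * vacuumState (F ^ p.2) := by
      intro j
      have := vacuumState_mul_proj_mul (field w q * F ^ p.1 * field w j) (F ^ p.2)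
      simpa only [mul_assoc, momentMatrix, Matrix.of_apply, hF] using this
    simp only [hD, mul_add, add_mul, mul_smul_comm, smul_mul_assoc, Finset.mul_sum,
      Finset.sum_mul, map_add, map_smul, map_sum, e1, e2, smul_eq_mul, mul_zero,
      Finset.sum_const_zero, zero_add]
    exact Finset.sum_congr rfl fun j _ => by ring
  have h4 := vacuumState_mul_field_of_comm w i h2
  have h5 : vacuumState (vacuumProj * F ^ (b + 1)) = vacuumState (F ^ (b + 1)) :=
    vacuumState_proj_mul _
  rw [map_add, map_smul, h5, map_sum, Finset.sum_congr rfl fun p _ => h3 p] at h4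
  have h6 : ∀ x, (momentMatrix w c d x * (c * Matrix.diagonal fun i : Fin n => w i)) q i =
      ∑ j, momentMatrix w c d x q j * (c j i * w i) := by
    intro x
    rw [Matrix.mul_apply]
    exact Finset.sum_congr rfl fun j _ => by rw [Matrix.mul_diagonal]
  simp only [Matrix.add_apply, Matrix.smul_apply, Matrix.sum_apply, h6, smul_eq_mul]
  rw [momentMatrix, Matrix.of_apply, ← hF, h4]
  congr 1
  by_cases hqi : q = i
  · subst hqi; simp [mul_comm]
  · simp [Matrix.diagonal_apply_ne _ hqi, Ne.symm hqi]

theorem vacuumState_pow_mul_last (k : ℕ) :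
    vacuumState (wickForm (field w) w c d ^ (k + 1) * field w n) =
      ∑ p ∈ antidiagonal k, vacuumState (wickForm (field w) w c d ^ p.2) *
        (d * w n * vacuumState (wickForm (field w) w c d ^ p.1)) := by
  rw [vacuumState_mul_field_of_comm w n
    (pow_mul_of_comm (wickForm_mul_rightCreation_last w c d) k), map_sum]
  refine Finset.sum_congr rfl fun p _ => ?_
  rw [mul_smul_comm, smul_mul_assoc, map_smul, vacuumState_mul_proj_mul, smul_eq_mul]
  ring

theorem vacuumState_pow_mul_field_mul_field (k : ℕ) (i j : Fin n) :
    vacuumState (wickForm (field w) w c d ^ (k + 1) * field w i * field w j) =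
      (if i = j then w i else 0) * vacuumState (wickForm (field w) w c d ^ (k + 1)) +
      ∑ p ∈ antidiagonal k, vacuumState (wickForm (field w) w c d ^ p.2) *
        ∑ q, w j * c j q * momentMatrix w c d p.1 q i := by
  set F := wickForm (field w) w c d with hF
  have h1 := pow_mul_of_comm (wickForm_mul_rightCreation w c d j) k
  rw [← hF] at h1
  set D := (w j • (∑ q : Fin n, c j q • (vacuumProj * field w q)) +
          w j • (∑ p : Fin n, c p j • (field w p * vacuumProj))) with hD
  have h2 : F ^ (k + 1) * field w i * rightCreation j =
      rightCreation j * (F ^ (k + 1) * field w i) +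
        ((if i = j then w i else 0) • (F ^ (k + 1) * vacuumProj) +
          ∑ p ∈ antidiagonal k, F ^ p.1 * D * F ^ p.2 * field w i) := by
    rw [mul_assoc, field_mul_rightCreation, mul_add, ← mul_assoc, h1, add_mul, mul_smul_comm,
      Finset.sum_mul, mul_assoc]
    have : (if (j : ℕ) = i then w j else 0) = if i = j then w i else 0 := by
      by_cases h : i = j
      · subst h; simp
      · simp [h, Fin.val_inj, Ne.symm h]
    rw [this]
    abel
  have h3 : ∀ p : ℕ × ℕ, vacuumState (F ^ p.1 * D * F ^ p.2 * field w i) =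
      vacuumState (F ^ p.1) * ∑ q, w j * c j q * momentMatrix w c d p.2 q i := by
    intro p
    have e1 : ∀ q : Fin n,
        vacuumState (F ^ p.1 * (vacuumProj * field w q) * F ^ p.2 * field w i) =
          vacuumState (F ^ p.1) * momentMatrix w c d p.2 q i := by
      intro q
      have := vacuumState_mul_proj_mul (F ^ p.1) (field w q * F ^ p.2 * field w i)
      simpa only [mul_assoc, momentMatrix, Matrix.of_apply, hF] using this
    have e2 : ∀ q : Fin n,
        vacuumState (F ^ p.1 * (field w q * vacuumProj) * F ^ p.2 * field w i) = 0 := by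
      intro q
      have := vacuumState_mul_proj_mul (F ^ p.1 * field w q) (F ^ p.2 * field w i)
      rw [vacuumState_pow_mul_field, zero_mul] at this
      simpa only [mul_assoc] using this
    simp only [hD, mul_add, add_mul, mul_smul_comm, smul_mul_assoc, Finset.mul_sum,
      Finset.sum_mul, map_add, map_smul, map_sum, e1, e2, smul_eq_mul, mul_zero,
      Finset.sum_const_zero, add_zero]
    exact Finset.sum_congr rfl fun j _ => by ring
  rw [vacuumState_mul_field_of_comm w j h2, map_add, map_smul, vacuumState_mul_proj, map_sum,
    Finset.sum_congr rfl fun p _ => h3 p, smul_eq_mul]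
  congr 1
  exact Finset.Nat.sum_antidiagonal_swap
    (f := fun p => vacuumState (F ^ p.2) * ∑ q, w j * c j q * momentMatrix w c d p.1 q i) |>.symm
    |>.trans (by simp) |>.symm

/-- The free cumulants of `wickForm X w c d` for a free semicircular family `X` with variances
`w`; the value at `r` is the cumulant of order `r + 1`. -/
noncomputable def wickCumulant (r : ℕ) : ℂ :=
  if r = 0 then 0 else
    ((c * Matrix.diagonal fun i : Fin n => w i) ^ (r + 1)).trace + if r = 1 then d ^ 2 * w n else 0

/-- With `K = c * diagonal w`, the auxiliary array of the moment-cumulant relation is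
`t b r = tr (K ^ r * c * M b)` for `r ≥ 1`, where `M b` is the moment matrix, plus a term
of the linear part for `r = 1`: its recursion is that of the moment matrices, and the case
`r = 0` is the expansion of `F ^ (b + 2)` in its last factor. -/
theorem hasFreeCumulants_vacuumState_wickForm :
    HasFreeCumulants (fun k => vacuumState (wickForm (field w) w c d ^ k))
      (wickCumulant w c d) := by
  set F := wickForm (field w) w c d with hF
  set K := c * Matrix.diagonal fun i : Fin n => w i with hK
  set M := momentMatrix w c d with hM
  have hm1 : vacuumState F = 0 := by
    have e : ∀ i j : Fin n, vacuumState (field w i * field w j) = if i = j then w i else 0 := by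
      intro i j
      have := congrFun (congrFun (momentMatrix_zero w c d) i) j
      simpa [momentMatrix, Matrix.diagonal_apply] using this
    have e' : vacuumState (field w n) = 0 := by
      simp [vacuumState_apply, vacuum, field_word_nil, vacuumCoeff]
    have e2 : ∀ i j : Fin n, vacuumState
        (field w i * field w j - (if i = j then w i else 0) • (1 : Module.End ℂ Fock)) = 0 := by
      intro i j
      rw [map_sub, map_smul, e, vacuumState_one, smul_eq_mul, mul_one, sub_self]
    simp only [hF, wickForm, map_add, map_smul, map_sum, e2, e', smul_zero,
      Finset.sum_const_zero, add_zero]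
  refine ⟨fun b r => if r = 0 then vacuumState (F ^ (b + 1)) else
    (K ^ r * c * M b).trace + if r = 1 then d ^ 2 * w n * vacuumState (F ^ b) else 0,
    by simp [vacuumState_one], fun b => by simp, fun r => ?_, fun b r => ?_⟩
  · by_cases hr : r = 0
    · simp [hr, hm1, wickCumulant]
    · simp only [hr, if_false, hM, momentMatrix_zero, mul_assoc, ← hK, wickCumulant, pow_succ,
        pow_zero, vacuumState_one, mul_one]
  · by_cases hr : r = 0
    · subst hr
      have hstep : vacuumState (F ^ (b + 2)) =
          d * vacuumState (F ^ (b + 1) * field w n) + ∑ i : Fin n, ∑ j : Fin n,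
            c i j * (vacuumState (F ^ (b + 1) * field w i * field w j) -
              (if i = j then w i else 0) * vacuumState (F ^ (b + 1))) := by
        have h : F ^ (b + 2) = F ^ (b + 1) * wickForm (field w) w c d := pow_succ F (b + 1)
        rw [h, wickForm]
        simp only [mul_add, Finset.mul_sum, mul_smul_comm, mul_sub, mul_one, map_add, map_sum,
          map_smul, map_sub, smul_eq_mul, mul_assoc]
      have htr : ∀ x, (K * c * M x).trace =
          ∑ i : Fin n, ∑ j : Fin n, c i j * ∑ q, w j * c j q * M x q i := by
        intro x
        rw [mul_assoc, Matrix.trace]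
        refine Finset.sum_congr rfl fun i _ => ?_
        rw [Matrix.diag_apply, Matrix.mul_apply]
        refine Finset.sum_congr rfl fun j _ => ?_
        rw [hK, Matrix.mul_diagonal, Matrix.mul_apply, mul_assoc, Finset.mul_sum]
        simp only [mul_assoc]
      simp only [if_true, wickCumulant, mul_zero, zero_add, one_ne_zero, if_false, pow_one, htr]
      have h1 := vacuumState_pow_mul_last w c d b
      have h2 := vacuumState_pow_mul_field_mul_field w c d b
      rw [← hF] at h1
      rw [← hF, ← hM] at h2
      rw [hstep, h1]
      simp only [h2, add_sub_cancel_left]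
      simp only [Finset.mul_sum, mul_add, Finset.sum_add_distrib]
      rw [add_comm]
      congr 1
      · rw [Finset.sum_congr rfl fun i _ => Finset.sum_comm, Finset.sum_comm]
        refine Finset.sum_congr rfl fun p _ => Finset.sum_congr rfl fun i _ =>
          Finset.sum_congr rfl fun j _ => Finset.sum_congr rfl fun q _ => by ring
      · exact Finset.sum_congr rfl fun p _ => by ring
    · have hr1 : r + 1 ≠ 1 := by omega
      have htr : ∀ x, (K ^ r * c * (M x * K)).trace = (K ^ (r + 1) * c * M x).trace := by
        intro x
        rw [← mul_assoc, Matrix.trace_mul_comm, pow_succ' K, ← mul_assoc, ← mul_assoc]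
      have hMs := momentMatrix_succ w c d b
      rw [← hF, ← hM, ← hK] at hMs
      simp only [hr, if_false, hMs, wickCumulant, Nat.succ_ne_zero, hr1, add_zero, ← hK]
      simp only [mul_add, Finset.mul_sum, mul_smul_comm, Matrix.trace_add, Matrix.trace_sum,
        Matrix.trace_smul, htr, smul_eq_mul]
      rw [mul_assoc (K ^ r), ← hK, ← pow_succ]
      split_ifs <;> ring

end Recursion

/-! ### Free semicircular families and the Fock space -/

theorem vacuumState_field_pow_add_two (w : ℕ → ℂ) (i k : ℕ) :
    vacuumState (field w i ^ (k + 2)) = w i *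
      ∑ p ∈ antidiagonal k, vacuumState (field w i ^ p.1) * vacuumState (field w i ^ p.2) := by
  have h := field_mul_rightCreation w i i
  rw [if_pos rfl] at h
  rw [pow_succ, vacuumState_mul_field_of_comm w i (pow_mul_of_comm h k), map_sum, Finset.mul_sum]
  refine Finset.sum_congr rfl fun p _ => ?_
  rw [mul_smul_comm, smul_mul_assoc, map_smul, vacuumState_mul_proj_mul, smul_eq_mul]

/-- A field operator is semicircular in the vacuum state. -/
theorem vacuumState_field_pow (w : ℕ → ℂ) (i m : ℕ) :
    vacuumState (field w i ^ (2 * m)) = (catalan m : ℂ) * w i ^ m ∧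
      vacuumState (field w i ^ (2 * m + 1)) = 0 := by
  induction m using Nat.strong_induction_on with
  | _ m ih =>
    cases m with
    | zero =>
      refine ⟨by simp [vacuumState_one], ?_⟩
      simp [vacuumState_apply, vacuum, field_word_nil, vacuumCoeff]
    | succ m =>
      have hodd : ∀ a ≤ 2 * m + 1, ¬ Even a → vacuumState (field w i ^ a) = 0 := by
        intro a ha hodd
        obtain ⟨b, rfl⟩ := Nat.not_even_iff_odd.mp hodd
        exact (ih b (by omega)).2
      constructor
      · rw [show 2 * (m + 1) = 2 * m + 2 by ring, vacuumState_field_pow_add_two]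
        have hsum : ∑ p ∈ antidiagonal (2 * m),
            vacuumState (field w i ^ p.1) * vacuumState (field w i ^ p.2) =
            ∑ p ∈ antidiagonal m, (catalan p.1 : ℂ) * catalan p.2 * w i ^ m := by
          symm
          refine Finset.sum_of_injOn (fun p => (2 * p.1, 2 * p.2)) ?_ ?_ ?_ ?_
          · intro p _ q _ h
            simp only [Prod.mk.injEq] at h
            ext <;> omega
          · intro p hp
            simp only [Finset.mem_coe, Finset.HasAntidiagonal.mem_antidiagonal] at hp ⊢
            omega
          · intro p hp hp2
            rw [Finset.HasAntidiagonal.mem_antidiagonal] at hp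
            by_cases he : Even p.1
            · exfalso
              obtain ⟨a, ha⟩ := he
              refine hp2 ⟨(a, m - a), ?_, ?_⟩
              · simp only [Finset.mem_coe, Finset.HasAntidiagonal.mem_antidiagonal]; omega
              · ext <;> simp only <;> omega
            · rw [hodd _ (by omega) he, zero_mul]
          · intro p hp
            rw [Finset.HasAntidiagonal.mem_antidiagonal] at hp
            simp only
            rw [(ih p.1 (by omega)).1, (ih p.2 (by omega)).1, ← hp, pow_add]
            ring
        rw [hsum, ← Finset.sum_mul, catalan_succ']
        push_cast
        ring
      · rw [show 2 * (m + 1) + 1 = (2 * m + 1) + 2 by ring, vacuumState_field_pow_add_two]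
        refine mul_eq_zero_of_right _ (Finset.sum_eq_zero fun p hp => ?_)
        rw [Finset.HasAntidiagonal.mem_antidiagonal] at hp
        by_cases he : Even p.1
        · rw [hodd p.2 (by omega) (by
            intro he2
            have := he.add he2
            rw [hp] at this
            exact Nat.not_even_two_mul_add_one m this), mul_zero]
        · rw [hodd p.1 (by omega) he, zero_mul]

section WickWord

variable {A : Type*} [Ring A] [Algebra ℂ A] (X : ℕ → A) (w : ℕ → ℂ)

/-- The Wick product of the variables `X i` along a word: the element of the algebra generated by
the `X i` which corresponds to a word of the Fock space. -/
noncomputable def wickWord : List ℕ → A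
  | [] => 1
  | [i] => X i
  | i :: j :: u => X i * wickWord (j :: u) - (if j = i then w i else 0) • wickWord u

/-- The linear extension of `wickWord` to the Fock space. -/
noncomputable def wickMap : Fock →ₗ[ℂ] A := fockLift (wickWord X w)

theorem wickMap_word (u : List ℕ) : wickMap X w (word u) = wickWord X w u := fockLift_word _ _

theorem wickMap_vacuum : wickMap X w vacuum = 1 := by
  rw [vacuum, wickMap_word, wickWord]

/-- The field operators model left multiplication by the variables. -/
theorem wickMap_field (i : ℕ) (v : Fock) :
    wickMap X w (field w i v) = X i * wickMap X w v := by
  have h : (wickMap X w).comp (field w i) = (LinearMap.mulLeft ℂ (X i)).comp (wickMap X w) := by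
    refine fock_hom_ext fun u => ?_
    cases u with
    | nil => simp [field_word_nil, wickMap_word, wickWord]
    | cons j u =>
      by_cases h : j = i <;> simp [field_word_cons, wickMap_word, wickWord, h]
  exact LinearMap.congr_fun h v

theorem wickMap_wickForm {n : ℕ} (c : Matrix (Fin n) (Fin n) ℂ) (d : ℂ) (v : Fock) :
    wickMap X w (wickForm (field w) w c d v) = wickForm X w c d * wickMap X w v := by
  simp [wickForm, wickMap_field, add_mul, Finset.sum_mul, mul_assoc, sub_mul,
    LinearMap.sum_apply, -ite_smul]

theorem wickMap_wickForm_pow {n : ℕ} (c : Matrix (Fin n) (Fin n) ℂ) (d : ℂ) (k : ℕ) :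
    wickMap X w ((wickForm (field w) w c d ^ k) vacuum) = wickForm X w c d ^ k := by
  induction k with
  | zero => simp [wickMap_vacuum]
  | succ k ih => rw [pow_succ', Module.End.mul_apply, wickMap_wickForm, ih, pow_succ']

theorem wickMap_field_pow (i k : ℕ) :
    wickMap X w ((field w i ^ k) vacuum) = X i ^ k := by
  induction k with
  | zero => simp [wickMap_vacuum]
  | succ k ih => rw [pow_succ', Module.End.mul_apply, wickMap_field, ih, pow_succ']

theorem wickWord_mem (B : Subalgebra ℂ A) (u : List ℕ) (h : ∀ i ∈ u, X i ∈ B) :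
    wickWord X w u ∈ B := by
  induction u using wickWord.induct with
  | case1 => rw [wickWord]; exact B.one_mem
  | case2 i => rw [wickWord]; exact h i (by simp)
  | case3 i j u ih1 ih2 =>
    rw [wickWord]
    exact B.sub_mem (B.mul_mem (h i (by simp)) (ih1 fun k hk => h k (by simp_all)))
      (B.smul_mem (ih2 fun k hk => h k (by simp_all)) _)

/-- Wick products are multiplicative across a change of letters. -/
theorem wickWord_append (u v : List ℕ) (h : ∀ a ∈ u.getLast?, ∀ b ∈ v.head?, a ≠ b) :
    wickWord X w (u ++ v) = wickWord X w u * wickWord X w v := by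
  induction u using wickWord.induct with
  | case1 => simp [wickWord]
  | case2 i =>
    cases v with
    | nil => simp [wickWord]
    | cons j v =>
      have : j ≠ i := (h i (by simp) j (by simp)).symm
      simp [wickWord, this]
  | case3 i j u ih1 ih2 =>
    have h1 := ih1 fun a ha b hb => h a (by simpa using ha) b hb
    have h2 := ih2 fun a ha b hb => h a (by
      cases u with
      | nil => simp at ha
      | cons k u => simpa using ha) b hb
    rw [List.cons_append] at h1
    rw [List.cons_append, List.cons_append, wickWord, wickWord, h1, h2, sub_mul, mul_assoc,
      smul_mul_assoc]

end WickWord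

/-- A nonempty word begins with a maximal constant block. -/
theorem exists_replicate_append (i : ℕ) (u : List ℕ) :
    ∃ (k : ℕ) (v : List ℕ), i :: u = List.replicate (k + 1) i ++ v ∧ ∀ b ∈ v.head?, i ≠ b := by
  induction u with
  | nil => exact ⟨0, [], by simp⟩
  | cons j u ih =>
    by_cases h : i = j
    · subst h
      obtain ⟨k, v, hv, hb⟩ := ih
      exact ⟨k + 1, v, by rw [hv, ← List.cons_append, ← List.replicate_succ], hb⟩
    · exact ⟨0, j :: u, by simp, by simpa using h⟩

/-- `X` is a sequence of freely independent centered semicircular variables, `X k` having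
variance `w k`. -/
structure IsFreeSemicircularFamily {A : Type*} [CStarAlgebra A] (φ : A →ₗ[ℂ] ℂ) (X : ℕ → A)
    (w : ℕ → ℝ) : Prop where
  map_one : φ 1 = 1
  semicircular : ∀ k, IsSemicircular φ (X k) (w k)
  free : FreelyIndependent φ fun k => Algebra.adjoin ℂ {X k}

namespace IsFreeSemicircularFamily

variable {A : Type*} [CStarAlgebra A] {φ : A →ₗ[ℂ] ℂ} {X : ℕ → A} {w : ℕ → ℝ}

/-- The Wick powers of a single variable are centered: this involves only its moments, which agree
with those of the field operator. -/
theorem apply_wickWord_replicate (h : IsFreeSemicircularFamily φ X w) (i k : ℕ) :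
    φ (wickWord X (fun i => w i) (List.replicate (k + 1) i)) = 0 := by
  set W : ℕ → ℂ := fun i => w i with hW
  set P : Submodule ℂ Fock := Submodule.span ℂ (Set.range fun n => (field W i ^ n) vacuum) with hP
  have hfield : ∀ v ∈ P, field W i v ∈ P := by
    intro v hv
    induction hv using Submodule.span_induction with
    | mem x hx =>
      obtain ⟨n, rfl⟩ := hx
      exact Submodule.subset_span ⟨n + 1, by simp only [pow_succ', Module.End.mul_apply]⟩
    | zero => simp
    | add x y _ _ hx hy => rw [map_add]; exact P.add_mem hx hy
    | smul a x _ hx => rw [map_smul]; exact P.smul_mem a hx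
  -- Each word `i ⋯ i` is a polynomial in the field operator, applied to the vacuum.
  have hword : ∀ n, word (List.replicate n i) ∈ P ∧ word (List.replicate (n + 1) i) ∈ P := by
    intro n
    induction n with
    | zero =>
      have h0 : word [] ∈ P := Submodule.subset_span ⟨0, rfl⟩
      exact ⟨h0, by simpa [field_word_nil] using hfield _ h0⟩
    | succ n ih =>
      refine ⟨ih.2, ?_⟩
      have h1 := hfield _ ih.2
      rw [List.replicate_succ, field_word_cons, if_pos rfl] at h1
      have h2 := P.sub_mem h1 (P.smul_mem (W i) ih.1)
      rwa [add_sub_cancel_right] at h2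
  have hφ : ∀ v ∈ P, φ (wickMap X W v) = vacuumCoeff v := by
    intro v hv
    induction hv using Submodule.span_induction with
    | mem x hx =>
      obtain ⟨n, rfl⟩ := hx
      simp only [wickMap_field_pow]
      rw [← vacuumState_apply]
      obtain ⟨m, rfl | rfl⟩ := n.even_or_odd'
      · rw [((h.semicircular i).2 m).1, (vacuumState_field_pow W i m).1]
      · rw [((h.semicircular i).2 m).2, (vacuumState_field_pow W i m).2]
    | zero => simp
    | add x y _ _ hx hy => simp only [map_add, hx, hy]
    | smul a x _ hx => simp only [map_smul, hx]
  rw [← wickMap_word, hφ _ (hword k).2, vacuumCoeff, fockLift_word, List.replicate_succ,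
    if_neg (List.cons_ne_nil _ _)]

/-- A Wick word is the alternating product of the centered Wick powers given by its maximal
constant blocks. -/
theorem exists_chain_wickWord (h : IsFreeSemicircularFamily φ X w) (u : List ℕ) :
    ∃ l : List (ℕ × A), l.IsChain (fun p q => p.1 ≠ q.1) ∧
      (∀ p ∈ l, p.2 ∈ Algebra.adjoin ℂ {X p.1} ∧ φ p.2 = 0) ∧
      (l.map Prod.snd).prod = wickWord X (fun i => w i) u ∧ l.head?.map Prod.fst = u.head? := by
  induction hn : u.length using Nat.strong_induction_on generalizing u with
  | _ n ih =>
    cases u with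
    | nil => exact ⟨[], by simp [wickWord]⟩
    | cons i u =>
      obtain ⟨k, v, huv, hb⟩ := exists_replicate_append i u
      obtain ⟨l, hl1, hl2, hl3, hl4⟩ := ih v.length (by
        have := congrArg List.length huv
        simp at this hn
        omega) v rfl
      refine ⟨(i, wickWord X (fun i => w i) (List.replicate (k + 1) i)) :: l, ?_, ?_, ?_, ?_⟩
      · refine hl1.cons ?_
        intro q hq
        refine hb _ ?_
        rw [← hl4]
        simp only [Option.mem_def] at hq ⊢
        rw [hq, Option.map_some]
      · intro p hp
        rcases List.mem_cons.mp hp with rfl | hp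
        · refine ⟨wickWord_mem X _ _ _ fun j hj => ?_, h.apply_wickWord_replicate i k⟩
          rw [List.eq_of_mem_replicate hj]
          exact Algebra.subset_adjoin rfl
        · exact hl2 p hp
      · rw [huv, wickWord_append, List.map_cons, List.prod_cons, hl3]
        intro a ha
        have := List.eq_of_mem_replicate (List.mem_of_getLast? ha)
        rw [this]
        exact hb
      · simp

theorem apply_wickWord (h : IsFreeSemicircularFamily φ X w) (u : List ℕ) (hu : u ≠ []) :
    φ (wickWord X (fun i => w i) u) = 0 := by
  obtain ⟨l, hl1, hl2, hl3, hl4⟩ := h.exists_chain_wickWord u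
  rw [← hl3]
  refine h.free l ?_ hl1 hl2
  rintro rfl
  simp [eq_comm, hu] at hl4

/-- The state is the vacuum coefficient, transported by `wickMap`. -/
theorem apply_wickMap (h : IsFreeSemicircularFamily φ X w) (v : Fock) :
    φ (wickMap X (fun i => w i) v) = vacuumCoeff v := by
  have h2 : φ.comp (wickMap X fun i => (w i : ℂ)) = vacuumCoeff := by
    refine fock_hom_ext fun u => ?_
    rw [LinearMap.comp_apply, wickMap_word, vacuumCoeff, fockLift_word]
    by_cases hu : u = []
    · rw [hu, wickWord, h.map_one, if_pos rfl]
    · rw [h.apply_wickWord u hu, if_neg hu]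
  exact LinearMap.congr_fun h2 v

theorem hasFreeCumulants_wickForm (h : IsFreeSemicircularFamily φ X w) {n : ℕ}
    (c : Matrix (Fin n) (Fin n) ℂ) (d : ℂ) :
    HasFreeCumulants (fun k => φ (wickForm X (fun i => w i) c d ^ k))
      (wickCumulant (fun i => w i) c d) := by
  have h2 := hasFreeCumulants_vacuumState_wickForm (fun i => (w i : ℂ)) c d
  have h3 : ∀ k, vacuumState (wickForm (field fun i => (w i : ℂ)) (fun i => (w i : ℂ)) c d ^ k) =
      φ (wickForm X (fun i => w i) c d ^ k) := by
    intro k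
    rw [vacuumState_apply, ← h.apply_wickMap, wickMap_wickForm_pow]
  simpa only [h3] using h2

/-- Every element of the algebra generated by the variables of one class comes from the words in
the letters of that class. -/
theorem exists_wickMap_eq (X : ℕ → A) (w : ℕ → ℂ) {ι : Type*} (cl : ℕ → ι) (k : ι) {x : A}
    (hx : x ∈ Algebra.adjoin ℂ (X '' {i | cl i = k})) :
    ∃ v ∈ Submodule.span ℂ (word '' {u | ∀ i ∈ u, cl i = k}), wickMap X w v = x := by
  set W := Submodule.span ℂ (word '' {u | ∀ i ∈ u, cl i = k}) with hW
  have hfield : ∀ i, cl i = k → ∀ v ∈ W, field w i v ∈ W := by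
    intro i hi v hv
    induction hv using Submodule.span_induction with
    | mem x hx =>
      obtain ⟨u, hu, rfl⟩ := hx
      cases u with
      | nil =>
        rw [field_word_nil]
        exact Submodule.subset_span ⟨[i], by simpa using hi, rfl⟩
      | cons j u =>
        rw [field_word_cons]
        refine W.add_mem (Submodule.subset_span ⟨i :: j :: u, ?_, rfl⟩) ?_
        · intro a ha
          rcases List.mem_cons.mp ha with rfl | ha
          · exact hi
          · exact hu a ha
        · split_ifs
          · exact W.smul_mem _ (Submodule.subset_span
              ⟨u, fun a ha => hu a (List.mem_cons_of_mem _ ha), rfl⟩)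
          · exact W.zero_mem
    | zero => simp
    | add x y _ _ hx hy => rw [map_add]; exact W.add_mem hx hy
    | smul a x _ hx => rw [map_smul]; exact W.smul_mem a hx
  have key : ∀ v ∈ W, ∃ v' ∈ W, wickMap X w v' = x * wickMap X w v := by
    induction hx using Algebra.adjoin_induction with
    | mem x hx =>
      obtain ⟨i, hi, rfl⟩ := hx
      exact fun v hv => ⟨_, hfield i hi v hv, wickMap_field X w i v⟩
    | algebraMap r =>
      exact fun v hv => ⟨r • v, W.smul_mem r hv, by rw [map_smul, Algebra.smul_def]⟩
    | add x y _ _ hx hy =>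
      intro v hv
      obtain ⟨v1, h1, e1⟩ := hx v hv
      obtain ⟨v2, h2, e2⟩ := hy v hv
      exact ⟨v1 + v2, W.add_mem h1 h2, by rw [map_add, e1, e2, add_mul]⟩
    | mul x y _ _ hx hy =>
      intro v hv
      obtain ⟨v1, h1, e1⟩ := hy v hv
      obtain ⟨v2, h2, e2⟩ := hx v1 h1
      exact ⟨v2, h2, by rw [e2, e1, mul_assoc]⟩
  obtain ⟨v, hv, e⟩ := key vacuum (Submodule.subset_span ⟨[], by simp, rfl⟩)
  exact ⟨v, hv, by rw [e, wickMap_vacuum, mul_one]⟩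

/-- Centered elements of the algebra of one class are combinations of nonempty Wick words in the
letters of that class. -/
theorem mem_span_of_apply_eq_zero (h : IsFreeSemicircularFamily φ X w) {ι : Type*} (cl : ℕ → ι)
    (k : ι) {x : A} (hx : x ∈ Algebra.adjoin ℂ (X '' {i | cl i = k})) (hφ : φ x = 0) :
    x ∈ Submodule.span ℂ (wickWord X (fun i => w i) '' {u | u ≠ [] ∧ ∀ i ∈ u, cl i = k}) := by
  set U := Submodule.span ℂ (wickWord X (fun i => (w i : ℂ)) '' {u | u ≠ [] ∧ ∀ i ∈ u, cl i = k})
  obtain ⟨v, hv, rfl⟩ := exists_wickMap_eq X (fun i => (w i : ℂ)) cl k hx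
  rw [h.apply_wickMap] at hφ
  have key : wickMap X (fun i => (w i : ℂ)) v - vacuumCoeff v • (1 : A) ∈ U := by
    clear hφ hx
    induction hv using Submodule.span_induction with
    | mem x hx =>
      obtain ⟨u, hu, rfl⟩ := hx
      rw [wickMap_word, vacuumCoeff, fockLift_word]
      by_cases hu0 : u = []
      · simp [hu0, wickWord]
      · simpa [hu0] using Submodule.subset_span (s := wickWord X (fun i => (w i : ℂ)) ''
          {u | u ≠ [] ∧ ∀ i ∈ u, cl i = k}) ⟨u, ⟨hu0, hu⟩, rfl⟩
    | zero => simp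
    | add x y _ _ hx hy =>
      have := U.add_mem hx hy
      rwa [sub_add_sub_comm, ← map_add, ← add_smul, ← map_add] at this
    | smul a x _ hx =>
      have := U.smul_mem a hx
      rwa [smul_sub, ← map_smul, smul_smul, ← smul_eq_mul, ← map_smul] at this
  rwa [hφ, zero_smul, sub_zero] at key

/-- Free independence is associative: algebras generated by disjoint blocks of a free family are
freely independent. -/
theorem freelyIndependent_blocks (h : IsFreeSemicircularFamily φ X w) {ι : Type*} (cl : ℕ → ι) :
    FreelyIndependent φ fun k => Algebra.adjoin ℂ (X '' {i | cl i = k}) := by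
  -- An alternating product of centered elements consists of Wick words that begin in the class of
  -- its first factor, since Wick words multiply by concatenation when the class changes.
  have key : ∀ l : List (ι × A), l.IsChain (fun p q => p.1 ≠ q.1) →
      (∀ p ∈ l, p.2 ∈ Algebra.adjoin ℂ (X '' {i | cl i = p.1}) ∧ φ p.2 = 0) →
      (l.map Prod.snd).prod ∈ Submodule.span ℂ (wickWord X (fun i => w i) ''
        {u | u.head?.map cl = l.head?.map Prod.fst}) := by
    intro l
    induction l with
    | nil => exact fun _ _ => Submodule.subset_span ⟨[], rfl, rfl⟩
    | cons p l ih =>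
      intro hc hl
      have h1 := h.mem_span_of_apply_eq_zero cl p.1 (hl p (by simp)).1 (hl p (by simp)).2
      have h2 := ih hc.tail fun q hq => hl q (by simp [hq])
      have h3 := Submodule.mul_mem_mul h1 h2
      rw [Submodule.span_mul_span] at h3
      rw [List.map_cons, List.prod_cons]
      refine Submodule.span_mono ?_ h3
      rintro _ ⟨_, ⟨u, ⟨hu0, hu⟩, rfl⟩, _, ⟨u', hu', rfl⟩, rfl⟩
      refine ⟨u ++ u', ?_, wickWord_append X _ u u' ?_⟩
      · obtain ⟨i, u, rfl⟩ := List.exists_cons_of_ne_nil hu0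
        simpa using hu i (by simp)
      · intro a ha b hb hab
        have e1 : cl a = p.1 := hu a (List.mem_of_getLast? ha)
        rw [Set.mem_ofPred_eq, Option.mem_def.mp hb, Option.map_some] at hu'
        cases l with
        | nil => simp at hu'
        | cons q l =>
          have hpq : p.1 ≠ q.1 := (List.isChain_cons_cons.mp hc).1
          simp only [List.head?_cons, Option.map_some, Option.some.injEq] at hu'
          exact hpq (by rw [← e1, ← hu', hab])
  intro l hl hc hmem
  have h1 := key l hc hmem
  have h2 : Submodule.span ℂ (wickWord X (fun i => w i) ''
      {u | u.head?.map cl = l.head?.map Prod.fst}) ≤ LinearMap.ker φ := by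
    rw [Submodule.span_le]
    rintro _ ⟨u, hu, rfl⟩
    refine h.apply_wickWord u ?_
    rintro rfl
    obtain ⟨p, l, rfl⟩ := List.exists_cons_of_ne_nil hl
    simp at hu
  exact h2 h1

end IsFreeSemicircularFamily

theorem IsFreeBrownianMotion.isFreeSemicircularFamily {A : Type*} [CStarAlgebra A]
    {φ : A →ₗ[ℂ] ℂ} {S : ℝ≥0 → A} (hS : IsFreeBrownianMotion φ S) (h1 : φ 1 = 1)
    {t : ℕ → ℝ≥0} (ht : Monotone t) :
    IsFreeSemicircularFamily φ (fun k => S (t (k + 1)) - S (t k))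
      (fun k => (t (k + 1) : ℝ) - t k) :=
  ⟨h1, fun k => hS.semicircular _ _ (ht k.le_succ), hS.free_increments t ht⟩

/-! ### Limits, uniqueness and growth in the moment-cumulant relation -/

/-- Moments and free cumulants converge together: the relation can be solved for the cumulants. -/
theorem HasFreeCumulants.tendsto {α : Type*} {l : Filter α} [l.NeBot] {m κ : α → ℕ → ℂ}
    {m' : ℕ → ℂ} (h : ∀ a, HasFreeCumulants (m a) (κ a))
    (hm : ∀ k, Tendsto (fun a => m a k) l (𝓝 (m' k))) :
    ∃ κ' : ℕ → ℂ, (∀ r, Tendsto (fun a => κ a r) l (𝓝 (κ' r))) ∧ HasFreeCumulants m' κ' := by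
  choose t h0 h1 h2 h3 using h
  -- The recursion, solved for `t b (r + 1)`, propagates convergence from the column `r`.
  have key : ∀ r b, ∃ L, Tendsto (fun a => t a b r) l (𝓝 L) := by
    intro r
    induction r with
    | zero => exact fun b => ⟨m' (b + 1), by simpa only [h1] using hm (b + 1)⟩
    | succ r ihr =>
      intro b
      induction b using Nat.strong_induction_on with
      | _ b ihb =>
        have hmem : (b, 0) ∈ antidiagonal b := by
          simp [Finset.HasAntidiagonal.mem_antidiagonal]
        have e : ∀ a, t a b (r + 1) = t a (b + 1) r - m a (b + 1) * t a 0 r -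
            ∑ p ∈ (antidiagonal b).erase (b, 0), m a p.2 * t a p.1 (r + 1) := by
          intro a
          rw [h3, h2, ← Finset.add_sum_erase _ _ hmem, h0]
          ring
        have hsum : ∀ p ∈ (antidiagonal b).erase (b, 0),
            ∃ L, Tendsto (fun a => m a p.2 * t a p.1 (r + 1)) l (𝓝 L) := by
          intro p hp
          rw [Finset.mem_erase, Finset.HasAntidiagonal.mem_antidiagonal] at hp
          obtain ⟨L, hL⟩ := ihb p.1 (by
            rcases lt_or_ge p.1 b with hlt | hge
            · exact hlt
            · exact absurd (Prod.ext (by simp only; omega) (by simp only; omega)) hp.1)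
          exact ⟨_, (hm p.2).mul hL⟩
        choose! L hL using hsum
        obtain ⟨L1, hL1⟩ := ihr (b + 1)
        obtain ⟨L2, hL2⟩ := ihr 0
        simp only [e]
        exact ⟨_, (hL1.sub ((hm (b + 1)).mul hL2)).sub (tendsto_finsetSum _ hL)⟩
  choose T hT using key
  refine ⟨fun r => T r 0, fun r => by simpa only [h2] using hT r 0, fun b r => T r b, ?_, ?_,
    fun r => rfl, ?_⟩
  · exact tendsto_nhds_unique (hm 0) (by simpa only [h0] using tendsto_const_nhds)
  · exact fun b => tendsto_nhds_unique (hT 0 b) (by simpa only [h1] using hm (b + 1))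
  · intro b r
    refine tendsto_nhds_unique (hT r (b + 1)) ?_
    simp only [h3, ← h2]
    exact ((hm (b + 1)).mul (hT r 0)).add
      (tendsto_finsetSum _ fun p _ => (hm p.2).mul (hT (r + 1) p.1))

/-- The free cumulants determine the moments. -/
theorem HasFreeCumulants.unique {m m' κ : ℕ → ℂ} (h : HasFreeCumulants m κ)
    (h' : HasFreeCumulants m' κ) : m = m' := by
  obtain ⟨t, h0, h1, h2, h3⟩ := h
  obtain ⟨t', h0', h1', h2', h3'⟩ := h'
  have key : ∀ b, m b = m' b ∧ ∀ r, t b r = t' b r := by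
    intro b
    induction b using Nat.strong_induction_on with
    | _ b ih =>
      cases b with
      | zero => exact ⟨by rw [h0, h0'], fun r => by rw [h2, h2']⟩
      | succ b =>
        have hb : m (b + 1) = m' (b + 1) := by rw [← h1, ← h1', (ih b (by omega)).2]
        refine ⟨hb, fun r => ?_⟩
        rw [h3, h3', hb]
        congr 1
        refine Finset.sum_congr rfl fun p hp => ?_
        rw [Finset.HasAntidiagonal.mem_antidiagonal] at hp
        rw [(ih p.2 (by omega)).1, (ih p.1 (by omega)).2]
  exact funext fun b => (key b).1

/-- If the cumulant of each order `r` is at most `σ ^ r`, then the moments are dominated by those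
of a free Poisson variable. -/
theorem HasFreeCumulants.norm_le {m κ : ℕ → ℂ} (h : HasFreeCumulants m κ) {σ : ℝ} (hσ : 0 ≤ σ)
    (hκ : ∀ r, ‖κ r‖ ≤ σ ^ (r + 1)) (n : ℕ) : ‖m n‖ ≤ (4 * σ) ^ n := by
  obtain ⟨t, h0, h1, h2, h3⟩ := h
  have key : ∀ b, ‖m b‖ ≤ catalan b * σ ^ b ∧
      ∀ r, ‖t b r‖ ≤ catalan (b + 1) * σ ^ (b + r + 1) := by
    intro b
    induction b using Nat.strong_induction_on with
    | _ b ih =>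
      cases b with
      | zero =>
        refine ⟨by simp [h0], fun r => ?_⟩
        rw [h2]
        simpa using hκ r
      | succ b =>
        have hb : ‖m (b + 1)‖ ≤ catalan (b + 1) * σ ^ (b + 1) := by
          rw [← h1]
          exact (ih b (by omega)).2 0
        refine ⟨hb, fun r => ?_⟩
        have e : (catalan (b + 1 + 1) : ℝ) * σ ^ (b + 1 + r + 1) =
            (catalan (b + 1) * σ ^ (b + 1)) * σ ^ (r + 1) +
              ∑ p ∈ antidiagonal b, (catalan p.2 * σ ^ p.2) *
                (catalan (p.1 + 1) * σ ^ (p.1 + (r + 1) + 1)) := by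
          have e1 : ∀ p ∈ antidiagonal b, (catalan p.2 * σ ^ p.2) *
                (catalan (p.1 + 1) * σ ^ (p.1 + (r + 1) + 1)) =
              ((catalan (p.1 + 1) : ℝ) * catalan p.2) * σ ^ (b + 1 + r + 1) := by
            intro p hp
            rw [Finset.HasAntidiagonal.mem_antidiagonal] at hp
            rw [show b + 1 + r + 1 = p.2 + (p.1 + (r + 1) + 1) by omega, pow_add σ p.2]
            ring
          rw [Finset.sum_congr rfl e1, ← Finset.sum_mul, catalan_succ' (b + 1),
            Finset.Nat.sum_antidiagonal_succ]
          push_cast [catalan_zero]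
          ring
        rw [h3, e]
        refine (norm_add_le _ _).trans (add_le_add ?_ ((norm_sum_le _ _).trans
          (Finset.sum_le_sum fun p hp => ?_)))
        · rw [norm_mul]
          exact mul_le_mul hb (hκ r) (norm_nonneg _) (by positivity)
        · rw [Finset.HasAntidiagonal.mem_antidiagonal] at hp
          rw [norm_mul]
          exact mul_le_mul (ih p.2 (by omega)).1 ((ih p.1 (by omega)).2 (r + 1))
            (norm_nonneg _) (by positivity)
  have hcat : (catalan n : ℝ) ≤ 4 ^ n := by
    have h1 : catalan n ≤ 4 ^ n := by
      rw [catalan_eq_centralBinom_div]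
      refine (Nat.div_le_self _ _).trans ?_
      rw [Nat.centralBinom, show (4 : ℕ) ^ n = 2 ^ (2 * n) by rw [pow_mul]; norm_num]
      exact Nat.choose_le_two_pow _ _
    exact_mod_cast h1
  rw [mul_pow]
  exact (key n).1.trans (mul_le_mul_of_nonneg_right hcat (by positivity))

/-! ### Tracial states on C*-algebras -/

/-- `φ` is a tracial state, not necessarily faithful. -/
structure IsTracialState {A : Type u} [CStarAlgebra A] (φ : A →ₗ[ℂ] ℂ) : Prop where
  map_one : φ 1 = 1
  nonneg : ∀ x : A, ∃ r : ℝ, 0 ≤ r ∧ φ (star x * x) = (r : ℂ)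
  trace : ∀ x y : A, φ (x * y) = φ (y * x)

theorem IsFaithfulTracialState.isTracialState {A : Type u} [CStarAlgebra A] {φ : A →ₗ[ℂ] ℂ}
    (h : IsFaithfulTracialState φ) : IsTracialState φ :=
  ⟨h.map_one, h.nonneg, h.trace⟩

section Order

open scoped ComplexOrder

attribute [local instance] CStarAlgebra.spectralOrder CStarAlgebra.spectralOrderedRing

/-- A tracial state as a positive linear map, for the spectral order. -/
noncomputable def IsTracialState.toPositive {A : Type u} [CStarAlgebra A] {φ : A →ₗ[ℂ] ℂ}
    (h : IsTracialState φ) : A →ₚ[ℂ] ℂ :=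
  PositiveLinearMap.mk₀ φ fun x hx => by
    obtain ⟨b, rfl⟩ := CStarAlgebra.nonneg_iff_eq_star_mul_self.mp hx
    obtain ⟨r, hr, e⟩ := h.nonneg b
    rw [e]
    exact_mod_cast hr

theorem IsTracialState.toPositive_apply {A : Type u} [CStarAlgebra A] {φ : A →ₗ[ℂ] ℂ}
    (h : IsTracialState φ) (x : A) : h.toPositive x = φ x := rfl

theorem IsTracialState.exists_norm_le {A : Type u} [CStarAlgebra A] {φ : A →ₗ[ℂ] ℂ}
    (h : IsTracialState φ) : ∃ C : ℝ, 0 < C ∧ ∀ x, ‖φ x‖ ≤ C * ‖x‖ := by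
  obtain ⟨C, hC⟩ := PositiveLinearMap.exists_norm_apply_le h.toPositive
  refine ⟨C + 1, by positivity, fun x => (hC x).trans ?_⟩
  gcongr
  simp

/-- The norm of a self-adjoint element is determined by the growth of its moments in a faithful
state. -/
theorem IsFaithfulTracialState.norm_le_of_moments {A : Type u} [CStarAlgebra A] {φ : A →ₗ[ℂ] ℂ}
    (h : IsFaithfulTracialState φ) {x : A} (hx : IsSelfAdjoint x) {C : ℝ} (hC : 0 ≤ C)
    (hm : ∀ k, ‖φ (x ^ k)‖ ≤ C ^ k) : ‖x‖ ≤ C := by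
  by_contra hlt
  rw [← cfc_id ℝ x, norm_cfc_le_iff id x hC] at hlt
  push Not at hlt
  obtain ⟨r, hr, hrC⟩ := hlt
  obtain ⟨R, hCR, hRr⟩ := exists_between hrC
  rw [id, Real.norm_eq_abs] at hRr
  have hR : 0 < R := hC.trans_lt hCR
  -- A bump function of `x` supported where the spectral value exceeds `R` in absolute value.
  set b := cfc (fun s : ℝ => max 0 (|s| - R)) x with hb
  have hbsa : IsSelfAdjoint b := cfc_predicate _ x
  have hb0 : b ≠ 0 := by
    intro h0
    have := norm_apply_le_norm_cfc (𝕜 := ℝ) (fun s : ℝ => max 0 (|s| - R)) x hr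
    rw [← hb, h0, norm_zero, norm_le_zero_iff] at this
    have h2 := le_max_right 0 (|r| - R)
    rw [this] at h2
    linarith
  have hkey : ∀ k : ℕ, (R ^ (2 * k)) • (b * b) ≤ ‖x‖ ^ 2 • x ^ (2 * k) := by
    intro k
    have e1 : (R ^ (2 * k)) • (b * b) =
        cfc (fun s : ℝ => R ^ (2 * k) • (max 0 (|s| - R) * max 0 (|s| - R))) x := by
      rw [cfc_smul (R ^ (2 * k)) (fun s : ℝ => max 0 (|s| - R) * max 0 (|s| - R)) x, cfc_mul _ _ x]
    have e2 : ‖x‖ ^ 2 • x ^ (2 * k) = cfc (fun s : ℝ => ‖x‖ ^ 2 • s ^ (2 * k)) x := by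
      rw [cfc_smul (‖x‖ ^ 2) (fun s : ℝ => s ^ (2 * k)) x, cfc_pow_id x]
    rw [e1, e2]
    refine cfc_mono fun s hs => ?_
    simp only [smul_eq_mul]
    have hsx : |s| ≤ ‖x‖ := IsometricContinuousFunctionalCalculus.norm_spectrum_le x hs
    rcases le_total |s| R with hle | hge
    · rw [max_eq_left (by linarith), mul_zero, mul_zero]
      exact mul_nonneg (by positivity) (Even.pow_nonneg (even_two_mul k) s)
    · rw [max_eq_right (by linarith), mul_comm]
      have h1 : R ^ (2 * k) ≤ s ^ (2 * k) := by
        rw [← (even_two_mul k).pow_abs s]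
        exact pow_le_pow_left₀ hR.le hge _
      have h2 : (|s| - R) * (|s| - R) ≤ ‖x‖ ^ 2 := by
        rw [sq]
        exact mul_le_mul (by linarith) (by linarith) (by linarith) (norm_nonneg _)
      exact mul_le_mul h2 h1 (by positivity) (by positivity)
  obtain ⟨p, hp, hpe⟩ := h.nonneg b
  rw [hbsa.star_eq] at hpe
  have hbound : ∀ k : ℕ, p ≤ ‖x‖ ^ 2 * ((C / R) ^ 2) ^ k := by
    intro k
    have h1 := OrderHomClass.mono h.isTracialState.toPositive (hkey k)
    rw [IsTracialState.toPositive_apply, IsTracialState.toPositive_apply,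
      ← Complex.coe_smul, ← Complex.coe_smul, map_smul, map_smul, hpe] at h1
    have h2 := (Complex.le_def.mp h1).1
    have h3 : (φ (x ^ (2 * k))).re ≤ C ^ (2 * k) := (Complex.re_le_norm _).trans (hm _)
    simp only [smul_eq_mul, Complex.re_ofReal_mul, Complex.ofReal_re] at h2
    rw [← pow_mul, div_pow, ← mul_div_assoc, le_div_iff₀ (by positivity), mul_comm]
    exact h2.trans (by gcongr)
  have hlim : Tendsto (fun k : ℕ => ‖x‖ ^ 2 * ((C / R) ^ 2) ^ k) atTop (𝓝 (‖x‖ ^ 2 * 0)) := by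
    refine (tendsto_pow_atTop_nhds_zero_of_lt_one (by positivity) ?_).const_mul _
    have : C / R < 1 := (div_lt_one hR).mpr hCR
    have h0 : 0 ≤ C / R := by positivity
    nlinarith
  have hp0 : p ≤ 0 := by
    simpa using ge_of_tendsto' hlim hbound
  refine hb0 (h.faithful b ?_)
  rw [hbsa.star_eq, hpe, le_antisymm hp0 hp, Complex.ofReal_zero]

/-- The GNS representation of a tracial state: its norm-closed image carries a faithful tracial
state which restricts to the given one.  By traciality, an operator of the image that kills the
vacuum vector kills a dense subspace. -/
theorem IsTracialState.exists_faithful {A : Type u} [CStarAlgebra A] {φ : A →ₗ[ℂ] ℂ}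
    (h : IsTracialState φ) :
    ∃ (B : Type u) (_ : CStarAlgebra B) (ψ : B →ₗ[ℂ] ℂ) (π : A →⋆ₐ[ℂ] B),
      IsFaithfulTracialState ψ ∧ ∀ x, ψ (π x) = φ x := by
  set f := h.toPositive with hf
  set ρ : A →⋆ₐ[ℂ] (f.GNS →L[ℂ] f.GNS) := f.gnsStarAlgHom with hρ
  set Ω : f.GNS := ((f.toPreGNS 1 : f.PreGNS) : f.GNS) with hΩ
  -- The vacuum vector `Ω` is cyclic, and its vector state `Ψ` extends `φ`.
  have hρΩ : ∀ x, ρ x Ω = ((f.toPreGNS x : f.PreGNS) : f.GNS) := by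
    intro x
    simp [hρ, hΩ]
  set Ψ : (f.GNS →L[ℂ] f.GNS) →ₗ[ℂ] ℂ :=
    { toFun := fun T => inner ℂ Ω (T Ω)
      map_add' := fun T U => by simp [inner_add_right]
      map_smul' := fun c T => by simp [inner_smul_right] } with hΨ
  have hΨa : ∀ T, Ψ T = inner ℂ Ω (T Ω) := fun T => rfl
  have hΨρ : ∀ x, Ψ (ρ x) = φ x := by
    intro x
    rw [hΨa, hρΩ, hΩ, UniformSpace.Completion.inner_coe, PositiveLinearMap.preGNS_inner_def]
    simp [hf, IsTracialState.toPositive_apply]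
  have hΨc : Continuous Ψ := by
    change Continuous fun T : f.GNS →L[ℂ] f.GNS => inner ℂ Ω (T Ω)
    fun_prop
  set B : StarSubalgebra ℂ (f.GNS →L[ℂ] f.GNS) := ρ.range.topologicalClosure with hB
  have hBc : IsClosed (B : Set (f.GNS →L[ℂ] f.GNS)) := ρ.range.isClosed_topologicalClosure
  have hBsub : ∀ P : (f.GNS →L[ℂ] f.GNS) → Prop, IsClosed {T | P T} → (∀ x, P (ρ x)) →
      ∀ T ∈ B, P T := by
    intro P hP hx T hT
    have h1 : closure (ρ.range : Set (f.GNS →L[ℂ] f.GNS)) ⊆ {T | P T} := by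
      refine closure_minimal ?_ hP
      rintro _ ⟨x, rfl⟩
      exact hx x
    exact h1 hT
  have htr1 : ∀ y, ∀ T ∈ B, Ψ (T * ρ y) = Ψ (ρ y * T) := by
    intro y
    refine hBsub _ (isClosed_eq (by fun_prop) (by fun_prop)) fun x => ?_
    rw [← map_mul, ← map_mul, hΨρ, hΨρ, h.trace]
  have htr : ∀ T ∈ B, ∀ U ∈ B, Ψ (T * U) = Ψ (U * T) := by
    intro T hT
    exact hBsub _ (isClosed_eq (by fun_prop) (by fun_prop)) fun y => htr1 y T hT
  have hsq : ∀ T, Ψ (star T * T) = ((‖T Ω‖ ^ 2 : ℝ) : ℂ) := by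
    intro T
    rw [hΨa, mul_apply_eq_comp, ContinuousLinearMap.star_eq_adjoint,
      ContinuousLinearMap.adjoint_inner_right, inner_self_eq_norm_sq_to_K]
    norm_cast
  have hρB : ∀ x, ρ x ∈ B := fun x => ρ.range.le_topologicalClosure ⟨x, rfl⟩
  refine ⟨B, StarSubalgebra.cstarAlgebra B, Ψ.comp B.subtype.toLinearMap,
    ρ.codRestrict B hρB, ⟨?_, ?_, ?_, ?_⟩, hΨρ⟩
  · change Ψ 1 = 1
    rw [← _root_.map_one ρ, hΨρ, h.map_one]
  · intro T
    exact ⟨_, by positivity, hsq T⟩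
  · intro T U
    exact htr T T.2 U U.2
  · intro T hT
    have hT1 : Ψ (star (T : f.GNS →L[ℂ] f.GNS) * T) = 0 := hT
    have hT2 : star (T : f.GNS →L[ℂ] f.GNS) Ω = 0 := by
      rw [htr _ (star_mem T.2) _ T.2] at hT1
      have := hsq (star (T : f.GNS →L[ℂ] f.GNS))
      rw [star_star, hT1] at this
      have h2 : ‖star (T : f.GNS →L[ℂ] f.GNS) Ω‖ ^ 2 = 0 := by exact_mod_cast this.symm
      exact norm_eq_zero.mp (pow_eq_zero_iff two_ne_zero |>.mp h2)
    have hT3 : ∀ x, (T : f.GNS →L[ℂ] f.GNS) (ρ x Ω) = 0 := by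
      intro x
      have h1 := hsq ((T : f.GNS →L[ℂ] f.GNS) * ρ x)
      rw [htr _ (star_mem (mul_mem T.2 (hρB x))) _ (mul_mem T.2 (hρB x)), star_mul, hΨa] at h1
      simp only [mul_apply_eq_comp, hT2, map_zero, inner_zero_right] at h1
      have h2 : ‖(T : f.GNS →L[ℂ] f.GNS) (ρ x Ω)‖ ^ 2 = 0 := by exact_mod_cast h1.symm
      exact norm_eq_zero.mp (pow_eq_zero_iff two_ne_zero |>.mp h2)
    refine Subtype.ext (ContinuousLinearMap.ext fun v => ?_)
    change (T : f.GNS →L[ℂ] f.GNS) v = 0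
    induction v using UniformSpace.Completion.induction_on with
    | hp => exact isClosed_eq (by fun_prop) continuous_const
    | ih a =>
      have := hT3 (f.ofPreGNS a)
      rwa [hρΩ] at this

end Order

/-! ### The tracial ultrapower -/

open scoped BoundedContinuousFunction in
/-- The limit of a tracial state along an ultrafilter, on bounded sequences. -/
theorem IsTracialState.exists_ultralimit {A : Type u} [CStarAlgebra A] {φ : A →ₗ[ℂ] ℂ}
    (h : IsTracialState φ) (U : Ultrafilter ℕ) :
    ∃ ψ : (ℕ →ᵇ A) →ₗ[ℂ] ℂ, IsTracialState ψ ∧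
      ∀ x : ℕ →ᵇ A, Tendsto (fun n => φ (x n)) U (𝓝 (ψ x)) := by
  obtain ⟨C, hC, hφ⟩ := h.exists_norm_le
  have hex : ∀ x : ℕ →ᵇ A, ∃ L, Tendsto (fun n => φ (x n)) U (𝓝 L) := by
    intro x
    obtain ⟨L, -, hL⟩ := (isCompact_closedBall (0 : ℂ) (C * ‖x‖)).ultrafilter_le_nhds
      (U.map fun n => φ (x n)) (by
        rw [Ultrafilter.coe_map, le_principal_iff, mem_map]
        refine Filter.univ_mem' fun n => ?_
        simp only [Set.mem_preimage, mem_closedBall_zero_iff]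
        exact (hφ _).trans (mul_le_mul_of_nonneg_left (x.norm_coe_le_norm n) hC.le))
    exact ⟨L, hL⟩
  choose ψ hψ using hex
  refine ⟨{ toFun := ψ, map_add' := fun x y => ?_, map_smul' := fun c x => ?_ },
    ⟨?_, fun x => ?_, fun x y => ?_⟩, hψ⟩
  · refine tendsto_nhds_unique (hψ (x + y)) ?_
    simpa using (hψ x).add (hψ y)
  · refine tendsto_nhds_unique (hψ (c • x)) ?_
    simpa using (hψ x).const_mul c
  · refine tendsto_nhds_unique (hψ 1) ?_
    simp [h.map_one]
  · have hc : IsClosed {z : ℂ | 0 ≤ z.re ∧ z.im = 0} :=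
      (isClosed_le continuous_const Complex.continuous_re).inter
        (isClosed_eq Complex.continuous_im continuous_const)
    have hmem : ψ (star x * x) ∈ {z : ℂ | 0 ≤ z.re ∧ z.im = 0} := by
      refine hc.mem_of_tendsto (hψ (star x * x)) (Eventually.of_forall fun n => ?_)
      obtain ⟨r, hr, e⟩ := h.nonneg (x n)
      have : φ ((star x * x) n) = r := e
      rw [this]
      exact ⟨by simpa using hr, by simp⟩
    exact ⟨(ψ (star x * x)).re, hmem.1, Complex.ext (by simp) (by simpa using hmem.2)⟩
  · refine tendsto_nhds_unique (hψ (x * y)) ?_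
    have e : ∀ n, φ ((y * x) n) = φ ((x * y) n) := fun n => h.trace _ _
    have h1 := hψ (y * x)
    simp only [e] at h1
    exact h1

/-! ### Wick-ordered quadratic forms with Hermitian coefficients -/

theorem trace_mul_pow_comm {n : ℕ} (P Q : Matrix (Fin n) (Fin n) ℂ) (k : ℕ) :
    ((P * Q) ^ (k + 1)).trace = ((Q * P) ^ (k + 1)).trace := by
  have h : ∀ k, (P * Q) ^ (k + 1) = P * (Q * P) ^ k * Q := by
    intro k
    induction k with
    | zero => simp
    | succ k ih => rw [pow_succ, ih, pow_succ (Q * P)]; simp only [mul_assoc]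
  rw [h, Matrix.trace_mul_comm, ← mul_assoc, ← pow_succ']

theorem trace_pow_eq_sum_eigenvalues {n : ℕ} {P : Matrix (Fin n) (Fin n) ℂ} (hP : P.IsHermitian)
    (k : ℕ) : (P ^ k).trace = ((∑ i, hP.eigenvalues i ^ k : ℝ) : ℂ) := by
  conv_lhs => rw [hP.spectral_theorem]
  rw [← map_pow, Unitary.conjStarAlgAut_apply, Matrix.trace_mul_comm, ← mul_assoc,
    Unitary.coe_star_mul_self, one_mul, Matrix.diagonal_pow, Matrix.trace_diagonal]
  simp

/-- The cumulants of a Hermitian Wick-ordered quadratic form are the power sums of a real family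
with the same sum of squares as the weighted coefficients. -/
theorem exists_wickCumulant_eq {n : ℕ} {c : Matrix (Fin n) (Fin n) ℂ} (hc : c.IsHermitian)
    {w : ℕ → ℝ} (hw : ∀ i, 0 ≤ w i) :
    ∃ lam : Fin n → ℝ, ∑ i, lam i ^ 2 = ∑ i, ∑ j, ‖c i j‖ ^ 2 * (w i * w j) ∧
      ∀ r, wickCumulant (fun i => w i) c 0 r =
        if r = 0 then 0 else ((∑ i, lam i ^ (r + 1) : ℝ) : ℂ) := by
  -- The traces of powers of `c * D ^ 2` are those of the Hermitian matrix `D * c * D`.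
  set D : Matrix (Fin n) (Fin n) ℂ := Matrix.diagonal fun i => ((√(w i) : ℝ) : ℂ) with hD
  have hDD : Matrix.diagonal (fun i : Fin n => ((w i : ℝ) : ℂ)) = D * D := by
    rw [hD, Matrix.diagonal_mul_diagonal]
    congr 1
    ext i
    rw [← Complex.ofReal_mul, Real.mul_self_sqrt (hw i)]
  have hDs : D.conjTranspose = D := by
    rw [hD, Matrix.diagonal_conjTranspose]
    congr 1
    ext i
    simp
  have hP : (D * (c * D)).IsHermitian := by
    rw [Matrix.IsHermitian, Matrix.conjTranspose_mul, Matrix.conjTranspose_mul, hDs, hc.eq,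
      mul_assoc]
  have htr : ∀ k, ((c * Matrix.diagonal (fun i : Fin n => ((w i : ℝ) : ℂ))) ^ (k + 1)).trace =
      ((∑ i, hP.eigenvalues i ^ (k + 1) : ℝ) : ℂ) := by
    intro k
    rw [hDD, ← mul_assoc, trace_mul_pow_comm, trace_pow_eq_sum_eigenvalues]
  refine ⟨hP.eigenvalues, ?_, fun r => ?_⟩
  · have h2 : ((c * Matrix.diagonal (fun i : Fin n => ((w i : ℝ) : ℂ))) ^ (1 + 1)).trace =
        ((∑ i, ∑ j, ‖c i j‖ ^ 2 * (w i * w j) : ℝ) : ℂ) := by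
      rw [one_add_one_eq_two, sq, Matrix.trace]
      push_cast
      refine Finset.sum_congr rfl fun i _ => ?_
      rw [Matrix.diag_apply, Matrix.mul_apply]
      refine Finset.sum_congr rfl fun j _ => ?_
      rw [Matrix.mul_diagonal, Matrix.mul_diagonal, ← hc.apply i j, Complex.star_def,
        ← Complex.conj_mul']
      simp only [Complex.conj_conj]
      ring
    exact Complex.ofReal_injective ((htr 1).symm.trans h2)
  · by_cases hr : r = 0
    · simp [wickCumulant, hr]
    · simp only [wickCumulant, hr, if_false, htr]
      simp

/-- The power sums of order at least two are controlled by the sum of squares. -/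
theorem abs_sum_pow_le {n : ℕ} (lam : Fin n → ℝ) {r : ℕ} (hr : r ≠ 0) :
    |∑ i, lam i ^ (r + 1)| ≤ √(∑ i, lam i ^ 2) ^ (r + 1) := by
  obtain ⟨s, rfl⟩ := Nat.exists_eq_succ_of_ne_zero hr
  set σ := √(∑ i, lam i ^ 2) with hσ
  have h0 : 0 ≤ ∑ i, lam i ^ 2 := Finset.sum_nonneg fun i _ => sq_nonneg _
  have h1 : ∀ i, |lam i| ≤ σ := fun i =>
    Real.abs_le_sqrt (Finset.single_le_sum (f := fun i => lam i ^ 2) (fun i _ => sq_nonneg _)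
      (Finset.mem_univ i))
  calc |∑ i, lam i ^ (s + 1 + 1)| ≤ ∑ i, |lam i ^ (s + 1 + 1)| := Finset.abs_sum_le_sum_abs _ _
    _ ≤ ∑ i, σ ^ s * lam i ^ 2 := by
        refine Finset.sum_le_sum fun i _ => ?_
        rw [add_assoc, one_add_one_eq_two, pow_add, abs_mul, abs_sq, abs_pow]
        gcongr
        exact h1 i
    _ = σ ^ (s + 1 + 1) := by
        rw [← Finset.mul_sum, ← Real.sq_sqrt h0, ← hσ]
        ring

section WickForm

variable {A : Type*} [CStarAlgebra A] (X : ℕ → A) (w : ℕ → ℂ) {n : ℕ}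

theorem wickForm_add (c c' : Matrix (Fin n) (Fin n) ℂ) (d d' : ℂ) :
    wickForm X w (c + c') (d + d') = wickForm X w c d + wickForm X w c' d' := by
  simp only [wickForm, Matrix.add_apply, add_smul, Finset.sum_add_distrib]
  abel

theorem wickForm_smul (a : ℂ) (c : Matrix (Fin n) (Fin n) ℂ) (d : ℂ) :
    wickForm X w (a • c) (a * d) = a • wickForm X w c d := by
  simp only [wickForm, Matrix.smul_apply, smul_eq_mul, mul_smul, smul_add, Finset.smul_sum]

theorem isSelfAdjoint_wickForm {w : ℕ → ℝ} (hX : ∀ i, IsSelfAdjoint (X i))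
    {c : Matrix (Fin n) (Fin n) ℂ} (hc : c.IsHermitian) :
    IsSelfAdjoint (wickForm X (fun i => w i) c 0) := by
  simp only [IsSelfAdjoint, wickForm, zero_smul, zero_add, star_sum, star_smul, star_sub, star_mul,
    star_one, (hX _).star_eq]
  rw [Finset.sum_comm]
  refine Finset.sum_congr rfl fun i _ => Finset.sum_congr rfl fun j _ => ?_
  rw [hc.apply]
  by_cases hij : i = j
  · subst hij; simp
  · simp [hij, Ne.symm hij]

end WickForm

namespace IsFreeSemicircularFamily

variable {A : Type u} [CStarAlgebra A] {φ : A →ₗ[ℂ] ℂ} {X : ℕ → A} {w : ℕ → ℝ}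

/-- Haagerup-type inequality for Hermitian coefficients: the operator norm is controlled by the
`L²` norm of the coefficients. -/
theorem norm_wickForm_le_of_isHermitian (h : IsFreeSemicircularFamily φ X w)
    (hφ : IsFaithfulTracialState φ) (hw : ∀ i, 0 ≤ w i) {n : ℕ}
    {c : Matrix (Fin n) (Fin n) ℂ} (hc : c.IsHermitian) :
    ‖wickForm X (fun i => w i) c 0‖ ≤ 4 * √(∑ i, ∑ j, ‖c i j‖ ^ 2 * (w i * w j)) := by
  obtain ⟨lam, hlam, hκ⟩ := exists_wickCumulant_eq hc hw
  refine hφ.norm_le_of_moments (isSelfAdjoint_wickForm X (fun i => (h.semicircular i).1) hc)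
    (by positivity) fun k => ?_
  refine (h.hasFreeCumulants_wickForm c 0).norm_le (Real.sqrt_nonneg _) (fun r => ?_) k
  rw [hκ, ← hlam]
  by_cases hr : r = 0
  · simp [hr]
  · rw [if_neg hr, Complex.norm_real, Real.norm_eq_abs]
    exact abs_sum_pow_le lam hr

/-- Haagerup-type inequality for arbitrary coefficients. -/
theorem norm_wickForm_le (h : IsFreeSemicircularFamily φ X w)
    (hφ : IsFaithfulTracialState φ) (hw : ∀ i, 0 ≤ w i) {n : ℕ}
    (c : Matrix (Fin n) (Fin n) ℂ) :
    ‖wickForm X (fun i => w i) c 0‖ ≤ 8 * √(∑ i, ∑ j, ‖c i j‖ ^ 2 * (w i * w j)) := by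
  set W : ℕ → ℂ := fun i => w i with hW
  -- The coefficient matrix is `c₁ + I • c₂` with Hermitian matrices `c₁` and `c₂`.
  set c₁ : Matrix (Fin n) (Fin n) ℂ := (2⁻¹ : ℂ) • (c + c.conjTranspose) with hc₁
  set c₂ : Matrix (Fin n) (Fin n) ℂ := (Complex.I * 2⁻¹) • (c.conjTranspose - c) with hc₂
  have h₁ : c₁.IsHermitian := by
    simp [Matrix.IsHermitian, hc₁, Matrix.conjTranspose_add, add_comm]
  have h₂ : c₂.IsHermitian := by
    rw [Matrix.IsHermitian, hc₂, Matrix.conjTranspose_smul, Matrix.conjTranspose_sub,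
      Matrix.conjTranspose_conjTranspose, ← neg_sub c.conjTranspose c, smul_neg, ← neg_smul]
    congr 1
    simp
  have hdec : c = c₁ + Complex.I • c₂ := by
    ext i j
    simp only [hc₁, hc₂, Matrix.add_apply, Matrix.smul_apply, Matrix.sub_apply, smul_eq_mul]
    linear_combination (2⁻¹ * (c.conjTranspose i j - c i j)) * (-Complex.I_mul_I)
  have hform : wickForm X W c 0 = wickForm X W c₁ 0 + Complex.I • wickForm X W c₂ 0 := by
    conv_lhs => rw [hdec]
    rw [← wickForm_smul, ← wickForm_add, mul_zero, add_zero]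
  have hbound : ∀ c' : Matrix (Fin n) (Fin n) ℂ,
      (∀ i j, ‖c' i j‖ ≤ 2⁻¹ * (‖c i j‖ + ‖c j i‖)) →
      √(∑ i, ∑ j, ‖c' i j‖ ^ 2 * (w i * w j)) ≤ √(∑ i, ∑ j, ‖c i j‖ ^ 2 * (w i * w j)) := by
    intro c' hc'
    refine Real.sqrt_le_sqrt ?_
    have e : ∑ i : Fin n, ∑ j : Fin n, ‖c i j‖ ^ 2 * (w i * w j) =
        ∑ i : Fin n, ∑ j : Fin n,
          (2⁻¹ * ‖c i j‖ ^ 2 * (w i * w j) + 2⁻¹ * ‖c j i‖ ^ 2 * (w i * w j)) := by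
      have e1 : ∑ i : Fin n, ∑ j : Fin n, 2⁻¹ * ‖c j i‖ ^ 2 * (w i * w j) =
          ∑ i : Fin n, ∑ j : Fin n, 2⁻¹ * ‖c i j‖ ^ 2 * (w i * w j) := by
        rw [Finset.sum_comm]
        exact Finset.sum_congr rfl fun i _ => Finset.sum_congr rfl fun j _ => by ring
      simp only [Finset.sum_add_distrib, e1]
      simp only [← Finset.sum_add_distrib]
      exact Finset.sum_congr rfl fun i _ => Finset.sum_congr rfl fun j _ => by ring
    rw [e]
    refine Finset.sum_le_sum fun i _ => Finset.sum_le_sum fun j _ => ?_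
    rw [← add_mul]
    refine mul_le_mul_of_nonneg_right ?_ (mul_nonneg (hw i) (hw j))
    have := pow_le_pow_left₀ (norm_nonneg _) (hc' i j) 2
    nlinarith [sq_nonneg (‖c i j‖ - ‖c j i‖)]
  have b₁ := hbound c₁ fun i j => by
    simp only [hc₁, Matrix.smul_apply, Matrix.add_apply, Matrix.conjTranspose_apply, norm_smul]
    refine mul_le_mul (by simp) ((norm_add_le _ _).trans (by simp)) (norm_nonneg _) (by norm_num)
  have b₂ := hbound c₂ fun i j => by
    simp only [hc₂, Matrix.smul_apply, Matrix.sub_apply, Matrix.conjTranspose_apply, norm_smul]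
    refine mul_le_mul (by simp) ((norm_sub_le _ _).trans (by simp [add_comm])) (norm_nonneg _)
      (by norm_num)
  have n₁ := h.norm_wickForm_le_of_isHermitian hφ hw h₁
  have n₂ := h.norm_wickForm_le_of_isHermitian hφ hw h₂
  rw [hform]
  refine (norm_add_le _ _).trans ?_
  rw [norm_smul, Complex.norm_I, one_mul]
  linarith

end IsFreeSemicircularFamily

/-! ### Square integrals of step functions -/

theorem eLpNorm_two_sq {α : Type*} [MeasurableSpace α] (μ : Measure α) (f : α → ℝ) :
    eLpNorm f 2 μ ^ 2 = ∫⁻ x, ‖f x‖ₑ ^ 2 ∂μ := by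
  have h := eLpNorm_nnreal_pow_eq_lintegral (f := f) (μ := μ) (p := 2) two_ne_zero
  simpa using h

theorem lintegral_enorm_sq_tsum_indicator {α ι : Type*} [MeasurableSpace α] [Countable ι]
    (μ : Measure α) {E : ι → Set α} (hE : ∀ k, MeasurableSet (E k))
    (hd : Pairwise fun k l => Disjoint (E k) (E l)) (c : ι → ℝ) :
    ∫⁻ x, ‖∑' k, (E k).indicator (fun _ => c k) x‖ₑ ^ 2 ∂μ = ∑' k, ‖c k‖ₑ ^ 2 * μ (E k) := by
  have hpt : ∀ x, ‖∑' k, (E k).indicator (fun _ => c k) x‖ₑ ^ 2 =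
      ∑' k, (E k).indicator (fun _ => ‖c k‖ₑ ^ 2) x := by
    intro x
    by_cases hx : ∃ k, x ∈ E k
    · obtain ⟨k, hk⟩ := hx
      have hk' : ∀ l, l ≠ k → x ∉ E l := fun l hl hxl =>
        Set.disjoint_left.mp (hd hl) hxl hk
      rw [tsum_eq_single k fun l hl => Set.indicator_of_notMem (hk' l hl) _,
        tsum_eq_single k fun l hl => Set.indicator_of_notMem (hk' l hl) _,
        Set.indicator_of_mem hk, Set.indicator_of_mem hk]
    · push Not at hx
      simp [Set.indicator_of_notMem (hx _)]
  simp only [hpt]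
  rw [lintegral_tsum fun k => (measurable_const.indicator (hE k)).aemeasurable]
  refine tsum_congr fun k => ?_
  rw [lintegral_indicator_const (hE k)]

theorem quadrant_rect (s t u v : ℝ≥0) :
    quadrant (Set.Ioc (s : ℝ) t ×ˢ Set.Ioc (u : ℝ) v) =
      ENNReal.ofReal ((t : ℝ) - s) * ENNReal.ofReal ((v : ℝ) - u) := by
  have hsub : Set.Ioc (s : ℝ) t ×ˢ Set.Ioc (u : ℝ) v ⊆ Set.Ici 0 ×ˢ Set.Ici 0 :=
    Set.prod_mono (fun x hx => s.2.trans hx.1.le) (fun x hx => u.2.trans hx.1.le)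
  rw [quadrant, Measure.restrict_eq_self _ hsub, Measure.volume_eq_prod, Measure.prod_prod,
    Real.volume_Ioc, Real.volume_Ioc]

/-! ### Step functions on a grid -/

/-- The indicator function of the interval `(s, t]`. -/
noncomputable def iocFun (s t : ℝ≥0) (x : ℝ) : ℝ := (Set.Ioc (s : ℝ) t).indicator (fun _ => 1) x

theorem iocFun_eq_sub {r r' : ℝ≥0} (hr : r ≤ r') (x : ℝ) :
    iocFun r r' x = (if x ≤ r' then 1 else 0) - (if x ≤ r then 1 else 0) := by
  have hr' : (r : ℝ) ≤ r' := hr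
  simp only [iocFun, Set.indicator_apply, Set.mem_Ioc]
  by_cases h1 : x ≤ r
  · simp [h1, h1.trans hr', not_lt.mpr h1]
  · simp [h1, not_le.mp h1]

theorem OffDiagRect.indicator_toSet (R : OffDiagRect) (p : ℝ × ℝ) :
    R.toSet.indicator (fun _ => (1 : ℝ)) p = iocFun R.s R.t p.1 * iocFun R.u R.v p.2 := by
  simp only [OffDiagRect.toSet, iocFun, Set.indicator_apply, Set.mem_prod]
  split_ifs <;> simp_all

/-- Every finite set of times lies in a monotone sequence starting at zero, which is strictly
monotone on an initial segment containing the set. -/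
theorem exists_grid (s : Finset ℝ≥0) :
    ∃ (t : ℕ → ℝ≥0) (n : ℕ), Monotone t ∧ StrictMonoOn t (Set.Iic n) ∧ t 0 = 0 ∧
      ∀ x ∈ s, ∃ k ≤ n, t k = x := by
  classical
  obtain ⟨n, hn⟩ : ∃ n, (insert 0 s).card = n + 1 :=
    Nat.exists_eq_succ_of_ne_zero (Finset.card_ne_zero_of_mem (Finset.mem_insert_self 0 s))
  set e := (insert 0 s).orderEmbOfFin hn with he
  refine ⟨fun k => e ⟨min k n, by omega⟩, n, ?_, ?_, ?_, ?_⟩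
  · intro a b hab
    exact e.monotone (Fin.mk_le_mk.mpr (min_le_min_right n hab))
  · intro a ha b hb hab
    refine e.strictMono (Fin.mk_lt_mk.mpr ?_)
    rwa [min_eq_left ha, min_eq_left hb]
  · obtain ⟨k, hk⟩ : (0 : ℝ≥0) ∈ Set.range e := by
      rw [he, Finset.range_orderEmbOfFin]
      simp
    have h2 := e.monotone (Fin.zero_le k)
    rw [hk] at h2
    have h3 : e 0 = 0 := le_antisymm h2 zero_le
    simpa using h3
  · intro x hx
    obtain ⟨k, hk⟩ : x ∈ Set.range e := by
      rw [he, Finset.range_orderEmbOfFin]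
      simp [hx]
    refine ⟨k, by omega, ?_⟩
    rw [← hk]
    exact congrArg e (Fin.ext (min_eq_left (by omega)))

/-- A grid adapted to an off-diagonal step function: all corners of its rectangles are grid
points. -/
structure IsGridFor (t : ℕ → ℝ≥0) (n : ℕ) (g : OffDiagRect →₀ ℝ) : Prop where
  mono : Monotone t
  strictMono : StrictMonoOn t (Set.Iic n)
  corners : ∀ R ∈ g.support, ∀ x ∈ ({R.s, R.t, R.u, R.v} : Set ℝ≥0), ∃ k ≤ n, t k = x

theorem exists_isGridFor (g : OffDiagRect →₀ ℝ) : ∃ t n, IsGridFor t n g := by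
  classical
  obtain ⟨t, n, h1, h2, -, h3⟩ := exists_grid
    (g.support.biUnion fun R => ({R.s, R.t, R.u, R.v} : Finset ℝ≥0))
  refine ⟨t, n, h1, h2, fun R hR x hx => h3 x ?_⟩
  rw [Finset.mem_biUnion]
  exact ⟨R, hR, by simpa using hx⟩

/-- The increments over the grid intervals inside `(s, t]` add up to the increment over
`(s, t]`. -/
theorem sum_grid_increments {M : Type*} [AddCommGroup M] (Y : ℝ≥0 → M) {t : ℕ → ℝ≥0} {n : ℕ}
    (ht : StrictMonoOn t (Set.Iic n)) {a b : ℕ} (ha : a ≤ n) (hb : b ≤ n) (hab : t a ≤ t b) :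
    ∑ i : Fin n, (if t a < t (i + 1) ∧ t (i + 1) ≤ t b then Y (t (i + 1)) - Y (t i) else 0) =
      Y (t b) - Y (t a) := by
  have hab' : a ≤ b := (ht.le_iff_le ha hb).mp hab
  have hcond : ∀ i : Fin n, (t a < t (i + 1) ∧ t (i + 1) ≤ t b) ↔ (a ≤ i ∧ (i : ℕ) < b) := by
    intro i
    have hi : (i : ℕ) + 1 ∈ Set.Iic n := i.2
    rw [ht.lt_iff_lt ha hi, ht.le_iff_le hi hb]
    omega
  simp only [hcond]
  rw [Fin.sum_univ_eq_sum_range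
    (fun i => if a ≤ i ∧ i < b then Y (t (i + 1)) - Y (t i) else 0) n, ← Finset.sum_filter]
  have hf : (Finset.range n).filter (fun i => a ≤ i ∧ i < b) = Finset.Ico a b := by
    ext i
    simp only [Finset.mem_filter, Finset.mem_range, Finset.mem_Ico]
    omega
  rw [hf, Finset.sum_Ico_eq_sub _ hab', Finset.sum_range_sub (fun i => Y (t i)),
    Finset.sum_range_sub (fun i => Y (t i))]
  abel

/-- The values of a step function at the upper right corners of the grid cells. -/
noncomputable def gridMatrix (t : ℕ → ℝ≥0) (n : ℕ) (g : OffDiagRect →₀ ℝ) :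
    Matrix (Fin n) (Fin n) ℂ :=
  Matrix.of fun i j => ((stepFun g (t (i + 1), t (j + 1)) : ℝ) : ℂ)

/-- Step functions supported off the diagonal vanish on the diagonal, so that the integral of a step
function needs no Wick correction. -/
theorem stepFun_diag (g : OffDiagRect →₀ ℝ) (x : ℝ≥0) : stepFun g (x, x) = 0 := by
  refine Finset.sum_eq_zero fun R _ => ?_
  simp only
  rw [Set.indicator_of_notMem, mul_zero]
  intro hx
  have h1 : x ∈ Set.Ioc R.s R.t := by exact_mod_cast hx.1
  have h2 : x ∈ Set.Ioc R.u R.v := by exact_mod_cast hx.2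
  exact Set.disjoint_left.mp R.disjoint h1 h2

namespace IsGridFor

variable {t : ℕ → ℝ≥0} {n : ℕ} {g : OffDiagRect →₀ ℝ}

theorem sum_iocFun_smul {A : Type*} [AddCommGroup A] [Module ℂ A] (S : ℝ≥0 → A)
    (h : IsGridFor t n g) {a b : ℝ≥0} (ha : ∃ k ≤ n, t k = a) (hb : ∃ k ≤ n, t k = b)
    (hab : a ≤ b) :
    ∑ i : Fin n, ((iocFun a b (t (i + 1)) : ℝ) : ℂ) • (S (t (i + 1)) - S (t i)) = S b - S a := by
  obtain ⟨k, hk, rfl⟩ := ha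
  obtain ⟨l, hl, rfl⟩ := hb
  rw [← sum_grid_increments S h.strictMono hk hl hab]
  refine Finset.sum_congr rfl fun i _ => ?_
  simp only [iocFun, Set.indicator_apply, Set.mem_Ioc, NNReal.coe_lt_coe, NNReal.coe_le_coe]
  split_ifs <;> simp

theorem sum_iocFun_mul (h : IsGridFor t n g) {a b : ℝ≥0} (ha : ∃ k ≤ n, t k = a)
    (hb : ∃ k ≤ n, t k = b) (hab : a ≤ b) (x : ℝ) :
    ∑ i : Fin n, iocFun a b (t (i + 1)) * iocFun (t i) (t (i + 1)) x = iocFun a b x := by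
  obtain ⟨k, hk, rfl⟩ := ha
  obtain ⟨l, hl, rfl⟩ := hb
  rw [iocFun_eq_sub hab, ← sum_grid_increments (fun r : ℝ≥0 => if x ≤ r then (1 : ℝ) else 0)
    h.strictMono hk hl hab]
  refine Finset.sum_congr rfl fun i _ => ?_
  rw [← iocFun_eq_sub (h.mono (Nat.le_succ i))]
  simp only [iocFun, Set.indicator_apply, Set.mem_Ioc, NNReal.coe_lt_coe, NNReal.coe_le_coe]
  split_ifs <;> simp

theorem stepIntegral_eq {A : Type*} [CStarAlgebra A] (S : ℝ≥0 → A) (h : IsGridFor t n g)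
    (w : ℕ → ℂ) :
    stepIntegral S g =
      wickForm (fun k => S (t (k + 1)) - S (t k)) w (gridMatrix t n g) 0 := by
  have h1 : ∀ R ∈ g.support, (S R.t - S R.s) * (S R.v - S R.u) =
      ∑ i : Fin n, ∑ j : Fin n,
        ((R.toSet.indicator (fun _ => (1 : ℝ)) (t (i + 1), t (j + 1)) : ℝ) : ℂ) •
          ((S (t (i + 1)) - S (t i)) * (S (t (j + 1)) - S (t j))) := by
    intro R hR
    have hc := h.corners R hR
    rw [← h.sum_iocFun_smul S (hc R.s (by simp)) (hc R.t (by simp)) R.le_st,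
      ← h.sum_iocFun_smul S (hc R.u (by simp)) (hc R.v (by simp)) R.le_uv, Finset.sum_mul_sum]
    refine Finset.sum_congr rfl fun i _ => Finset.sum_congr rfl fun j _ => ?_
    rw [R.indicator_toSet, smul_mul_smul_comm]
    push_cast
    rfl
  have h2 : ∀ i j : Fin n, gridMatrix t n g i j •
      ((S (t (i + 1)) - S (t i)) * (S (t (j + 1)) - S (t j)) -
        (if i = j then w i else 0) • (1 : A)) =
      ∑ R ∈ g.support, (g R : ℂ) •
        ((R.toSet.indicator (fun _ => (1 : ℝ)) (t (i + 1), t (j + 1)) : ℝ) : ℂ) •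
        ((S (t (i + 1)) - S (t i)) * (S (t (j + 1)) - S (t j))) := by
    intro i j
    have h3 : gridMatrix t n g i j • ((if i = j then w i else 0) • (1 : A)) = 0 := by
      by_cases hij : i = j
      · subst hij
        simp [gridMatrix, stepFun_diag]
      · simp [hij]
    rw [smul_sub, h3, sub_zero, gridMatrix, Matrix.of_apply, stepFun, Finsupp.sum]
    push_cast
    simp only [Finset.sum_smul, mul_smul]
  simp only [wickForm, zero_smul, zero_add, h2]
  rw [stepIntegral, Finsupp.sum, Finset.sum_congr rfl fun R hR => by rw [h1 R hR]]
  simp only [Finset.smul_sum]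
  rw [Finset.sum_comm]
  exact Finset.sum_congr rfl fun i _ => Finset.sum_comm

/-- A step function is constant on the cells of an adapted grid. -/
theorem stepFun_eq (h : IsGridFor t n g) (p : ℝ × ℝ) :
    stepFun g p = ∑' k : Fin n × Fin n,
      (Set.Ioc (t k.1 : ℝ) (t (k.1 + 1)) ×ˢ Set.Ioc (t k.2 : ℝ) (t (k.2 + 1))).indicator
        (fun _ => stepFun g (t (k.1 + 1), t (k.2 + 1))) p := by
  have h1 : ∀ R ∈ g.support, R.toSet.indicator (fun _ => (1 : ℝ)) p =
      ∑ i : Fin n, ∑ j : Fin n, R.toSet.indicator (fun _ => (1 : ℝ)) (↑(t (i + 1)), ↑(t (j + 1))) *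
        (iocFun (t i) (t (i + 1)) p.1 * iocFun (t j) (t (j + 1)) p.2) := by
    intro R hR
    have hc := h.corners R hR
    rw [R.indicator_toSet,
      ← h.sum_iocFun_mul (hc R.s (by simp)) (hc R.t (by simp)) R.le_st,
      ← h.sum_iocFun_mul (hc R.u (by simp)) (hc R.v (by simp)) R.le_uv, Finset.sum_mul_sum]
    refine Finset.sum_congr rfl fun i _ => Finset.sum_congr rfl fun j _ => ?_
    rw [R.indicator_toSet]
    ring
  have h2 : ∀ k : Fin n × Fin n,
      (Set.Ioc (t k.1 : ℝ) (t (k.1 + 1)) ×ˢ Set.Ioc (t k.2 : ℝ) (t (k.2 + 1))).indicator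
        (fun _ => stepFun g (t (k.1 + 1), t (k.2 + 1))) p =
      ∑ R ∈ g.support, g R * (R.toSet.indicator (fun _ => (1 : ℝ))
        (↑(t (k.1 + 1)), ↑(t (k.2 + 1))) *
        (iocFun (t k.1) (t (k.1 + 1)) p.1 * iocFun (t k.2) (t (k.2 + 1)) p.2)) := by
    intro k
    have h3 : (Set.Ioc (t k.1 : ℝ) (t (k.1 + 1)) ×ˢ Set.Ioc (t k.2 : ℝ) (t (k.2 + 1))).indicator
        (fun _ => stepFun g (t (k.1 + 1), t (k.2 + 1))) p =
        stepFun g (t (k.1 + 1), t (k.2 + 1)) *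
          (iocFun (t k.1) (t (k.1 + 1)) p.1 * iocFun (t k.2) (t (k.2 + 1)) p.2) := by
      simp only [iocFun, Set.indicator_apply, Set.mem_prod]
      split_ifs <;> simp_all
    rw [h3, stepFun, Finsupp.sum, Finset.sum_mul]
    exact Finset.sum_congr rfl fun R _ => by ring
  rw [tsum_fintype, Finset.sum_congr rfl fun k _ => h2 k, Finset.sum_comm, stepFun, Finsupp.sum]
  refine Finset.sum_congr rfl fun R hR => ?_
  rw [h1 R hR, ← Finset.mul_sum, Fintype.sum_prod_type]

theorem pairwise_disjoint_cells (ht : Monotone t) (n : ℕ) :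
    Pairwise fun k l : Fin n × Fin n => Disjoint
      (Set.Ioc (t k.1 : ℝ) (t (k.1 + 1)) ×ˢ Set.Ioc (t k.2 : ℝ) (t (k.2 + 1)))
      (Set.Ioc (t l.1 : ℝ) (t (l.1 + 1)) ×ˢ Set.Ioc (t l.2 : ℝ) (t (l.2 + 1))) := by
  have h1 : Monotone fun k => (t k : ℝ) := fun a b hab => ht hab
  have h2 := h1.pairwise_disjoint_on_Ioc_succ
  intro k l hkl
  rw [Set.disjoint_prod]
  by_cases h : k.1 = l.1
  · exact Or.inr (h2 fun h3 => hkl (Prod.ext h (Fin.ext h3)))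
  · exact Or.inl (h2 fun h3 => h (Fin.ext h3))

theorem eLpNorm_stepFun_sq (h : IsGridFor t n g) :
    eLpNorm (stepFun g) 2 quadrant ^ 2 = ENNReal.ofReal (∑ i : Fin n, ∑ j : Fin n,
      ‖gridMatrix t n g i j‖ ^ 2 * (((t (i + 1) : ℝ) - t i) * ((t (j + 1) : ℝ) - t j))) := by
  have hpos : ∀ i : ℕ, 0 ≤ (t (i + 1) : ℝ) - t i := fun i => sub_nonneg.mpr (h.mono i.le_succ)
  have hnn : ∀ i j : Fin n, 0 ≤ ‖gridMatrix t n g i j‖ ^ 2 *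
      (((t (i + 1) : ℝ) - t i) * ((t (j + 1) : ℝ) - t j)) := fun i j =>
    mul_nonneg (sq_nonneg _) (mul_nonneg (hpos i) (hpos j))
  rw [eLpNorm_two_sq,
    lintegral_congr fun p => congrArg (fun y : ℝ => ‖y‖ₑ ^ 2) (h.stepFun_eq p)]
  rw [lintegral_enorm_sq_tsum_indicator _ (fun k => measurableSet_Ioc.prod measurableSet_Ioc)
    (pairwise_disjoint_cells h.mono n), tsum_fintype, Fintype.sum_prod_type,
    ENNReal.ofReal_sum_of_nonneg fun i _ => Finset.sum_nonneg fun j _ => hnn i j]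
  refine Finset.sum_congr rfl fun i _ => ?_
  rw [ENNReal.ofReal_sum_of_nonneg fun j _ => hnn i j]
  refine Finset.sum_congr rfl fun j _ => ?_
  rw [quadrant_rect, ENNReal.ofReal_mul (sq_nonneg ‖gridMatrix t n g i j‖),
    ENNReal.ofReal_mul (hpos i), ENNReal.ofReal_pow (norm_nonneg _), ofReal_norm, gridMatrix,
    Matrix.of_apply]
  congr 2
  rw [← ofReal_norm, ← ofReal_norm, Complex.norm_real]

end IsGridFor

/-- Haagerup-type inequality for double Wigner integrals of step functions. -/
theorem IsFreeBrownianMotion.norm_stepIntegral_le {A : Type u} [CStarAlgebra A]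
    {φ : A →ₗ[ℂ] ℂ} {S : ℝ≥0 → A} (hS : IsFreeBrownianMotion φ S)
    (hφ : IsFaithfulTracialState φ) {g : OffDiagRect →₀ ℝ} {ε : ℝ} (hε : 0 ≤ ε)
    (hg : eLpNorm (stepFun g) 2 quadrant ≤ ENNReal.ofReal ε) :
    ‖stepIntegral S g‖ ≤ 8 * ε := by
  obtain ⟨t, n, h⟩ := exists_isGridFor g
  have hpos : ∀ i : ℕ, 0 ≤ (t (i + 1) : ℝ) - t i := fun i => sub_nonneg.mpr (h.mono i.le_succ)
  have h1 := (hS.isFreeSemicircularFamily hφ.map_one h.mono).norm_wickForm_le hφ hpos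
    (gridMatrix t n g)
  rw [← h.stepIntegral_eq S] at h1
  refine h1.trans (mul_le_mul_of_nonneg_left ?_ (by norm_num))
  refine Real.sqrt_le_iff.mpr ⟨hε, ?_⟩
  have h2 := pow_le_pow_left₀ zero_le hg 2
  rw [h.eLpNorm_stepFun_sq, ← ENNReal.ofReal_pow hε] at h2
  exact (ENNReal.ofReal_le_ofReal_iff (sq_nonneg ε)).mp h2

/-! ### Elements of the second chaos are norm limits of step integrals -/

theorem stepFun_add (g g' : OffDiagRect →₀ ℝ) (p : ℝ × ℝ) :
    stepFun (g + g') p = stepFun g p + stepFun g' p :=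
  Finsupp.sum_add_index' (fun _ => zero_mul _) fun _ _ _ => add_mul _ _ _

theorem stepFun_smul (a : ℝ) (g : OffDiagRect →₀ ℝ) (p : ℝ × ℝ) :
    stepFun (a • g) p = a * stepFun g p := by
  rw [stepFun, Finsupp.sum_smul_index fun _ => zero_mul _, stepFun, Finsupp.mul_sum]
  simp only [mul_assoc]

theorem stepFun_sub (g g' : OffDiagRect →₀ ℝ) (p : ℝ × ℝ) :
    stepFun (g - g') p = stepFun g p - stepFun g' p := by
  rw [sub_eq_add_neg, ← neg_one_smul ℝ g', stepFun_add, stepFun_smul]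
  ring

section

variable {A : Type*} [CStarAlgebra A] (S : ℝ≥0 → A)

theorem stepIntegral_add (g g' : OffDiagRect →₀ ℝ) :
    stepIntegral S (g + g') = stepIntegral S g + stepIntegral S g' :=
  Finsupp.sum_add_index' (fun _ => by simp) fun _ _ _ => by rw [Complex.ofReal_add, add_smul]

theorem stepIntegral_smul (a : ℝ) (g : OffDiagRect →₀ ℝ) :
    stepIntegral S (a • g) = (a : ℂ) • stepIntegral S g := by
  rw [stepIntegral, Finsupp.sum_smul_index fun _ => by simp, stepIntegral, Finsupp.smul_sum]
  simp only [Complex.ofReal_mul, mul_smul]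

theorem stepIntegral_sub (g g' : OffDiagRect →₀ ℝ) :
    stepIntegral S (g - g') = stepIntegral S g - stepIntegral S g' := by
  rw [sub_eq_add_neg, ← neg_one_smul ℝ g', stepIntegral_add, stepIntegral_smul]
  simp [sub_eq_add_neg]

end

theorem measurable_stepFun (g : OffDiagRect →₀ ℝ) : Measurable (stepFun g) := by
  refine Finset.measurable_fun_sum _ fun R _ => ?_
  exact measurable_const.mul
    (measurable_const.indicator (measurableSet_Ioc.prod measurableSet_Ioc))

/-- The reflection of a rectangle in the diagonal. -/
def OffDiagRect.swap (R : OffDiagRect) : OffDiagRect :=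
  ⟨R.u, R.v, R.s, R.t, R.le_uv, R.le_st, R.disjoint.symm⟩

theorem stepFun_mapDomain_swap (g : OffDiagRect →₀ ℝ) (p : ℝ × ℝ) :
    stepFun (g.mapDomain OffDiagRect.swap) p = stepFun g p.swap := by
  rw [stepFun, Finsupp.sum_mapDomain_index (fun _ => zero_mul _) fun _ _ _ => add_mul _ _ _,
    stepFun]
  refine Finsupp.sum_congr fun R _ => ?_
  rw [OffDiagRect.indicator_toSet, OffDiagRect.indicator_toSet]
  simp only [OffDiagRect.swap, Prod.fst_swap, Prod.snd_swap, mul_comm]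

theorem measurePreserving_swap_quadrant : MeasurePreserving Prod.swap quadrant quadrant := by
  have h1 : MeasurePreserving (Prod.swap : ℝ × ℝ → ℝ × ℝ) volume volume :=
    Measure.measurePreserving_swap
  have h2 := h1.restrict_preimage (s := Set.Ici (0 : ℝ) ×ˢ Set.Ici (0 : ℝ))
    (measurableSet_Ici.prod measurableSet_Ici)
  rwa [Set.preimage_swap_prod] at h2

/-- Close step functions have close double Wigner integrals, in operator norm. -/
theorem IsFreeBrownianMotion.norm_stepIntegral_sub_le {A : Type u} [CStarAlgebra A]
    {φ : A →ₗ[ℂ] ℂ} {S : ℝ≥0 → A} (hS : IsFreeBrownianMotion φ S)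
    (hφ : IsFaithfulTracialState φ) {f : ℝ × ℝ → ℝ} (hf : AEStronglyMeasurable f quadrant)
    {g g' : OffDiagRect →₀ ℝ} {ε ε' : ℝ} (hε : 0 ≤ ε) (hε' : 0 ≤ ε')
    (hg : eLpNorm (fun p => f p - stepFun g p) 2 quadrant ≤ ENNReal.ofReal ε)
    (hg' : eLpNorm (fun p => f p - stepFun g' p) 2 quadrant ≤ ENNReal.ofReal ε') :
    ‖stepIntegral S g - stepIntegral S g'‖ ≤ 8 * (ε + ε') := by
  rw [← stepIntegral_sub]
  refine hS.norm_stepIntegral_le hφ (add_nonneg hε hε') ?_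
  have e : stepFun (g - g') = (fun p => f p - stepFun g' p) - fun p => f p - stepFun g p := by
    ext p
    rw [stepFun_sub, Pi.sub_apply]
    ring
  rw [e, add_comm, ENNReal.ofReal_add hε' hε]
  exact (eLpNorm_sub_le (hf.sub (measurable_stepFun g').aestronglyMeasurable)
    (hf.sub (measurable_stepFun g).aestronglyMeasurable) (by norm_num)).trans (add_le_add hg' hg)

theorem IsTracialState.sq_l2Norm {A : Type u} [CStarAlgebra A] {φ : A →ₗ[ℂ] ℂ}
    (h : IsTracialState φ) (x : A) : ((l2Norm φ x ^ 2 : ℝ) : ℂ) = φ (star x * x) := by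
  obtain ⟨r, hr, e⟩ := h.nonneg x
  rw [l2Norm, e, Complex.ofReal_re, Real.sq_sqrt hr]

theorem IsTracialState.exists_l2Norm_le {A : Type u} [CStarAlgebra A] {φ : A →ₗ[ℂ] ℂ}
    (h : IsTracialState φ) : ∃ C : ℝ, 0 < C ∧ ∀ x, l2Norm φ x ≤ C * ‖x‖ := by
  obtain ⟨C, hC, hb⟩ := h.exists_norm_le
  refine ⟨√C, Real.sqrt_pos.mpr hC, fun x => ?_⟩
  refine Real.sqrt_le_iff.mpr ⟨by positivity, ?_⟩
  refine (Complex.re_le_norm _).trans ((hb _).trans (le_of_eq ?_))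
  rw [CStarRing.norm_star_mul_self, mul_pow, Real.sq_sqrt hC.le, sq]

theorem IsTracialState.sq_l2Norm_add_le {A : Type u} [CStarAlgebra A] {φ : A →ₗ[ℂ] ℂ}
    (h : IsTracialState φ) (x y : A) :
    l2Norm φ (x + y) ^ 2 ≤ 2 * l2Norm φ x ^ 2 + 2 * l2Norm φ y ^ 2 := by
  have e : ((l2Norm φ (x + y) ^ 2 + l2Norm φ (x - y) ^ 2 : ℝ) : ℂ) =
      ((2 * l2Norm φ x ^ 2 + 2 * l2Norm φ y ^ 2 : ℝ) : ℂ) := by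
    rw [Complex.ofReal_add, Complex.ofReal_add, Complex.ofReal_mul, Complex.ofReal_mul,
      h.sq_l2Norm, h.sq_l2Norm, h.sq_l2Norm, h.sq_l2Norm]
    simp only [star_add, star_sub, add_mul, mul_add, sub_mul, mul_sub, map_add, map_sub]
    push_cast
    ring
  have e' := Complex.ofReal_injective e
  have := sq_nonneg (l2Norm φ (x - y))
  linarith

/-- Elements of the second chaos are norm limits of integrals of symmetric step functions. -/
theorem IsFreeBrownianMotion.exists_stepIntegral_near {A : Type u} [CStarAlgebra A]
    {φ : A →ₗ[ℂ] ℂ} {S : ℝ≥0 → A} (hS : IsFreeBrownianMotion φ S)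
    (hφ : IsFaithfulTracialState φ) {F : A} (hF : F ∈ secondWignerChaos φ S) {ε : ℝ}
    (hε : 0 < ε) :
    ∃ g : OffDiagRect →₀ ℝ, (∀ p, stepFun g p.swap = stepFun g p) ∧
      ‖F - stepIntegral S g‖ < ε := by
  obtain ⟨f, hfs, hf, happ⟩ := hF
  have hfm := hf.aestronglyMeasurable
  choose g hg1 hg2 using fun m : ℕ => happ (1 / ((m : ℝ) + 1)) Nat.one_div_pos_of_nat
  have hpos : ∀ m : ℕ, 0 ≤ 1 / ((m : ℝ) + 1) := fun m => Nat.one_div_pos_of_nat.le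
  have hlim0 : Tendsto (fun m : ℕ => 1 / ((m : ℝ) + 1)) atTop (𝓝 0) :=
    tendsto_one_div_add_atTop_nhds_zero_nat
  have hcauchy : CauchySeq fun m => stepIntegral S (g m) := by
    refine cauchySeq_of_le_tendsto_0 (fun N : ℕ => 8 * (1 / ((N : ℝ) + 1) + 1 / ((N : ℝ) + 1)))
      (fun m k N hm hk => ?_) (by simpa using (hlim0.add hlim0).const_mul 8)
    rw [dist_eq_norm]
    refine (hS.norm_stepIntegral_sub_le hφ hfm (hpos m) (hpos k) (hg1 m).le (hg1 k).le).trans ?_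
    have := Nat.one_div_le_one_div (α := ℝ) hm
    have := Nat.one_div_le_one_div (α := ℝ) hk
    linarith
  obtain ⟨F', hF'⟩ := cauchySeq_tendsto_of_complete hcauchy
  -- The norm limit agrees with the given `L²` limit because the state is faithful.
  have hFF' : F = F' := by
    obtain ⟨C, hC, hb⟩ := hφ.isTracialState.exists_l2Norm_le
    have hlim : Tendsto (fun m : ℕ => 2 * (1 / ((m : ℝ) + 1)) ^ 2 +
        2 * (C * ‖stepIntegral S (g m) - F'‖) ^ 2) atTop (𝓝 0) := by
      have h1 := tendsto_iff_norm_sub_tendsto_zero.mp hF'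
      simpa using ((hlim0.pow 2).const_mul 2).add (((h1.const_mul C).pow 2).const_mul 2)
    have hle : ∀ m : ℕ, l2Norm φ (F - F') ^ 2 ≤ 2 * (1 / ((m : ℝ) + 1)) ^ 2 +
        2 * (C * ‖stepIntegral S (g m) - F'‖) ^ 2 := by
      intro m
      have h1 := hφ.isTracialState.sq_l2Norm_add_le (F - stepIntegral S (g m))
        (stepIntegral S (g m) - F')
      rw [sub_add_sub_cancel] at h1
      have h2 : l2Norm φ (F - stepIntegral S (g m)) ^ 2 ≤ (1 / ((m : ℝ) + 1)) ^ 2 :=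
        pow_le_pow_left₀ (Real.sqrt_nonneg _) (hg2 m).le 2
      have h3 : l2Norm φ (stepIntegral S (g m) - F') ^ 2 ≤
          (C * ‖stepIntegral S (g m) - F'‖) ^ 2 :=
        pow_le_pow_left₀ (Real.sqrt_nonneg _) (hb (stepIntegral S (g m) - F')) 2
      linarith
    have h0 : l2Norm φ (F - F') ^ 2 = 0 :=
      le_antisymm (ge_of_tendsto' hlim hle) (sq_nonneg _)
    refine sub_eq_zero.mp (hφ.faithful _ ?_)
    rw [← hφ.isTracialState.sq_l2Norm, h0, Complex.ofReal_zero]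
  have hnear : Tendsto (fun m : ℕ => ‖stepIntegral S (g m) - F'‖ + 8 * (1 / ((m : ℝ) + 1)))
      atTop (𝓝 0) := by
    simpa using (tendsto_iff_norm_sub_tendsto_zero.mp hF').add (hlim0.const_mul 8)
  obtain ⟨m, hm⟩ := (hnear.eventually (gt_mem_nhds hε)).exists
  -- The symmetrization of `g m` is as close to the symmetric function `f` as `g m` itself.
  set g' := (g m).mapDomain OffDiagRect.swap with hg'
  have hswap : eLpNorm (fun p => f p - stepFun g' p) 2 quadrant ≤
      ENNReal.ofReal (1 / ((m : ℝ) + 1)) := by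
    have h1 := eLpNorm_comp_measurePreserving (p := 2)
      (hfm.sub (measurable_stepFun (g m)).aestronglyMeasurable) measurePreserving_swap_quadrant
    have h2 : eLpNorm (fun p => f p - stepFun g' p) 2 quadrant =
        eLpNorm ((fun p => f p - stepFun (g m) p) ∘ Prod.swap) 2 quadrant := by
      refine eLpNorm_congr_ae ?_
      filter_upwards [hfs.2] with p hp
      rw [Function.comp_apply, hg', stepFun_mapDomain_swap, hp]
    rw [h2]
    exact h1.le.trans (hg1 m).le
  refine ⟨(2⁻¹ : ℝ) • (g m + g'), fun p => ?_, ?_⟩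
  · simp only [stepFun_smul, stepFun_add, hg', stepFun_mapDomain_swap, Prod.swap_swap]
    ring
  · have h1 := hS.norm_stepIntegral_sub_le hφ hfm (hpos m) (hpos m) (hg1 m).le hswap
    have e : F - stepIntegral S ((2⁻¹ : ℝ) • (g m + g')) =
        -(stepIntegral S (g m) - F') +
          (2⁻¹ : ℂ) • (stepIntegral S (g m) - stepIntegral S g') := by
      rw [hFF', stepIntegral_smul, stepIntegral_add]
      push_cast
      module
    rw [e]
    refine (norm_add_le _ _).trans_lt ?_
    rw [norm_neg, norm_smul]
    have h2 : ‖(2⁻¹ : ℂ)‖ = 2⁻¹ := by simp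
    rw [h2]
    linarith

theorem IsDoubleWignerIntegral.of_norm {A : Type u} [CStarAlgebra A]
    {φ : A →ₗ[ℂ] ℂ} (hφ : IsTracialState φ) {S : ℝ≥0 → A} {f : ℝ × ℝ → ℝ} {F : A}
    (hf : MemLp f 2 quadrant)
    (h : ∀ ε : ℝ, 0 < ε → ∃ g : OffDiagRect →₀ ℝ,
      eLpNorm (fun p => f p - stepFun g p) 2 quadrant < ENNReal.ofReal ε ∧
      ‖F - stepIntegral S g‖ < ε) :
    IsDoubleWignerIntegral φ S f F := by
  obtain ⟨C, hC, hb⟩ := hφ.exists_l2Norm_le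
  refine ⟨hf, fun ε hε => ?_⟩
  obtain ⟨g, h1, h2⟩ := h (min ε (ε / C)) (lt_min hε (by positivity))
  refine ⟨g, h1.trans_le (ENNReal.ofReal_le_ofReal (min_le_left _ _)), (hb _).trans_lt ?_⟩
  rw [mul_comm, ← lt_div_iff₀ hC]
  exact h2.trans_le (min_le_right _ _)

/-! ### Compactness for power sums -/

/-- A finite family, sorted by decreasing absolute value and extended by zero. -/
theorem exists_sorted (n : ℕ) (x : Fin n → ℝ) :
    ∃ y : ℕ → ℝ, (Antitone fun k => |y k|) ∧ (∀ k, n ≤ k → y k = 0) ∧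
      ∀ p, ∑ k ∈ Finset.range n, y k ^ p = ∑ i, x i ^ p := by
  set σ := Tuple.sort fun i => -|x i| with hσ
  have hmono : Monotone ((fun i => -|x i|) ∘ σ) := Tuple.monotone_sort _
  refine ⟨fun k => if h : k < n then x (σ ⟨k, h⟩) else 0, ?_, ?_, ?_⟩
  · intro a b hab
    simp only
    by_cases hb : b < n
    · have ha : a < n := hab.trans_lt hb
      rw [dif_pos ha, dif_pos hb]
      have := hmono (Fin.mk_le_mk.mpr hab : (⟨a, ha⟩ : Fin n) ≤ ⟨b, hb⟩)
      simpa using this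
    · rw [dif_neg hb, abs_zero]
      exact abs_nonneg _
  · intro k hk
    simp only
    rw [dif_neg (by omega)]
  · intro p
    rw [← Fin.sum_univ_eq_sum_range (fun k => (if h : k < n then x (σ ⟨k, h⟩) else 0) ^ p) n]
    simp only [Fin.is_lt, dif_pos, Fin.eta]
    exact Equiv.sum_comp σ fun i => x i ^ p

theorem sum_range_sq_le {n : ℕ} {y : ℕ → ℝ} (h0 : ∀ k, n ≤ k → y k = 0) (K : ℕ) :
    ∑ k ∈ Finset.range K, y k ^ 2 ≤ ∑ k ∈ Finset.range n, y k ^ 2 := by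
  rw [← Finset.sum_filter_add_sum_filter_not (Finset.range K) (fun i => i < n),
    Finset.sum_eq_zero (s := (Finset.range K).filter fun i => ¬ i < n), add_zero]
  · refine Finset.sum_le_sum_of_subset_of_nonneg ?_ fun i _ _ => sq_nonneg _
    intro i hi
    exact Finset.mem_range.mpr (Finset.mem_filter.mp hi).2
  · intro i hi
    rw [h0 i (not_lt.mp (Finset.mem_filter.mp hi).2)]
    ring

/-- Since `(k + 1) * y k ^ 2` is at most the sum of the first `k + 1` squares. -/
theorem abs_le_of_antitone {n : ℕ} {y : ℕ → ℝ} (hy : Antitone fun k => |y k|)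
    (h0 : ∀ k, n ≤ k → y k = 0) {M : ℝ} (hM : ∑ k ∈ Finset.range n, y k ^ 2 ≤ M) (k : ℕ) :
    |y k| ≤ √M * (√((k : ℝ) + 1))⁻¹ := by
  have hM0 : 0 ≤ M := (Finset.sum_nonneg fun k _ => sq_nonneg (y k)).trans hM
  have h1 : ∑ i ∈ Finset.range (k + 1), y i ^ 2 ≤ M := (sum_range_sq_le h0 _).trans hM
  have h2 : ((k : ℝ) + 1) * y k ^ 2 ≤ M := by
    refine le_trans ?_ h1
    have h3 := Finset.card_nsmul_le_sum (Finset.range (k + 1)) (fun i => y i ^ 2) (y k ^ 2)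
      fun i hi => by
        rw [← sq_abs, ← sq_abs (y i)]
        exact pow_le_pow_left₀ (abs_nonneg _) (hy (by simpa [Nat.lt_succ_iff] using hi)) 2
    simpa using h3
  have hk : 0 < (k : ℝ) + 1 := by positivity
  rw [← div_eq_mul_inv, ← Real.sqrt_div hM0]
  exact Real.abs_le_sqrt ((le_div_iff₀ hk).mpr (by linarith))

theorem summable_inv_sqrt_cube : Summable fun k : ℕ => ((√((k : ℝ) + 1))⁻¹) ^ 3 := by
  have h1 : Summable fun k : ℕ => (((k : ℝ)) ^ (3 / 2 : ℝ))⁻¹ :=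
    Real.summable_nat_rpow_inv.mpr (by norm_num)
  have h2 := (summable_nat_add_iff 1).mpr h1
  refine h2.congr fun k => ?_
  have hk : 0 ≤ (k : ℝ) + 1 := by positivity
  rw [inv_pow, Real.sqrt_eq_rpow, ← Real.rpow_natCast, ← Real.rpow_mul hk]
  push_cast
  norm_num

/-- If the power sums of order at least two of finite real families converge, then the limits of
order at least three are the power sums of a square-summable sequence; in the limit of order two
an additional nonnegative mass may appear.  The sequence is a limit of the families sorted by
decreasing absolute value; its `k`-th term being `O(k ^ (-1/2))`, uniformly, there is no loss of
mass from order three on. -/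
theorem exists_limit_power_sums {n : ℕ → ℕ} (x : (a : ℕ) → Fin (n a) → ℝ) {κ : ℕ → ℝ}
    (h : ∀ r, Tendsto (fun a => ∑ i, x a i ^ (r + 2)) atTop (𝓝 (κ r))) :
    ∃ (z : ℕ → ℝ) (s : ℝ), Summable (fun k => z k ^ 2) ∧ κ 0 = s ^ 2 + ∑' k, z k ^ 2 ∧
      ∀ r, κ (r + 1) = ∑' k, z k ^ (r + 3) := by
  choose y hanti h0 hsum using fun a => exists_sorted (n a) (x a)
  obtain ⟨M, hM⟩ := (h 0).bddAbove_range
  have hM' : ∀ a, ∑ k ∈ Finset.range (n a), y a k ^ 2 ≤ M := fun a => by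
    rw [hsum]
    exact hM ⟨a, rfl⟩
  have hbound := fun a => abs_le_of_antitone (hanti a) (h0 a) (hM' a)
  have hU : ((hyperfilter ℕ : Ultrafilter ℕ) : Filter ℕ) ≤ atTop := Nat.hyperfilter_le_atTop
  have hz : ∀ k, ∃ z, Tendsto (fun a => y a k) (hyperfilter ℕ) (𝓝 z) := by
    intro k
    obtain ⟨z, -, hz⟩ := (isCompact_closedBall (0 : ℝ) (√M * (√((k : ℝ) + 1))⁻¹)
      ).ultrafilter_le_nhds ((hyperfilter ℕ).map fun a => y a k) (by
        rw [Ultrafilter.coe_map, le_principal_iff, mem_map]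
        refine Filter.univ_mem' fun a => ?_
        simpa using hbound a k)
    exact ⟨z, hz⟩
  choose z hz using hz
  have hpart : ∀ K, ∑ k ∈ Finset.range K, z k ^ 2 ≤ κ 0 := by
    intro K
    refine le_of_tendsto_of_tendsto
      (tendsto_finsetSum (Finset.range K) fun k _ => (hz k).pow 2) ((h 0).mono_left hU)
      (Eventually.of_forall fun a => ?_)
    simp only [zero_add, ← hsum]
    exact sum_range_sq_le (h0 a) K
  have hsummable : Summable fun k => z k ^ 2 :=
    summable_of_sum_range_le (fun k => sq_nonneg _) hpart
  have hle : ∑' k, z k ^ 2 ≤ κ 0 := Real.tsum_le_of_sum_range_le (fun k => sq_nonneg _) hpart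
  refine ⟨z, √(κ 0 - ∑' k, z k ^ 2), hsummable, ?_, fun r => ?_⟩
  · rw [Real.sq_sqrt (sub_nonneg.mpr hle)]
    ring
  · refine tendsto_nhds_unique ((h (r + 1)).mono_left hU) ?_
    have e : ∀ a, ∑ i, x a i ^ (r + 1 + 2) = ∑' k, y a k ^ (r + 3) := by
      intro a
      rw [← hsum]
      refine (tsum_eq_sum fun k hk => ?_).symm
      rw [h0 a k (by simpa using hk)]
      simp
    simp only [e]
    refine tendsto_tsum_of_dominated_convergence
      (bound := fun k : ℕ => √M ^ (r + 3) * ((√((k : ℝ) + 1))⁻¹) ^ 3)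
      (summable_inv_sqrt_cube.mul_left _) (fun k => (hz k).pow _)
      (Eventually.of_forall fun a k => ?_)
    rw [norm_pow, Real.norm_eq_abs]
    refine (pow_le_pow_left₀ (abs_nonneg _) (hbound a k) (r + 3)).trans ?_
    rw [mul_pow]
    refine mul_le_mul_of_nonneg_left (pow_le_pow_of_le_one (by positivity) ?_ (by omega))
      (by positivity)
    refine inv_le_one_of_one_le₀ (Real.one_le_sqrt.mpr ?_)
    linarith [(Nat.cast_nonneg k : (0 : ℝ) ≤ k)]

/-! ### Functions supported on diagonal blocks -/

/-- The function with value `c k` on the diagonal block `(t k, t (k + 1)]²`. -/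
noncomputable def diagFun (t : ℕ → ℝ≥0) (c : ℕ → ℝ) (p : ℝ × ℝ) : ℝ :=
  ∑' k, (Set.Ioc (t k : ℝ) (t (k + 1)) ×ˢ Set.Ioc (t k : ℝ) (t (k + 1))).indicator
    (fun _ => c k) p

theorem pairwise_disjoint_diag {t : ℕ → ℝ≥0} (ht : Monotone t) : Pairwise fun k l => Disjoint
    (Set.Ioc (t k : ℝ) (t (k + 1)) ×ˢ Set.Ioc (t k : ℝ) (t (k + 1)))
    (Set.Ioc (t l : ℝ) (t (l + 1)) ×ˢ Set.Ioc (t l : ℝ) (t (l + 1))) := by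
  have h1 : Monotone fun k => (t k : ℝ) := fun a b hab => ht hab
  intro k l hkl
  exact Set.disjoint_prod.mpr (Or.inl (h1.pairwise_disjoint_on_Ioc_succ hkl))

theorem hasSum_diagFun {t : ℕ → ℝ≥0} (ht : Monotone t) (c : ℕ → ℝ) (p : ℝ × ℝ) :
    HasSum (fun k => (Set.Ioc (t k : ℝ) (t (k + 1)) ×ˢ Set.Ioc (t k : ℝ) (t (k + 1))).indicator
      (fun _ => c k) p) (diagFun t c p) := by
  refine Summable.hasSum ?_
  by_cases hp : ∃ k, p ∈ Set.Ioc (t k : ℝ) (t (k + 1)) ×ˢ Set.Ioc (t k : ℝ) (t (k + 1))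
  · obtain ⟨k, hk⟩ := hp
    exact (hasSum_single k fun l hl => Set.indicator_of_notMem (fun hpl =>
      Set.disjoint_left.mp (pairwise_disjoint_diag ht hl) hpl hk) _).summable
  · push Not at hp
    simp only [Set.indicator_of_notMem (hp _)]
    exact summable_zero

theorem diagFun_add {t : ℕ → ℝ≥0} (ht : Monotone t) (c c' : ℕ → ℝ) (p : ℝ × ℝ) :
    diagFun t (fun k => c k + c' k) p = diagFun t c p + diagFun t c' p := by
  refine (hasSum_diagFun ht _ p).unique ?_
  refine ((hasSum_diagFun ht c p).add (hasSum_diagFun ht c' p)).congr_fun fun k => ?_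
  exact (congrFun (Set.indicator_add _ _ _) p)

theorem diagFun_eq_sum (t : ℕ → ℝ≥0) {c : ℕ → ℝ} {n : ℕ} (hc : ∀ k, n ≤ k → c k = 0)
    (p : ℝ × ℝ) : diagFun t c p =
      ∑ k ∈ Finset.range n,
        c k * (iocFun (t k) (t (k + 1)) p.1 * iocFun (t k) (t (k + 1)) p.2) := by
  rw [diagFun, tsum_eq_sum (s := Finset.range n)]
  · refine Finset.sum_congr rfl fun k _ => ?_
    simp only [iocFun, Set.indicator_apply, Set.mem_prod]
    split_ifs <;> simp_all
  · intro k hk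
    rw [hc k (by simpa using hk), Set.indicator_zero]

theorem diagFun_swap (t : ℕ → ℝ≥0) (c : ℕ → ℝ) (p : ℝ × ℝ) :
    diagFun t c p.swap = diagFun t c p := by
  refine tsum_congr fun k => ?_
  simp only [Set.indicator_apply, Set.mem_prod, Prod.fst_swap, Prod.snd_swap, and_comm]

theorem measurable_diagFun {t : ℕ → ℝ≥0} (ht : Monotone t) (c : ℕ → ℝ) :
    Measurable (diagFun t c) := by
  refine measurable_of_tendsto_metrizable (f := fun (n : ℕ) p => ∑ k ∈ Finset.range n,
    (Set.Ioc (t k : ℝ) (t (k + 1)) ×ˢ Set.Ioc (t k : ℝ) (t (k + 1))).indicator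
      (fun _ => c k) p) (fun n => ?_) ?_
  · exact Finset.measurable_fun_sum _ fun k _ =>
      measurable_const.indicator (measurableSet_Ioc.prod measurableSet_Ioc)
  · exact tendsto_pi_nhds.mpr fun p => (hasSum_diagFun ht c p).tendsto_sum_nat

theorem eLpNorm_diagFun_sq {t : ℕ → ℝ≥0} (ht : Monotone t) {c : ℕ → ℝ}
    (hc : Summable fun k => c k ^ 2 * ((t (k + 1) : ℝ) - t k) ^ 2) :
    eLpNorm (diagFun t c) 2 quadrant ^ 2 =
      ENNReal.ofReal (∑' k, c k ^ 2 * ((t (k + 1) : ℝ) - t k) ^ 2) := by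
  have hpos : ∀ i : ℕ, 0 ≤ (t (i + 1) : ℝ) - t i := fun i => sub_nonneg.mpr (ht i.le_succ)
  rw [eLpNorm_two_sq]
  simp only [diagFun]
  rw [lintegral_enorm_sq_tsum_indicator _ (fun k => measurableSet_Ioc.prod measurableSet_Ioc)
    (pairwise_disjoint_diag ht), ENNReal.ofReal_tsum_of_nonneg
      (fun k => mul_nonneg (sq_nonneg _) (sq_nonneg _)) hc]
  refine tsum_congr fun k => ?_
  rw [quadrant_rect, ENNReal.ofReal_mul (sq_nonneg (c k)), sq ((t (k + 1) : ℝ) - t k),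
    ENNReal.ofReal_mul (hpos k), ← sq_abs (c k), ENNReal.ofReal_pow (abs_nonneg _),
    ← Real.norm_eq_abs, ofReal_norm]

theorem eLpNorm_diagFun_le {t : ℕ → ℝ≥0} (ht : Monotone t) {c : ℕ → ℝ}
    (hc : Summable fun k => c k ^ 2 * ((t (k + 1) : ℝ) - t k) ^ 2) {ε : ℝ} (hε : 0 ≤ ε)
    (h : ∑' k, c k ^ 2 * ((t (k + 1) : ℝ) - t k) ^ 2 ≤ ε ^ 2) :
    eLpNorm (diagFun t c) 2 quadrant ≤ ENNReal.ofReal ε := by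
  refine (ENNReal.pow_le_pow_left_iff two_ne_zero).mp ?_
  rw [eLpNorm_diagFun_sq ht hc, ← ENNReal.ofReal_pow hε]
  exact ENNReal.ofReal_le_ofReal h

/-! ### Wick-ordered diagonal forms -/

theorem wickForm_diagonal {A : Type*} [Ring A] [Algebra ℂ A] (X : ℕ → A) (w : ℕ → ℂ) (n : ℕ)
    (a : ℕ → ℂ) (d : ℂ) :
    wickForm X w (Matrix.diagonal fun k : Fin n => a k) d =
      d • X n + ∑ k ∈ Finset.range n, a k • (X k * X k - w k • (1 : A)) := by
  rw [wickForm, ← Fin.sum_univ_eq_sum_range (fun k => a k • (X k * X k - w k • (1 : A))) n]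
  congr 1
  refine Finset.sum_congr rfl fun i _ => ?_
  rw [Finset.sum_eq_single i]
  · simp
  · intro j _ hj
    rw [Matrix.diagonal_apply_ne _ hj.symm, zero_smul]
  · simp

/-- Haagerup-type inequality for diagonal forms. -/
theorem IsFreeSemicircularFamily.norm_sum_sq_le {A : Type u} [CStarAlgebra A] {φ : A →ₗ[ℂ] ℂ}
    {X : ℕ → A} {w : ℕ → ℝ} (h : IsFreeSemicircularFamily φ X w)
    (hφ : IsFaithfulTracialState φ) (hw : ∀ i, 0 ≤ w i) (n : ℕ) (a : ℕ → ℝ) :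
    ‖∑ k ∈ Finset.range n, (a k : ℂ) • (X k * X k - (w k : ℂ) • (1 : A))‖ ≤
      8 * √(∑ k ∈ Finset.range n, a k ^ 2 * w k ^ 2) := by
  have h1 := h.norm_wickForm_le hφ hw (Matrix.diagonal fun k : Fin n => (a k : ℂ))
  rw [wickForm_diagonal X (fun i => (w i : ℂ)) n (fun k => (a k : ℂ)), zero_smul, zero_add] at h1
  refine h1.trans (le_of_eq ?_)
  rw [← Fin.sum_univ_eq_sum_range (fun k => a k ^ 2 * w k ^ 2) n]
  congr 2
  refine Finset.sum_congr rfl fun i _ => ?_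
  rw [Finset.sum_eq_single i]
  · simp [sq]
  · intro j _ hj
    rw [Matrix.diagonal_apply_ne _ hj.symm]
    simp
  · simp

/-! ### Approximation by off-diagonal step functions -/

/-- The pair `(f, F)` is a limit of pairs (step function, its double Wigner integral), in `L²` of
the quadrant and in operator norm. -/
def IsNormWignerLimit {A : Type u} [CStarAlgebra A] (S : ℝ≥0 → A) (f : ℝ × ℝ → ℝ) (F : A) : Prop :=
  ∀ ε : ℝ, 0 < ε → ∃ g : OffDiagRect →₀ ℝ,
    eLpNorm (fun p => f p - stepFun g p) 2 quadrant ≤ ENNReal.ofReal ε ∧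
    ‖F - stepIntegral S g‖ ≤ ε

namespace IsNormWignerLimit

variable {A : Type u} [CStarAlgebra A] {S : ℝ≥0 → A}

theorem add {f f' : ℝ × ℝ → ℝ} {F F' : A} (hf : Measurable f) (hf' : Measurable f')
    (h : IsNormWignerLimit S f F) (h' : IsNormWignerLimit S f' F') :
    IsNormWignerLimit S (fun p => f p + f' p) (F + F') := by
  intro ε hε
  obtain ⟨g, h1, h2⟩ := h (ε / 2) (by positivity)
  obtain ⟨g', h1', h2'⟩ := h' (ε / 2) (by positivity)
  refine ⟨g + g', ?_, ?_⟩
  · have e : (fun p => f p + f' p - stepFun (g + g') p) =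
        (fun p => f p - stepFun g p) + fun p => f' p - stepFun g' p := by
      ext p
      rw [stepFun_add, Pi.add_apply]
      ring
    rw [e, ← add_halves ε, ENNReal.ofReal_add (by positivity) (by positivity)]
    exact (eLpNorm_add_le (hf.sub (measurable_stepFun g)).aestronglyMeasurable
      (hf'.sub (measurable_stepFun g')).aestronglyMeasurable (by norm_num)).trans
        (add_le_add h1 h1')
  · rw [stepIntegral_add, add_sub_add_comm]
    exact (norm_add_le _ _).trans (by linarith)

theorem smul {f : ℝ × ℝ → ℝ} {F : A} (h : IsNormWignerLimit S f F) (a : ℝ) :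
    IsNormWignerLimit S (fun p => a * f p) ((a : ℂ) • F) := by
  intro ε hε
  have ha : 0 < |a| + 1 := by positivity
  obtain ⟨g, h1, h2⟩ := h (ε / (|a| + 1)) (by positivity)
  have hle : |a| * (ε / (|a| + 1)) ≤ ε := by
    rw [mul_div_assoc', div_le_iff₀ ha]
    nlinarith
  refine ⟨a • g, ?_, ?_⟩
  · have e : (fun p => a * f p - stepFun (a • g) p) = a • fun p => f p - stepFun g p := by
      ext p
      rw [stepFun_smul, Pi.smul_apply, smul_eq_mul]
      ring
    rw [e, eLpNorm_const_smul, ← ofReal_norm, Real.norm_eq_abs]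
    calc ENNReal.ofReal |a| * eLpNorm (fun p => f p - stepFun g p) 2 quadrant
        ≤ ENNReal.ofReal |a| * ENNReal.ofReal (ε / (|a| + 1)) := by gcongr
      _ = ENNReal.ofReal (|a| * (ε / (|a| + 1))) := (ENNReal.ofReal_mul (abs_nonneg a)).symm
      _ ≤ ENNReal.ofReal ε := ENNReal.ofReal_le_ofReal hle
  · rw [stepIntegral_smul, ← smul_sub, norm_smul, Complex.norm_real, Real.norm_eq_abs]
    exact (mul_le_mul_of_nonneg_left h2 (abs_nonneg a)).trans hle

theorem isDoubleWignerIntegral {φ : A →ₗ[ℂ] ℂ} (hφ : IsTracialState φ) {f : ℝ × ℝ → ℝ} {F : A}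
    (hf : MemLp f 2 quadrant) (h : IsNormWignerLimit S f F) : IsDoubleWignerIntegral φ S f F := by
  refine .of_norm hφ hf fun ε hε => ?_
  obtain ⟨g, h1, h2⟩ := h (ε / 2) (by positivity)
  exact ⟨g, h1.trans_lt ((ENNReal.ofReal_lt_ofReal_iff hε).mpr (by linarith)), by linarith⟩

end IsNormWignerLimit

theorem stepFun_sum {ι : Type*} (s : Finset ι) (g : ι → OffDiagRect →₀ ℝ) (p : ℝ × ℝ) :
    stepFun (∑ i ∈ s, g i) p = ∑ i ∈ s, stepFun (g i) p := by
  induction s using Finset.cons_induction with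
  | empty => rfl
  | cons a s ha ih => rw [Finset.sum_cons, Finset.sum_cons, stepFun_add, ih]

theorem stepIntegral_sum {A : Type*} [CStarAlgebra A] (S : ℝ≥0 → A) {ι : Type*} (s : Finset ι)
    (g : ι → OffDiagRect →₀ ℝ) :
    stepIntegral S (∑ i ∈ s, g i) = ∑ i ∈ s, stepIntegral S (g i) := by
  induction s using Finset.cons_induction with
  | empty => rfl
  | cons a s ha ih => rw [Finset.sum_cons, Finset.sum_cons, stepIntegral_add, ih]

/-- The off-diagonal cells of the square `(t 0, t n]²`: the corresponding step function. -/
noncomputable def offDiagStep {t : ℕ → ℝ≥0} (ht : Monotone t) (n : ℕ) : OffDiagRect →₀ ℝ :=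
  ∑ i ∈ Finset.range n, ∑ j ∈ Finset.range n,
    if h : i = j then 0 else
      Finsupp.single ⟨t i, t (i + 1), t j, t (j + 1), ht i.le_succ, ht j.le_succ,
        ht.pairwise_disjoint_on_Ioc_succ h⟩ 1

theorem stepFun_offDiagStep {t : ℕ → ℝ≥0} (ht : Monotone t) (n : ℕ) (p : ℝ × ℝ) :
    stepFun (offDiagStep ht n) p =
      (∑ i ∈ Finset.range n, iocFun (t i) (t (i + 1)) p.1) *
        (∑ i ∈ Finset.range n, iocFun (t i) (t (i + 1)) p.2) -
      ∑ i ∈ Finset.range n, iocFun (t i) (t (i + 1)) p.1 * iocFun (t i) (t (i + 1)) p.2 := by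
  rw [offDiagStep, stepFun_sum, Finset.sum_mul_sum, ← Finset.sum_sub_distrib]
  refine Finset.sum_congr rfl fun i hi => ?_
  rw [stepFun_sum, eq_sub_iff_add_eq, ← Finset.sum_erase_add _ _ hi,
    ← Finset.sum_erase_add (Finset.range n)
      (fun j => iocFun (t i) (t (i + 1)) p.1 * iocFun (t j) (t (j + 1)) p.2) hi, dif_pos rfl]
  have h0 : stepFun 0 p = 0 := rfl
  rw [h0, add_zero]
  congr 1
  refine Finset.sum_congr rfl fun j hj => ?_
  rw [dif_neg (Finset.ne_of_mem_erase hj).symm, stepFun, Finsupp.sum_single_index (zero_mul _),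
    one_mul, OffDiagRect.indicator_toSet]

theorem stepIntegral_offDiagStep {A : Type*} [CStarAlgebra A] (S : ℝ≥0 → A) {t : ℕ → ℝ≥0}
    (ht : Monotone t) (n : ℕ) :
    stepIntegral S (offDiagStep ht n) = (S (t n) - S (t 0)) * (S (t n) - S (t 0)) -
      ∑ i ∈ Finset.range n, (S (t (i + 1)) - S (t i)) * (S (t (i + 1)) - S (t i)) := by
  rw [← Finset.sum_range_sub (fun i => S (t i)), offDiagStep, stepIntegral_sum,
    Finset.sum_mul_sum, ← Finset.sum_sub_distrib]
  refine Finset.sum_congr rfl fun i hi => ?_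
  rw [stepIntegral_sum, eq_sub_iff_add_eq, ← Finset.sum_erase_add _ _ hi,
    ← Finset.sum_erase_add (Finset.range n)
      (fun j => (S (t (i + 1)) - S (t i)) * (S (t (j + 1)) - S (t j))) hi, dif_pos rfl]
  have h0 : stepIntegral S 0 = 0 := rfl
  rw [h0, add_zero]
  congr 1
  refine Finset.sum_congr rfl fun j hj => ?_
  rw [dif_neg (Finset.ne_of_mem_erase hj).symm, stepIntegral,
    Finsupp.sum_single_index (by simp), Complex.ofReal_one, one_smul]

theorem sum_range_iocFun {t : ℕ → ℝ≥0} (ht : Monotone t) (n : ℕ) (x : ℝ) :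
    ∑ i ∈ Finset.range n, iocFun (t i) (t (i + 1)) x = iocFun (t 0) (t n) x := by
  rw [iocFun_eq_sub (ht (Nat.zero_le n)),
    ← Finset.sum_range_sub (fun i => if x ≤ t i then (1 : ℝ) else 0)]
  exact Finset.sum_congr rfl fun i _ => iocFun_eq_sub (ht i.le_succ) x

/-- The square of an increment over a unit interval, centered, is the double Wigner integral of
the indicator function of a square. -/
theorem IsFreeBrownianMotion.isNormWignerLimit_block {A : Type u} [CStarAlgebra A]
    {φ : A →ₗ[ℂ] ℂ} {S : ℝ≥0 → A} (hS : IsFreeBrownianMotion φ S)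
    (hφ : IsFaithfulTracialState φ) (s : ℝ≥0) :
    IsNormWignerLimit S (fun p => iocFun s (s + 1) p.1 * iocFun s (s + 1) p.2)
      ((S (s + 1) - S s) * (S (s + 1) - S s) - 1) := by
  intro ε hε
  -- The diagonal cells of the subdivision into `m` equal parts have total area `1 / m`.
  obtain ⟨m, hm⟩ := exists_nat_gt ((8 / ε) ^ 2)
  have hm0 : (0 : ℝ) < m := (by positivity : (0 : ℝ) ≤ (8 / ε) ^ 2).trans_lt hm
  have hmε : 1 / (m : ℝ) ≤ (ε / 8) ^ 2 := by
    rw [div_le_iff₀ hm0]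
    rw [div_pow, div_lt_iff₀ (by positivity)] at hm
    rw [div_pow]
    linarith
  set t : ℕ → ℝ≥0 := fun k => s + k / m with ht
  have hmono : Monotone t := by
    intro a b hab
    simp only [ht]
    gcongr
  have hw : ∀ k, (t (k + 1) : ℝ) - t k = 1 / m := by
    intro k
    simp only [ht]
    push_cast
    field_simp
    ring
  have ht0 : t 0 = s := by simp [ht]
  have htm : t m = s + 1 := by
    have : (m : ℝ≥0) ≠ 0 := by exact_mod_cast hm0.ne'
    simp [ht, this]
  set c : ℕ → ℝ := fun k => if k < m then 1 else 0 with hc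
  have hc0 : ∀ k, m ≤ k → c k = 0 := fun k hk => if_neg (by omega)
  have hcsum : ∑ k ∈ Finset.range m, c k ^ 2 * ((t (k + 1) : ℝ) - t k) ^ 2 = 1 / m := by
    have : ∀ k ∈ Finset.range m, c k ^ 2 * ((t (k + 1) : ℝ) - t k) ^ 2 = (1 / m) ^ 2 := by
      intro k hk
      rw [hw, hc]
      simp only
      rw [if_pos (Finset.mem_range.mp hk)]
      ring
    rw [Finset.sum_congr rfl this, Finset.sum_const, Finset.card_range, nsmul_eq_mul]
    field_simp
  have hcz : ∀ k ∉ Finset.range m, c k ^ 2 * ((t (k + 1) : ℝ) - t k) ^ 2 = 0 := by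
    intro k hk
    rw [hc0 k (by simpa using hk)]
    ring
  refine ⟨offDiagStep hmono m, ?_, ?_⟩
  · have e : (fun p : ℝ × ℝ => iocFun s (s + 1) p.1 * iocFun s (s + 1) p.2 -
        stepFun (offDiagStep hmono m) p) = diagFun t c := by
      ext p
      rw [stepFun_offDiagStep, sum_range_iocFun hmono, sum_range_iocFun hmono, ht0, htm,
        sub_sub_cancel, diagFun_eq_sum t hc0]
      refine Finset.sum_congr rfl fun k hk => ?_
      rw [hc]
      simp only
      rw [if_pos (Finset.mem_range.mp hk), one_mul]
    rw [e]
    refine eLpNorm_diagFun_le hmono (summable_of_ne_finset_zero hcz) hε.le ?_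
    rw [tsum_eq_sum hcz, hcsum]
    refine hmε.trans ?_
    gcongr
    linarith
  · have hfam := hS.isFreeSemicircularFamily hφ.map_one hmono
    have h1 := hfam.norm_sum_sq_le hφ (fun k => by rw [hw]; positivity) m c
    rw [hcsum] at h1
    have e : (S (s + 1) - S s) * (S (s + 1) - S s) - 1 - stepIntegral S (offDiagStep hmono m) =
        ∑ k ∈ Finset.range m, (c k : ℂ) • ((S (t (k + 1)) - S (t k)) * (S (t (k + 1)) - S (t k)) -
          (((t (k + 1) : ℝ) - t k : ℝ) : ℂ) • (1 : A)) := by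
      have e1 : ∀ k ∈ Finset.range m, (c k : ℂ) • ((S (t (k + 1)) - S (t k)) *
          (S (t (k + 1)) - S (t k)) - (((t (k + 1) : ℝ) - t k : ℝ) : ℂ) • (1 : A)) =
          (S (t (k + 1)) - S (t k)) * (S (t (k + 1)) - S (t k)) - ((1 / m : ℝ) : ℂ) • (1 : A) := by
        intro k hk
        rw [hw, hc]
        simp only
        rw [if_pos (Finset.mem_range.mp hk), Complex.ofReal_one, one_smul]
      rw [Finset.sum_congr rfl e1, Finset.sum_sub_distrib, stepIntegral_offDiagStep, ht0, htm,
        Finset.sum_const, Finset.card_range, ← Nat.cast_smul_eq_nsmul ℂ, smul_smul]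
      have e2 : (m : ℂ) * ((1 / m : ℝ) : ℂ) = 1 := by
        have : (m : ℂ) ≠ 0 := by exact_mod_cast hm0.ne'
        push_cast
        field_simp
      rw [e2, one_smul]
      abel
    rw [e]
    refine h1.trans ?_
    have h2 : √(1 / (m : ℝ)) ≤ ε / 8 := Real.sqrt_le_iff.mpr ⟨by positivity, hmε⟩
    linarith

/-! ### Double Wigner integrals with prescribed eigenvalues -/

/-- The Wigner integral of the kernel with the value `lam k` on `(k, k + 1]²` exists as an element
of the C*-algebra, for every square-summable sequence `lam`. -/
theorem IsFreeBrownianMotion.exists_integral_diag {A : Type u} [CStarAlgebra A]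
    {φ : A →ₗ[ℂ] ℂ} {S : ℝ≥0 → A} (hS : IsFreeBrownianMotion φ S)
    (hφ : IsFaithfulTracialState φ) {lam : ℕ → ℝ} (hlam : Summable fun k => lam k ^ 2) :
    ∃ (f : ℝ × ℝ → ℝ) (I : A), IsSymmL2 f ∧ IsDoubleWignerIntegral φ S f I ∧
      Tendsto (fun n => ∑ k ∈ Finset.range n, (lam k : ℂ) •
        ((S ((k + 1 : ℕ) : ℝ≥0) - S (k : ℝ≥0)) * (S ((k + 1 : ℕ) : ℝ≥0) - S (k : ℝ≥0)) - 1))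
        atTop (𝓝 I) := by
  set t : ℕ → ℝ≥0 := fun k => (k : ℝ≥0) with ht
  have hmono : Monotone t := Nat.mono_cast
  have hw : ∀ k, (t (k + 1) : ℝ) - t k = 1 := by
    intro k
    simp [ht]
  have hfam := hS.isFreeSemicircularFamily hφ.map_one hmono
  set Q : ℕ → A := fun k => (S (t (k + 1)) - S (t k)) * (S (t (k + 1)) - S (t k)) - 1 with hQ
  set J : ℕ → A := fun n => ∑ k ∈ Finset.range n, (lam k : ℂ) • Q k with hJ
  have hnorm : ∀ (n : ℕ) (a : ℕ → ℝ), ‖∑ k ∈ Finset.range n, (a k : ℂ) • Q k‖ ≤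
      8 * √(∑ k ∈ Finset.range n, a k ^ 2) := by
    intro n a
    have h1 := hfam.norm_sum_sq_le hφ (fun k => by rw [hw]; exact zero_le_one) n a
    simpa only [hw, Complex.ofReal_one, one_smul, one_pow, mul_one] using h1
  -- The `L²` norm of the tail of the kernel; up to the constant `8` it controls the tail of the
  -- integral in operator norm.
  set b : ℕ → ℝ := fun N => √(∑' k, lam (k + N) ^ 2) with hb
  have hb0 : Tendsto b atTop (𝓝 0) := by
    have h1 := tendsto_sum_nat_add fun k => lam k ^ 2
    have h2 := (Real.continuous_sqrt.tendsto 0).comp h1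
    rw [Real.sqrt_zero] at h2
    exact h2
  have htail : ∀ N, ∑' k, (if N ≤ k then lam k else 0) ^ 2 = ∑' k, lam (k + N) ^ 2 := by
    intro N
    have hs : Summable fun k => (if N ≤ k then lam k else 0) ^ 2 :=
      Summable.of_nonneg_of_le (fun k => sq_nonneg _) (fun k => by
        split_ifs
        · exact le_rfl
        · rw [zero_pow two_ne_zero]
          exact sq_nonneg _) hlam
    rw [← hs.sum_add_tsum_nat_add N, Finset.sum_eq_zero fun k hk => by
      rw [if_neg (by simpa using hk), zero_pow two_ne_zero], zero_add]
    simp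
  have hsumtail : ∀ N, Summable fun k => (if N ≤ k then lam k else 0) ^ 2 := fun N =>
    Summable.of_nonneg_of_le (fun k => sq_nonneg _) (fun k => by
      split_ifs
      · exact le_rfl
      · rw [zero_pow two_ne_zero]
        exact sq_nonneg _) hlam
  have hJdiff : ∀ N M, N ≤ M → ‖J M - J N‖ ≤ 8 * b N := by
    intro N M hNM
    have e : J M - J N = ∑ k ∈ Finset.range M, ((if N ≤ k then lam k else 0 : ℝ) : ℂ) • Q k := by
      simp only [hJ]
      rw [sub_eq_iff_eq_add, ← Finset.sum_range_add_sum_Ico _ hNM,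
        ← Finset.sum_range_add_sum_Ico (fun k => ((if N ≤ k then lam k else 0 : ℝ) : ℂ) • Q k) hNM,
        Finset.sum_eq_zero (s := Finset.range N) (f := fun k =>
          ((if N ≤ k then lam k else 0 : ℝ) : ℂ) • Q k), zero_add, add_comm]
      · congr 1
        refine Finset.sum_congr rfl fun k hk => ?_
        rw [if_pos (Finset.mem_Ico.mp hk).1]
      · intro k hk
        rw [if_neg (by simpa using hk), Complex.ofReal_zero, zero_smul]
    rw [e]
    refine (hnorm _ _).trans (mul_le_mul_of_nonneg_left (Real.sqrt_le_sqrt ?_) (by norm_num))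
    rw [← htail]
    exact (hsumtail N).sum_le_tsum _ fun k _ => sq_nonneg _
  have hcauchy : CauchySeq J := by
    refine cauchySeq_of_le_tendsto_0' (fun N => 8 * b N) (fun N M hNM => ?_)
      (by simpa using hb0.const_mul 8)
    rw [dist_comm, dist_eq_norm]
    exact hJdiff N M hNM
  obtain ⟨I, hI⟩ := cauchySeq_tendsto_of_complete hcauchy
  have hIdiff : ∀ N, ‖I - J N‖ ≤ 8 * b N := fun N =>
    le_of_tendsto ((hI.sub_const (J N)).norm)
      ((eventually_ge_atTop N).mono fun M hM => hJdiff N M hM)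
  have hJlim : ∀ n, IsNormWignerLimit S (diagFun t fun k => if k < n then lam k else 0) (J n) := by
    intro n
    induction n with
    | zero =>
      intro ε hε
      refine ⟨0, ?_, ?_⟩
      · have e : (fun p => diagFun t (fun k => if k < 0 then lam k else 0) p -
            stepFun 0 p) = 0 := by
          ext p
          have h0 : stepFun 0 p = 0 := rfl
          rw [h0]
          simp [diagFun]
        rw [e, eLpNorm_zero]
        exact zero_le
      · have h0 : stepIntegral S 0 = 0 := rfl
        rw [h0]
        simpa [hJ] using hε.le
    | succ n ih =>
      have e1 : diagFun t (fun k => if k < n + 1 then lam k else 0) = fun p =>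
          diagFun t (fun k => if k < n then lam k else 0) p +
            lam n * (iocFun (t n) (t n + 1) p.1 * iocFun (t n) (t n + 1) p.2) := by
        ext p
        rw [diagFun_eq_sum t (n := n + 1) (fun k hk => if_neg (by omega)),
          diagFun_eq_sum t (n := n) (fun k hk => if_neg (by omega)), Finset.sum_range_succ,
          if_pos (Nat.lt_succ_self n)]
        congr 1
        · refine Finset.sum_congr rfl fun k hk => ?_
          have hk' := Finset.mem_range.mp hk
          rw [if_pos hk', if_pos (by omega)]
        · simp [ht]
      have e2 : J (n + 1) = J n + (lam n : ℂ) •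
          ((S (t n + 1) - S (t n)) * (S (t n + 1) - S (t n)) - 1) := by
        simp only [hJ, hQ, Finset.sum_range_succ, ht, Nat.cast_succ]
      rw [e1, e2]
      refine ih.add (measurable_diagFun hmono _) ?_
        ((hS.isNormWignerLimit_block hφ (t n)).smul (lam n))
      have hm : Measurable (iocFun (t n) (t n + 1)) :=
        measurable_const.indicator measurableSet_Ioc
      exact ((hm.comp measurable_fst).mul (hm.comp measurable_snd)).const_mul _
  have hfsum : Summable fun k => lam k ^ 2 * ((t (k + 1) : ℝ) - t k) ^ 2 := by
    simpa only [hw, one_pow, mul_one] using hlam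
  have hmem : MemLp (diagFun t lam) 2 quadrant := by
    refine ⟨(measurable_diagFun hmono lam).aestronglyMeasurable, ?_⟩
    have h1 := eLpNorm_diagFun_sq hmono hfsum
    have h2 : eLpNorm (diagFun t lam) 2 quadrant ^ 2 < ∞ := h1 ▸ ENNReal.ofReal_lt_top
    exact (ENNReal.pow_lt_top_iff.mp h2).resolve_right two_ne_zero
  refine ⟨diagFun t lam, I, ⟨hmem, Eventually.of_forall fun p => diagFun_swap t lam p⟩, ?_, hI⟩
  refine IsNormWignerLimit.isDoubleWignerIntegral hφ.isTracialState hmem fun ε hε => ?_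
  obtain ⟨N, hN⟩ := (hb0.eventually (gt_mem_nhds (by positivity : 0 < ε / 16))).exists
  have hb_nonneg : 0 ≤ b N := Real.sqrt_nonneg _
  obtain ⟨g, h1, h2⟩ := hJlim N (ε / 2) (by positivity)
  refine ⟨g, ?_, ?_⟩
  · have e : (fun p => diagFun t lam p - stepFun g p) =
        diagFun t (fun k => if N ≤ k then lam k else 0) +
          fun p => diagFun t (fun k => if k < N then lam k else 0) p - stepFun g p := by
      ext p
      rw [Pi.add_apply, ← add_sub_assoc, ← diagFun_add hmono]
      congr 2
      ext k
      by_cases hk : k < N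
      · simp [hk, not_le.mpr hk]
      · simp [hk, not_lt.mp hk]
    have h3 : eLpNorm (diagFun t fun k => if N ≤ k then lam k else 0) 2 quadrant ≤
        ENNReal.ofReal (ε / 2) := by
      refine eLpNorm_diagFun_le hmono ?_ (by positivity) ?_
      · simpa only [hw, one_pow, mul_one] using hsumtail N
      · simp only [hw, one_pow, mul_one]
        rw [htail, ← Real.sq_sqrt (tsum_nonneg fun k => sq_nonneg (lam (k + N)))]
        exact pow_le_pow_left₀ hb_nonneg (by linarith) 2
    rw [e, ← add_halves ε, ENNReal.ofReal_add (by positivity) (by positivity)]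
    exact (eLpNorm_add_le (measurable_diagFun hmono _).aestronglyMeasurable
      ((measurable_diagFun hmono _).sub (measurable_stepFun g)).aestronglyMeasurable
      (by norm_num)).trans (add_le_add h3 h1)
  · rw [← sub_add_sub_cancel I (J N)]
    refine (norm_add_le _ _).trans ?_
    have := hIdiff N
    linarith

/-! ### Limit laws of the second chaos -/

theorem IsTracialState.continuous {A : Type u} [CStarAlgebra A] {φ : A →ₗ[ℂ] ℂ}
    (h : IsTracialState φ) : Continuous φ := by
  obtain ⟨C, -, hC⟩ := h.exists_norm_le
  exact AddMonoidHomClass.continuous_of_bound φ C hC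

theorem summable_pow_add_two {z : ℕ → ℝ} (hz : Summable fun k => z k ^ 2) (r : ℕ) :
    Summable fun k => z k ^ (r + 2) := by
  refine Summable.of_norm_bounded_eventually_nat hz ?_
  filter_upwards [hz.tendsto_atTop_zero.eventually_le_const zero_lt_one] with k hk
  have h1 : |z k| ≤ 1 := by
    rw [← sq_abs] at hk
    exact (sq_le_one_iff₀ (abs_nonneg _)).mp hk
  rw [Real.norm_eq_abs, abs_pow, pow_add, sq_abs]
  exact mul_le_of_le_one_left (sq_nonneg _) (pow_le_one₀ (abs_nonneg _) h1)

/-- The free cumulants of the sum of a semicircular variable of variance `s ^ 2` and a free variable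
`∑ₖ zₖ (Xₖ² - 1)`, with `Xₖ` free standard semicirculars; the index `r` stands for the cumulant
of order `r + 1`. -/
noncomputable def chaosCumulant (z : ℕ → ℝ) (s : ℝ) (r : ℕ) : ℂ :=
  if r = 0 then 0 else ((∑' k, z k ^ (r + 1) : ℝ) : ℂ) + if r = 1 then (s : ℂ) ^ 2 else 0

/-- Moments of elements of the second chaos are limits of moments of step integrals. -/
theorem IsFreeBrownianMotion.exists_stepIntegral_moments {A : Type u} [CStarAlgebra A]
    {φ : A →ₗ[ℂ] ℂ} {S : ℝ≥0 → A} (hS : IsFreeBrownianMotion φ S)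
    (hφ : IsFaithfulTracialState φ) {F : ℕ → A} (hF : ∀ n, F n ∈ secondWignerChaos φ S)
    {m : ℕ → ℂ} (hm : ∀ k, Tendsto (fun n => φ (F n ^ k)) atTop (𝓝 (m k))) :
    ∃ g : ℕ → OffDiagRect →₀ ℝ, (∀ n p, stepFun (g n) p.swap = stepFun (g n) p) ∧
      ∀ k, Tendsto (fun n => φ (stepIntegral S (g n) ^ k)) atTop (𝓝 (m k)) := by
  have hex : ∀ n : ℕ, ∃ g : OffDiagRect →₀ ℝ, (∀ p, stepFun g p.swap = stepFun g p) ∧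
      ∀ k ∈ Finset.range (n + 1),
        dist (φ (stepIntegral S g ^ k)) (φ (F n ^ k)) < 1 / ((n : ℝ) + 1) := by
    intro n
    have h1 : ∀ᶠ x in 𝓝 (F n), ∀ k ∈ Finset.range (n + 1),
        dist (φ (x ^ k)) (φ (F n ^ k)) < 1 / ((n : ℝ) + 1) := by
      rw [Filter.eventually_all_finset]
      intro k _
      exact (hφ.isTracialState.continuous.comp (continuous_pow k)).continuousAt.eventually
        (Metric.ball_mem_nhds _ Nat.one_div_pos_of_nat)
    obtain ⟨δ, hδ, h2⟩ := Metric.eventually_nhds_iff.mp h1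
    obtain ⟨g, hg, hgF⟩ := hS.exists_stepIntegral_near hφ (hF n) hδ
    exact ⟨g, hg, h2 (by rwa [dist_comm, dist_eq_norm])⟩
  choose g hg hgF using hex
  refine ⟨g, hg, fun k => (hm k).congr_dist ?_⟩
  refine squeeze_zero' (Eventually.of_forall fun n => dist_nonneg) ?_
    tendsto_one_div_add_atTop_nhds_zero_nat
  filter_upwards [eventually_ge_atTop k] with n hn
  rw [dist_comm]
  exact (hgF n k (Finset.mem_range.mpr (by omega))).le

/-- The cumulants of the integral of a symmetric step function are power sums. -/
theorem IsFreeBrownianMotion.exists_cumulants_stepIntegral {A : Type u} [CStarAlgebra A]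
    {φ : A →ₗ[ℂ] ℂ} {S : ℝ≥0 → A} (hS : IsFreeBrownianMotion φ S) (h1 : φ 1 = 1)
    {g : OffDiagRect →₀ ℝ} (hg : ∀ p, stepFun g p.swap = stepFun g p) :
    ∃ (n : ℕ) (lam : Fin n → ℝ), HasFreeCumulants (fun k => φ (stepIntegral S g ^ k))
      fun r => if r = 0 then 0 else ((∑ i, lam i ^ (r + 1) : ℝ) : ℂ) := by
  obtain ⟨t, n, ht⟩ := exists_isGridFor g
  have hc : (gridMatrix t n g).IsHermitian := by
    ext i j
    simp only [gridMatrix, Matrix.conjTranspose_apply, Matrix.of_apply, Complex.star_def,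
      Complex.conj_ofReal]
    rw [← hg, Prod.swap_prod_mk]
  obtain ⟨lam, -, hlam⟩ := exists_wickCumulant_eq hc (w := fun k => (t (k + 1) : ℝ) - t k)
    fun k => sub_nonneg.mpr (NNReal.coe_le_coe.mpr (ht.mono k.le_succ))
  refine ⟨n, lam, ?_⟩
  have h := (hS.isFreeSemicircularFamily h1 ht.mono).hasFreeCumulants_wickForm
    (gridMatrix t n g) 0
  rw [← ht.stepIntegral_eq] at h
  rwa [← funext hlam]

/-- The cumulants of a limit law of the second chaos are power sums, up to a semicircular term
which accounts for the square sums lost in the limit. -/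
theorem IsFreeBrownianMotion.exists_chaosCumulant {A : Type u} [CStarAlgebra A]
    {φ : A →ₗ[ℂ] ℂ} {S : ℝ≥0 → A} (hS : IsFreeBrownianMotion φ S)
    (hφ : IsFaithfulTracialState φ) {F : ℕ → A} (hF : ∀ n, F n ∈ secondWignerChaos φ S)
    {m : ℕ → ℂ} (hm : ∀ k, Tendsto (fun n => φ (F n ^ k)) atTop (𝓝 (m k))) :
    ∃ (z : ℕ → ℝ) (s : ℝ), (Summable fun k => z k ^ 2) ∧
      HasFreeCumulants m (chaosCumulant z s) := by
  obtain ⟨g, hg, hgm⟩ := hS.exists_stepIntegral_moments hφ hF hm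
  choose n lam hlam using fun a => hS.exists_cumulants_stepIntegral hφ.map_one (hg a)
  obtain ⟨κ, hκ, hmκ⟩ := HasFreeCumulants.tendsto hlam hgm
  have hre : ∀ r, Tendsto (fun a => ∑ i, lam a i ^ (r + 2)) atTop (𝓝 (κ (r + 1)).re) := by
    intro r
    have h1 := (Complex.continuous_re.tendsto _).comp (hκ (r + 1))
    refine h1.congr fun a => ?_
    rw [Function.comp_apply, if_neg r.succ_ne_zero, Complex.ofReal_re]
  have hreal : ∀ r, κ (r + 1) = ((κ (r + 1)).re : ℂ) := by
    intro r
    refine tendsto_nhds_unique (hκ (r + 1))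
      (((Complex.continuous_ofReal.tendsto _).comp (hre r)).congr fun a => ?_)
    rw [Function.comp_apply, if_neg r.succ_ne_zero]
  obtain ⟨z, s, hz, h0, h1⟩ := exists_limit_power_sums lam hre
  refine ⟨z, s, hz, ?_⟩
  have e : κ = chaosCumulant z s := by
    ext r
    obtain _ | _ | r := r
    · refine tendsto_nhds_unique (hκ 0) ?_
      simp [chaosCumulant]
    · rw [zero_add, ← zero_add 1, hreal, h0]
      simp [chaosCumulant, add_comm]
    · rw [hreal, h1]
      simp [chaosCumulant]
  rwa [← e]

/-! ### A free semicircular variable in the tracial ultrapower -/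

theorem IsSemicircular.smul {A : Type u} [CStarAlgebra A] {φ : A →ₗ[ℂ] ℂ} {a : A} {w : ℝ}
    (h : IsSemicircular φ a w) (s : ℝ) : IsSemicircular φ ((s : ℂ) • a) (s ^ 2 * w) := by
  refine ⟨IsSelfAdjoint.smul (Complex.conj_ofReal s) h.1, fun m => ⟨?_, ?_⟩⟩
  · rw [smul_pow, map_smul, (h.2 m).1, smul_eq_mul, Complex.ofReal_mul, mul_pow,
      Complex.ofReal_pow, ← pow_mul]
    ring
  · rw [smul_pow, map_smul, (h.2 m).2, smul_zero]

theorem IsFaithfulTracialState.norm_le_of_isSemicircular {A : Type u} [CStarAlgebra A]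
    {φ : A →ₗ[ℂ] ℂ} (hφ : IsFaithfulTracialState φ) {a : A} (h : IsSemicircular φ a 1) :
    ‖a‖ ≤ 2 := by
  refine hφ.norm_le_of_moments h.1 zero_le_two fun k => ?_
  obtain ⟨m, rfl | rfl⟩ := k.even_or_odd'
  · rw [(h.2 m).1, Complex.ofReal_one, one_pow, mul_one, Complex.norm_natCast, pow_mul]
    have h1 : catalan m ≤ 4 ^ m := by
      rw [catalan_eq_centralBinom_div]
      exact (Nat.div_le_self _ _).trans (Nat.centralBinom_le_four_pow m)
    norm_num
    exact_mod_cast h1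
  · rw [(h.2 m).2, norm_zero]
    positivity

theorem exists_finite_mem_adjoin {R B ι : Type*} [CommSemiring R] [Semiring B] [Algebra R B]
    (f : ι → B) (T : Set ι) {x : B} (hx : x ∈ Algebra.adjoin R (f '' T)) :
    ∃ T' ⊆ T, T'.Finite ∧ x ∈ Algebra.adjoin R (f '' T') := by
  induction hx using Algebra.adjoin_induction with
  | mem x hx =>
    obtain ⟨i, hi, rfl⟩ := hx
    exact ⟨{i}, by simpa using hi, Set.finite_singleton i,
      Algebra.subset_adjoin (Set.mem_image_of_mem f rfl)⟩
  | algebraMap r => exact ⟨∅, Set.empty_subset _, Set.finite_empty, Subalgebra.algebraMap_mem _ r⟩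
  | add x y _ _ hx hy =>
    obtain ⟨T₁, h1, f1, m1⟩ := hx
    obtain ⟨T₂, h2, f2, m2⟩ := hy
    exact ⟨T₁ ∪ T₂, Set.union_subset h1 h2, f1.union f2, add_mem
      (Algebra.adjoin_mono (Set.image_mono Set.subset_union_left) m1)
      (Algebra.adjoin_mono (Set.image_mono Set.subset_union_right) m2)⟩
  | mul x y _ _ hx hy =>
    obtain ⟨T₁, h1, f1, m1⟩ := hx
    obtain ⟨T₂, h2, f2, m2⟩ := hy
    exact ⟨T₁ ∪ T₂, Set.union_subset h1 h2, f1.union f2, mul_mem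
      (Algebra.adjoin_mono (Set.image_mono Set.subset_union_left) m1)
      (Algebra.adjoin_mono (Set.image_mono Set.subset_union_right) m2)⟩

/-- An increment is free from the past of the Brownian motion. -/
theorem IsFreeBrownianMotion.freelyIndependent_past {A : Type u} [CStarAlgebra A]
    {φ : A →ₗ[ℂ] ℂ} {S : ℝ≥0 → A} (hS : IsFreeBrownianMotion φ S) (h1 : φ 1 = 1)
    {a b : ℝ≥0} (hab : a ≤ b) :
    FreelyIndependent φ
      ![Algebra.adjoin ℂ {S b - S a}, Algebra.adjoin ℂ (S '' Set.Iic a)] := by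
  classical
  intro l hl hc hmem
  -- The elements at hand involve finitely many times, which lie on a grid together with `a`, `b`.
  have hT : ∀ x, ∃ T ⊆ Set.Iic a, T.Finite ∧ (x ∈ Algebra.adjoin ℂ (S '' Set.Iic a) →
      x ∈ Algebra.adjoin ℂ (S '' T)) := by
    intro x
    by_cases hx : x ∈ Algebra.adjoin ℂ (S '' Set.Iic a)
    · obtain ⟨T, h2, h3, h4⟩ := exists_finite_mem_adjoin S (Set.Iic a) hx
      exact ⟨T, h2, h3, fun _ => h4⟩
    · exact ⟨∅, Set.empty_subset _, Set.finite_empty, fun h => absurd h hx⟩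
  choose T hTa hTf hTx using hT
  have hfin : (⋃ p ∈ {p | p ∈ l}, T p.2).Finite := l.finite_toSet.biUnion fun p _ => hTf p.2
  obtain ⟨t, n, hmono, hstrict, ht0, hgrid⟩ := exists_grid (hfin.toFinset ∪ {a, b})
  obtain ⟨ka, hka, rfl⟩ := hgrid a (by simp)
  obtain ⟨kb, hkb, rfl⟩ := hgrid b (by simp)
  have hkab : ka ≤ kb := (hstrict.le_iff_le hka hkb).mp hab
  set X : ℕ → A := fun k => S (t (k + 1)) - S (t k) with hX
  -- Class `1` consists of the grid intervals before `a`.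
  set cl : ℕ → Fin 2 := fun k => if ka ≤ k then 0 else 1 with hcl
  refine (hS.isFreeSemicircularFamily h1 hmono).freelyIndependent_blocks cl l hl hc
    fun p hp => ⟨?_, (hmem p hp).2⟩
  obtain ⟨i, x⟩ := p
  have hx := (hmem _ hp).1
  fin_cases i
  · refine (Algebra.adjoin_le ?_ : Algebra.adjoin ℂ {S (t kb) - S (t ka)} ≤ _) hx
    have e := Finset.sum_Ico_eq_sub X hkab
    rw [hX, Finset.sum_range_sub (fun k => S (t k)), Finset.sum_range_sub (fun k => S (t k)),
      sub_sub_sub_cancel_right] at e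
    rw [Set.singleton_subset_iff, SetLike.mem_coe, ← e]
    refine Subalgebra.sum_mem _ fun k hk => Algebra.subset_adjoin ⟨k, ?_, rfl⟩
    simp [hcl, (Finset.mem_Ico.mp hk).1]
  · refine (Algebra.adjoin_le ?_ : Algebra.adjoin ℂ (S '' T x) ≤ _) (hTx x hx)
    rintro _ ⟨τ, hτ, rfl⟩
    obtain ⟨k, hk, rfl⟩ := hgrid τ (by
      simp only [Finset.mem_union, Set.Finite.mem_toFinset, Set.mem_iUnion]
      exact Or.inl ⟨_, hp, hτ⟩)
    have hkka : k ≤ ka := (hstrict.le_iff_le hk hka).mp (hTa x hτ)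
    have e := Finset.sum_range_sub (fun k => S (t k)) k
    rw [ht0, hS.zero, sub_zero] at e
    rw [SetLike.mem_coe, ← e]
    refine Subalgebra.sum_mem _ fun i hi => Algebra.subset_adjoin ⟨i, ?_, rfl⟩
    have : ¬ ka ≤ i := by
      have := Finset.mem_range.mp hi
      omega
    simpa [hcl] using this

open scoped BoundedContinuousFunction in
/-- Constant sequences, as a homomorphism into the algebra of bounded sequences. -/
def constSeq (A : Type u) [CStarAlgebra A] : A →⋆ₐ[ℂ] (ℕ →ᵇ A) where
  toFun x := BoundedContinuousFunction.const ℕ x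
  map_one' := rfl
  map_mul' _ _ := rfl
  map_zero' := rfl
  map_add' _ _ := rfl
  commutes' _ := rfl
  map_star' _ := rfl

open scoped BoundedContinuousFunction in
/-- The `n`-th term of a bounded sequence. -/
def evalSeq (A : Type u) [CStarAlgebra A] (n : ℕ) : (ℕ →ᵇ A) →ₐ[ℂ] A where
  toFun x := x n
  map_one' := rfl
  map_mul' _ _ := rfl
  map_zero' := rfl
  map_add' _ _ := rfl
  commutes' _ := rfl

open scoped BoundedContinuousFunction in
/-- In the tracial ultrapower, the class of the sequence of increments `S (n + 1) - S n` is a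
semicircular variable which is free from the Brownian motion: each increment is free from the past,
and finitely many times are eventually in the past. -/
theorem IsFreeBrownianMotion.exists_free_semicircular {A : Type u} [CStarAlgebra A]
    {φ : A →ₗ[ℂ] ℂ} {S : ℝ≥0 → A} (hS : IsFreeBrownianMotion φ S)
    (hφ : IsFaithfulTracialState φ) :
    ∃ (B : Type u) (_ : CStarAlgebra B) (ψ : B →ₗ[ℂ] ℂ) (j : A →⋆ₐ[ℂ] B) (a : B),
      IsFaithfulTracialState ψ ∧ (∀ x, ψ (j x) = φ x) ∧ IsSemicircular ψ a 1 ∧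
      FreelyIndependent ψ
        ![Algebra.adjoin ℂ {a}, Algebra.adjoin ℂ (Set.range fun t : ℝ≥0 => j (S t))] ∧
      ∀ (s : ℂ) (x : A) (k : ℕ), Tendsto
        (fun n : ℕ => φ ((s • (S ((n + 1 : ℕ) : ℝ≥0) - S (n : ℝ≥0)) + x) ^ k))
        (hyperfilter ℕ) (𝓝 (ψ ((s • a + j x) ^ k))) := by
  obtain ⟨ψ₀, hψ₀, hlim⟩ := hφ.isTracialState.exists_ultralimit (hyperfilter ℕ)
  obtain ⟨B, hB, ψ, π, hψ, hψπ⟩ := hψ₀.exists_faithful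
  have hle : (hyperfilter ℕ : Filter ℕ) ≤ atTop := Nat.hyperfilter_le_atTop
  set Z : ℕ → A := fun n => S ((n + 1 : ℕ) : ℝ≥0) - S (n : ℝ≥0) with hZ
  have hnn : ∀ n : ℕ, (n : ℝ≥0) ≤ ((n + 1 : ℕ) : ℝ≥0) := fun n => Nat.cast_le.mpr n.le_succ
  have hZs : ∀ n, IsSemicircular φ (Z n) 1 := by
    intro n
    have h := hS.semicircular _ _ (hnn n)
    have e : (((n + 1 : ℕ) : ℝ≥0) : ℝ) - ((n : ℝ≥0) : ℝ) = 1 := by simp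
    rwa [e] at h
  set Zb : ℕ →ᵇ A := BoundedContinuousFunction.ofNormedAddCommGroupDiscrete Z 2
    fun n => hφ.norm_le_of_isSemicircular (hZs n) with hZb
  have hZbn : ∀ n, evalSeq A n Zb = Z n := fun n => rfl
  have hψlim : ∀ x : ℕ →ᵇ A, Tendsto (fun n => φ (evalSeq A n x)) (hyperfilter ℕ)
      (𝓝 (ψ (π x))) := fun x => by
    rw [hψπ]
    exact hlim x
  have hj : ∀ x, ψ (π (constSeq A x)) = φ x := fun x =>
    tendsto_nhds_unique (hψlim _) tendsto_const_nhds
  have hmom : ∀ n k, φ (Z n ^ k) = φ (Z 0 ^ k) := by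
    intro n k
    obtain ⟨m, rfl | rfl⟩ := k.even_or_odd'
    · rw [((hZs n).2 m).1, ((hZs 0).2 m).1]
    · rw [((hZs n).2 m).2, ((hZs 0).2 m).2]
  have hψZ : ∀ k, ψ (π Zb ^ k) = φ (Z 0 ^ k) := by
    intro k
    refine tendsto_nhds_unique (f := fun n => φ (evalSeq A n (Zb ^ k))) (l := hyperfilter ℕ) ?_ ?_
    · rw [← map_pow]
      exact hψlim _
    · simp only [map_pow, hZbn, hmom]
      exact tendsto_const_nhds
  have hZsa : IsSelfAdjoint Zb := by
    ext n
    exact (hZs n).1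
  refine ⟨B, hB, ψ, π.comp (constSeq A), π Zb, hψ, hj, ⟨hZsa.map π, fun m => ?_⟩, ?_, ?_⟩
  · rw [hψZ, hψZ]
    exact (hZs 0).2 m
  · -- Elements of the two algebras lift to sequences in the corresponding algebras of `A`.
    -- Elements of the two algebras lift to sequences whose terms eventually lie in the algebras of
    -- an increment and of its past, with constant expectation.
    have key₀ : ∀ b ∈ Algebra.adjoin ℂ {π Zb}, ∃ x : ℕ →ᵇ A, π x = b ∧
        ∀ᶠ n : ℕ in atTop, evalSeq A n x ∈ Algebra.adjoin ℂ {Z n} ∧ φ (evalSeq A n x) = ψ b := by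
      intro b hb
      rw [Algebra.adjoin_singleton_eq_range_aeval] at hb
      obtain ⟨q, rfl⟩ := hb
      have hq : ∀ n, evalSeq A n (Polynomial.aeval Zb q) = Polynomial.aeval (Z n) q := fun n => by
        rw [← Polynomial.aeval_algHom_apply, hZbn]
      refine ⟨Polynomial.aeval Zb q, ?_, Eventually.of_forall fun n => ⟨?_, ?_⟩⟩
      · exact (Polynomial.aeval_algHom_apply π.toAlgHom Zb q).symm
      · rw [hq, Algebra.adjoin_singleton_eq_range_aeval]
        exact ⟨q, rfl⟩
      · rw [hq, Polynomial.aeval_eq_sum_range]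
        change _ = ψ (Polynomial.aeval (π Zb) q)
        rw [Polynomial.aeval_eq_sum_range]
        simp only [map_sum, map_smul, hmom, hψZ]
    have key₁ : ∀ b ∈ Algebra.adjoin ℂ (Set.range fun t : ℝ≥0 => π (constSeq A (S t))),
        ∃ x : ℕ →ᵇ A, π x = b ∧ ∀ᶠ n : ℕ in atTop,
          evalSeq A n x ∈ Algebra.adjoin ℂ (S '' Set.Iic (n : ℝ≥0)) ∧
            φ (evalSeq A n x) = ψ b := by
      intro b hb
      have e : (Set.range fun t : ℝ≥0 => π (constSeq A (S t))) =
          (π.comp (constSeq A)).toAlgHom '' Set.range S := by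
        rw [← Set.range_comp]
        rfl
      rw [e, ← AlgHom.map_adjoin] at hb
      obtain ⟨y, hy, rfl⟩ := hb
      rw [← Set.image_univ] at hy
      obtain ⟨T, -, hT, hyT⟩ := exists_finite_mem_adjoin S _ hy
      obtain ⟨τ, hτ⟩ := hT.bddAbove
      obtain ⟨N, hN⟩ := exists_nat_ge τ
      refine ⟨constSeq A y, rfl, (eventually_ge_atTop N).mono fun n hn => ⟨?_, (hj y).symm⟩⟩
      refine Algebra.adjoin_mono (Set.image_mono fun u hu => ?_) hyT
      exact (hτ hu).trans (hN.trans (Nat.cast_le.mpr hn))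
    have key : ∀ p : Fin 2 × B, p.2 ∈ (![Algebra.adjoin ℂ {π Zb},
          Algebra.adjoin ℂ (Set.range fun t : ℝ≥0 => π (constSeq A (S t)))] :
            Fin 2 → Subalgebra ℂ B) p.1 →
        ∃ x : ℕ →ᵇ A, π x = p.2 ∧ ∀ᶠ n : ℕ in atTop, evalSeq A n x ∈
          (![Algebra.adjoin ℂ {Z n}, Algebra.adjoin ℂ (S '' Set.Iic (n : ℝ≥0))] :
            Fin 2 → Subalgebra ℂ A) p.1 ∧ φ (evalSeq A n x) = ψ p.2 := by
      rintro ⟨i, b⟩ hb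
      fin_cases i
      · exact key₀ b hb
      · exact key₁ b hb
    choose! x hxπ hxn using key
    intro l hl hc hmem
    have e : (l.map Prod.snd).prod = π (l.map x).prod := by
      rw [map_list_prod, List.map_map]
      congr 1
      exact List.map_congr_left fun p hp => (hxπ p (hmem p hp).1).symm
    rw [e]
    refine tendsto_nhds_unique (hψlim _) (tendsto_const_nhds.congr' ?_)
    have hall : ∀ᶠ n : ℕ in atTop, ∀ p ∈ l, evalSeq A n (x p) ∈
        (![Algebra.adjoin ℂ {Z n}, Algebra.adjoin ℂ (S '' Set.Iic (n : ℝ≥0))] :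
          Fin 2 → Subalgebra ℂ A) p.1 ∧ φ (evalSeq A n (x p)) = ψ p.2 :=
      (Filter.eventually_all_finite l.finite_toSet).mpr fun p hp => hxn p (hmem p hp).1
    filter_upwards [hle hall] with n hn
    have h := hS.freelyIndependent_past hφ.map_one (hnn n)
      (l.map fun p => (p.1, evalSeq A n (x p))) (by simpa using hl)
      ((List.isChain_map _).mpr hc) (by
        intro p hp
        obtain ⟨q, hq, rfl⟩ := List.mem_map.mp hp
        exact ⟨(hn q hq).1, (hn q hq).2.trans (hmem q hq).2⟩)
    rw [map_list_prod, List.map_map]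
    rw [List.map_map] at h
    exact h.symm
  · intro s x k
    have h := hψlim ((s • Zb + constSeq A x) ^ k)
    simp only [map_pow, map_add, map_smul] at h
    exact h

theorem FreelyIndependent.adjoin_smul {A : Type u} [Ring A] [Algebra ℂ A] {φ : A →ₗ[ℂ] ℂ} {a : A}
    {M : Subalgebra ℂ A} (h : FreelyIndependent φ ![Algebra.adjoin ℂ {a}, M]) (s : ℂ) :
    FreelyIndependent φ ![Algebra.adjoin ℂ {s • a}, M] := by
  have hle : Algebra.adjoin ℂ {s • a} ≤ Algebra.adjoin ℂ {a} :=
    Algebra.adjoin_le (Set.singleton_subset_iff.mpr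
      (Subalgebra.smul_mem _ (Algebra.self_mem_adjoin_singleton ℂ a) s))
  have hle' : ∀ i, (![Algebra.adjoin ℂ {s • a}, M] : Fin 2 → Subalgebra ℂ A) i ≤
      (![Algebra.adjoin ℂ {a}, M] : Fin 2 → Subalgebra ℂ A) i := by
    rw [Fin.forall_fin_two]
    exact ⟨hle, le_refl M⟩
  exact fun l hl hc hmem => h l hl hc fun p hp => ⟨hle' p.1 (hmem p hp).1, (hmem p hp).2⟩

/-! ### The limit law -/

theorem tendsto_pow_sub_pow {α R : Type*} [NormedRing R] {l : Filter α} {u v : α → R} {M : ℝ}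
    (hu : ∀ n, ‖u n‖ ≤ M) (h : Tendsto (fun n => v n - u n) l (𝓝 0)) (k : ℕ) :
    Tendsto (fun n => v n ^ k - u n ^ k) l (𝓝 0) := by
  have hb : ∀ k, IsBoundedUnder (· ≤ ·) l ((‖·‖) ∘ fun n => u n ^ (k + 1)) := fun k =>
    isBoundedUnder_of ⟨M ^ (k + 1), fun n => (norm_pow_le' _ k.succ_pos).trans
      (pow_le_pow_left₀ (norm_nonneg _) (hu n) _)⟩
  induction k with
  | zero => simpa using tendsto_const_nhds
  | succ k ih =>
    have h1 : Tendsto (fun n => (v n ^ k - u n ^ k) * (v n - u n)) l (𝓝 0) := by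
      simpa using ih.mul h
    have h2 := ih.zero_mul_isBoundedUnder_le (hb 0)
    have h3 : Tendsto (fun n => u n ^ k * (v n - u n)) l (𝓝 0) := by
      cases k with
      | zero => simpa using h
      | succ k => exact isBoundedUnder_le_mul_tendsto_zero (hb k) h
    refine (((h1.add h2).add h3).congr fun n => ?_).trans (by simp)
    simp only [pow_succ, zero_add, pow_zero, one_mul]
    noncomm_ring

/-- The cumulants of a semicircular variable plus a free Wick-ordered sum of squares. -/
theorem IsFreeBrownianMotion.hasFreeCumulants_chaos {A : Type u} [CStarAlgebra A]
    {φ : A →ₗ[ℂ] ℂ} {S : ℝ≥0 → A} (hS : IsFreeBrownianMotion φ S)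
    (hφ : IsFaithfulTracialState φ) {z : ℕ → ℝ} (hz : Summable fun k => z k ^ 2) (s : ℝ) {I : A}
    (hI : Tendsto (fun n => ∑ k ∈ Finset.range n, (z k : ℂ) •
      ((S ((k + 1 : ℕ) : ℝ≥0) - S (k : ℝ≥0)) * (S ((k + 1 : ℕ) : ℝ≥0) - S (k : ℝ≥0)) - 1))
      atTop (𝓝 I)) {l : Filter ℕ} [l.NeBot] (hl : l ≤ atTop) {m : ℕ → ℂ}
    (hm : ∀ k, Tendsto
      (fun n : ℕ => φ (((s : ℂ) • (S ((n + 1 : ℕ) : ℝ≥0) - S (n : ℝ≥0)) + I) ^ k)) l (𝓝 (m k))) :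
    HasFreeCumulants m (chaosCumulant z s) := by
  set t : ℕ → ℝ≥0 := fun k => (k : ℝ≥0) with ht
  set w : ℕ → ℝ := fun k => (t (k + 1) : ℝ) - t k with hw
  have hw1 : w = fun _ => 1 := by
    ext k
    simp [hw, ht]
  have hfam := hS.isFreeSemicircularFamily hφ.map_one (t := t) Nat.mono_cast
  set X : ℕ → A := fun k => S (t (k + 1)) - S (t k) with hX
  have h1 : ∀ n, HasFreeCumulants
      (fun k => φ (wickForm X (fun i => w i) (Matrix.diagonal fun k : Fin n => (z k : ℂ)) s ^ k))
      (wickCumulant (fun i => w i) (Matrix.diagonal fun k : Fin n => (z k : ℂ)) s) :=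
    fun n => hfam.hasFreeCumulants_wickForm _ _
  have hXn : ∀ n, ‖X n‖ ≤ 2 := by
    intro n
    refine hφ.norm_le_of_isSemicircular ?_
    have := hfam.semicircular n
    rwa [show ((t (n + 1) : ℝ) - t n) = 1 from congrFun hw1 n] at this
  have h2 : ∀ k, Tendsto (fun n => φ (wickForm X (fun i => w i)
      (Matrix.diagonal fun k : Fin n => (z k : ℂ)) s ^ k)) l (𝓝 (m k)) := by
    intro k
    have hu : ∀ n, ‖(s : ℂ) • X n + I‖ ≤ ‖(s : ℂ)‖ * 2 + ‖I‖ := fun n =>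
      (norm_add_le _ _).trans (by rw [norm_smul]; gcongr; exact hXn n)
    have hsub : Tendsto (fun n => wickForm X (fun i => w i)
        (Matrix.diagonal fun k : Fin n => (z k : ℂ)) s - ((s : ℂ) • X n + I)) l (𝓝 0) := by
      have h3 := (hI.mono_left hl).sub_const I
      rw [sub_self] at h3
      refine h3.congr fun n => ?_
      rw [wickForm_diagonal X _ n (fun k => (z k : ℂ)), add_sub_add_left_eq_sub]
      simp [hX, ht, hw1]
    have h3 := (hφ.isTracialState.continuous.tendsto 0).comp (tendsto_pow_sub_pow hu hsub k)
    rw [map_zero] at h3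
    have h4 := h3.add (hm k)
    rw [zero_add] at h4
    refine h4.congr fun n => ?_
    rw [Function.comp_apply, map_sub]
    exact sub_add_cancel _ _
  obtain ⟨κ, hκ, hmκ⟩ := HasFreeCumulants.tendsto h1 h2
  have e : κ = chaosCumulant z s := by
    ext r
    refine tendsto_nhds_unique (hκ r) ?_
    simp only [hw1, wickCumulant, chaosCumulant]
    by_cases hr : r = 0
    · simp [hr]
    simp only [if_neg hr]
    refine Tendsto.add ?_ ?_
    · obtain ⟨r, rfl⟩ := Nat.exists_eq_succ_of_ne_zero hr
      have h3 := (summable_pow_add_two hz r).hasSum.tendsto_sum_nat.mono_left hl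
      refine ((Complex.continuous_ofReal.tendsto _).comp h3).congr fun n => ?_
      rw [Function.comp_apply, Matrix.diagonal_mul_diagonal, Matrix.diagonal_pow,
        Matrix.trace_diagonal, ← Fin.sum_univ_eq_sum_range (fun k => z k ^ (r + 2))]
      simp
    · simp
  rwa [← e]

end FreeProb

theorem mainTheorem3 {A : Type u} [CStarAlgebra A] (φ : A →ₗ[ℂ] ℂ)
    (hφ : FreeProb.IsFaithfulTracialState φ)
    (S : ℝ≥0 → A) (hS : FreeProb.IsFreeBrownianMotion φ S)
    (F : ℕ → A) (hF : ∀ n, F n ∈ FreeProb.secondWignerChaos φ S)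
    {C : Type v} [Ring C] [Algebra ℂ C] (τ : C →ₗ[ℂ] ℂ) (hτ : τ 1 = 1) (Finf : C)
    (hlim : FreeProb.ConvergesInLaw φ F τ Finf) :
    ∃ (lam0 : ℝ) (f : ℝ × ℝ → ℝ) (I : A),
      FreeProb.IsSymmL2 f ∧ FreeProb.IsDoubleWignerIntegral φ S f I ∧
      ∃ (B : Type u) (_ : CStarAlgebra B) (ψ : B →ₗ[ℂ] ℂ) (j : A →⋆ₐ[ℂ] B) (a : B),
        FreeProb.IsFaithfulTracialState ψ ∧ (∀ x : A, ψ (j x) = φ x) ∧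
        FreeProb.IsSemicircular ψ a (lam0 ^ 2) ∧
        FreeProb.FreelyIndependent ψ
          ![Algebra.adjoin ℂ {a}, Algebra.adjoin ℂ (Set.range fun t : ℝ≥0 => j (S t))] ∧
        FreeProb.EqualInLaw τ Finf ψ (a + j I) := by
  obtain ⟨z, s, hz, hm⟩ := hS.exists_chaosCumulant hφ hF hlim
  obtain ⟨f, I, hf, hfI, hI⟩ := hS.exists_integral_diag hφ hz
  obtain ⟨B, hB, ψ, j, a, hψ, hj, ha, hfree, hlimψ⟩ := hS.exists_free_semicircular hφ
  refine ⟨s, f, I, hf, hfI, B, hB, ψ, j, (s : ℂ) • a, hψ, hj, ?_, ?_, fun k => ?_⟩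
  · have h := ha.smul s
    rwa [mul_one] at h
  · exact hfree.adjoin_smul s
  · have h := hS.hasFreeCumulants_chaos hφ hz s hI Nat.hyperfilter_le_atTop (hlimψ s I)
    exact congrFun (hm.unique h) k
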